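/- Let $L=\{P,Q,H,<,\wedge\}$ with unary predicates $P,Q$, a unary function symbol $H$, a binary relation symbol $<$ and a binary function symbol $\wedge$. Let $T^{\forall}$ be the universal $L$-theory saying: $P\cap Q=\emptyset$; $H$ maps $P$ into $Q$ and is the identity outside $P$; $<$ is a strict partial order on $P$ (and relates only elements of $P$) in which the elements below a given one are linearly ordered; for $x,y\in P$, $x\wedge y$ is the greatest common lower bound of $x$ and $y$, and $x\wedge y=x$ if $x$ and $y$ are not both in $P$. Conventions. For a model $M$ of a theory $T$, let $\mathfrak C\succ M$ be any $|M|^{+}$-saturated elementary extension (the monster model), and let $S(M)$ be the set of complete types over $M$ in finitely many variables. For $p\in S(M)$ let $\mathrm{uf}(p)$ be the set of co-heirs of $p$: complete types $q$ over $\mathfrak C$ extending $p$ such that every formula $\varphi(x,b)\in q$ is realized in $M$. For a finite set $\Delta$ of formulas $\varphi(x;y)$ let $\mathrm{uf}_\Delta(p)$ be the set of complete $\Delta$-types $q$ over $\mathfrak C$ such that $q\cup p$ is finitely satisfiable in $M$. $T$ has small directionality if $\mathrm{uf}_\Delta(p)$ is finite for all $M\models T$, $p\in S(M)$ and finite $\Delta$;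 it has medium directionality if for every cardinal $\lambda\ge|T|$ (where $|T|=|L|+\aleph_0$) $$\lambda=\sup\{|\mathrm{uf}_\Delta(p)| : p\in S(M),\ \Delta\text{ finite},\ M\models T,\ |M|=\lambda\}.$$ $T$ is dependent if no formula has the independence property in a model of $T$. A model completion of $T^{\forall}$ is a theory $T$ all of whose models are models of $T^{\forall}$, such that every model of $T^{\forall}$ embeds into a model of $T$, and such that for every $A\models T^{\forall}$ any two models of $T$ extending $A$ are elementarily equivalent over $A$. Proposition. $T^{\forall}$ has a model completion, and any model completion $T$ of $T^{\forall}$ satisfies the following. (1) $T$ is dependent. (2) $T$ has medium directionality. (3) Let $M\models T$. Some $p\in S(M)$ in one variable has at least $|Q^{M}|$ co-heirs. More precisely, for every branch (maximal linearly ordered subset) $B$ of $P^{M}$ and every $m\in Q^{M}$ there is a complete $1$-type $p$ over $M$ containing $\{b<x : b\in B\}\cup\{H(x)=m\}$, and each such $p$ satisfies $|\mathrm{uf}(p)|\ge|Q^{M}|$. (4) For every $M\models T$ and $p\in S(M)$, $|\mathrm{uf}(p)|\le|M|^{\aleph_0}$. (5) The theory $T'$ of all consequences of $T$ in the language $L\setminus\{H\}$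 has small directionality. -/

import Mathlib

open FirstOrder FirstOrder.Language Cardinal

universe u

namespace Directionality

/-! ### Types, co-heirs and directionality

Languages are small (`Language.{0, 0}`), models live in an arbitrary universe `Type u`.
A formula in the variables `x = (x_0, …, x_{n-1})` with parameters in `A` is represented by
an element of `L.Formula (Fin n ⊕ A)`, in which the variable `Sum.inr a` stands for the
parameter `a` and is always interpreted by `a` itself. -/

section General

variable {L : FirstOrder.Language.{0, 0}}

/-- Finite satisfiability of a set `Γ(x)` of formulas over `C` in a subset, given as the range of
`f : A → C`: every finite subset of `Γ` is realized by a tuple coming from `A`. -/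
def FinSatIn {A C : Type u} [L.Structure C] (f : A → C) {n : ℕ}
    (Γ : Set (L.Formula (Fin n ⊕ C))) : Prop :=
  ∀ s : Finset (L.Formula (Fin n ⊕ C)), (s : Set (L.Formula (Fin n ⊕ C))) ⊆ Γ →
    ∃ a : Fin n → A, ∀ φ ∈ s, φ.Realize (Sum.elim (fun i => f (a i)) id)

/-- The space `S_n(M)` of complete `n`-types over a structure `M`. A set of formulas over `M` is
consistent with the elementary diagram of `M` iff it is finitely satisfiable in `M`. -/
def completeTypes (L : FirstOrder.Language.{0, 0}) (M : Type u) [L.Structure M] (n : ℕ) :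
    Set (Set (L.Formula (Fin n ⊕ M))) :=
  {p | FinSatIn (id : M → M) p ∧ ∀ φ : L.Formula (Fin n ⊕ M), φ ∈ p ∨ φ.not ∈ p}

/-- A formula over `M`, seen as a formula over `C` along `f : M → C`. -/
def mapParams {M C : Type u} (f : M → C) {n : ℕ} (φ : L.Formula (Fin n ⊕ M)) :
    L.Formula (Fin n ⊕ C) :=
  Formula.relabel (Sum.map id f) φ

/-- `C` is `κ`-saturated: every set of formulas in finitely many variables over fewer than `κ`
parameters which is finitely satisfiable in `C` is realized in `C`. -/
def IsSaturated (L : FirstOrder.Language.{0, 0}) (κ : Cardinal.{u}) (C : Type u) [L.Structure C] : Prop :=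
  ∀ A : Set C, #A < κ → ∀ (n : ℕ) (Γ : Set (L.Formula (Fin n ⊕ A))),
    FinSatIn (id : C → C) (mapParams ((↑) : A → C) '' Γ) →
      ∃ a : Fin n → C, ∀ φ ∈ Γ, φ.Realize (Sum.elim a (↑))

/-- `C` serves as a monster model around `M`: it is an `|M|⁺`-saturated elementary extension. -/
def IsMonsterOver {M C : Type u} [L.Structure M] [L.Structure C] (_f : M ↪ₑ[L] C) : Prop :=
  IsSaturated L (Order.succ #M) C

/-- `uf(p)`: the complete types over the monster model `C` that extend `p` and are co-heirs
over `M`, i.e. each of their formulas `φ(x, b)` is realized by a tuple from `M`. -/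
def coheirs {M C : Type u} [L.Structure M] [L.Structure C] (f : M ↪ₑ[L] C) {n : ℕ}
    (p : Set (L.Formula (Fin n ⊕ M))) : Set (Set (L.Formula (Fin n ⊕ C))) :=
  {q | q ∈ completeTypes L C n ∧ mapParams f '' p ⊆ q ∧
    ∀ φ ∈ q, ∃ a : Fin n → M, φ.Realize (Sum.elim (fun i => f (a i)) id)}

/-- The instance `φ(x, b)` of a partitioned formula `φ(x; y)`. The tuple `y` is taken from a
countable supply of variables, of which a formula uses finitely many. -/
def inst {C : Type u} {n : ℕ} (φ : L.Formula (Fin n ⊕ ℕ)) (b : ℕ → C) :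
    L.Formula (Fin n ⊕ C) :=
  Formula.relabel (Sum.map id b) φ

/-- `L_Δ(C)`: the formulas `φ(x, b)` and `¬ φ(x, b)` with `φ(x; y) ∈ Δ` and `b` in `C`. -/
def deltaFormulas (C : Type u) {n : ℕ} (Δ : Set (L.Formula (Fin n ⊕ ℕ))) :
    Set (L.Formula (Fin n ⊕ C)) :=
  {ψ | ∃ φ ∈ Δ, ∃ b : ℕ → C, ψ = inst φ b ∨ ψ = (inst φ b).not}

/-- `S_Δ(C)`: the complete `L_Δ(C)`-types over `C`. -/
def deltaTypes (C : Type u) [L.Structure C] {n : ℕ} (Δ : Set (L.Formula (Fin n ⊕ ℕ))) :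
    Set (Set (L.Formula (Fin n ⊕ C))) :=
  {q | q ⊆ deltaFormulas C Δ ∧ FinSatIn (id : C → C) q ∧
    ∀ φ ∈ Δ, ∀ b : ℕ → C, inst φ b ∈ q ∨ (inst φ b).not ∈ q}

/-- `uf_Δ(p)`: the `q ∈ S_Δ(C)` such that `q ∪ p` is finitely satisfiable in `M`. -/
def deltaCoheirs {M C : Type u} [L.Structure M] [L.Structure C] (f : M ↪ₑ[L] C) {n : ℕ}
    (Δ : Set (L.Formula (Fin n ⊕ ℕ))) (p : Set (L.Formula (Fin n ⊕ M))) :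
    Set (Set (L.Formula (Fin n ⊕ C))) :=
  {q | q ∈ deltaTypes C Δ ∧ FinSatIn f (q ∪ mapParams f '' p)}

/-- Small directionality: `uf_Δ(p)` is finite for all finite `Δ`, `M ⊨ T` and `p ∈ S(M)`. -/
def IsSmall (T : L.Theory) : Prop :=
  ∀ (M C : Type u) [L.Structure M] [L.Structure C] [Nonempty M] [M ⊨ T] (f : M ↪ₑ[L] C),
    IsMonsterOver f → ∀ (n : ℕ), ∀ p ∈ completeTypes L M n,
      ∀ Δ : Set (L.Formula (Fin n ⊕ ℕ)), Δ.Finite → (deltaCoheirs f Δ p).Finite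

/-- The cardinals `|uf_Δ(p)|` for `p ∈ S(M)`, `Δ` finite, `M ⊨ T` and `|M| = κ`. -/
def ufCards (T : L.Theory) (κ : Cardinal.{u}) : Set Cardinal.{u} :=
  {c | ∃ (M C : Type u) (_ : L.Structure M) (_ : L.Structure C) (f : M ↪ₑ[L] C) (n : ℕ)
    (p : Set (L.Formula (Fin n ⊕ M))) (Δ : Set (L.Formula (Fin n ⊕ ℕ))),
    Nonempty M ∧ M ⊨ T ∧ #M = κ ∧ IsMonsterOver f ∧ p ∈ completeTypes L M n ∧ Δ.Finite ∧
      c = #(deltaCoheirs f Δ p)}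

/-- Medium directionality: `κ = sup {|uf_Δ(p)| : p ∈ S(M), Δ finite, |M| = κ}` for every
`κ ≥ |T|`, where `|T|` is the number of formulas, `max(ℵ₀, |L|)`. -/
def IsMedium (T : L.Theory) : Prop :=
  ∀ κ : Cardinal.{u}, max ℵ₀ (Cardinal.lift.{u} L.card) ≤ κ → IsLUB (ufCards T κ) κ

/-- `T` is dependent (NIP): no formula `φ(x, y)` has the independence property in a model. -/
def IsDependent (T : L.Theory) : Prop :=
  ∀ (M : Type u) [L.Structure M] [Nonempty M] [M ⊨ T] (k l : ℕ)
    (φ : L.Formula (Fin k ⊕ Fin l)),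
    ¬ ∃ (a : ℕ → Fin k → M) (b : Set ℕ → Fin l → M),
      ∀ (i : ℕ) (s : Set ℕ), φ.Realize (Sum.elim (a i) (b s)) ↔ i ∈ s

/-- `T` is a model completion of `T₀`: models of `T` are models of `T₀`, every model of `T₀`
embeds into a model of `T`, and for every `A ⊨ T₀` the theory `T ∪ Diag(A)` is complete, i.e. any
two models of `T` that extend `A` are elementarily equivalent over `A`. -/
structure IsModelCompletion (T T₀ : L.Theory) : Prop where
  model_of_model : ∀ (M : Type u) [L.Structure M] [Nonempty M], M ⊨ T → M ⊨ T₀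
  exists_embedding : ∀ (A : Type u) [L.Structure A] [Nonempty A], A ⊨ T₀ →
    ∃ (M : Type u) (_ : L.Structure M), M ⊨ T ∧ Nonempty (A ↪[L] M)
  equivalent_over : ∀ (A M N : Type u) [L.Structure A] [L.Structure M] [L.Structure N]
    [Nonempty A], A ⊨ T₀ → M ⊨ T → N ⊨ T → ∀ (f : A ↪[L] M) (g : A ↪[L] N) (φ : L.Formula A),
      φ.Realize (fun a => f a) ↔ φ.Realize (fun a => g a)

/-- The restriction of a theory to a smaller language: its consequences there. -/
def restrict {L₀ : FirstOrder.Language.{0, 0}} (i : L₀ →ᴸ L) (T : L.Theory) : L₀.Theory :=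
  {φ | T ⊨ᵇ i.onSentence φ}

end General

/-! ### A tree with a function to a set without structure -/

/-- Function symbols of the full language: the meet `∧` of the tree and the function `H`. -/
inductive Func : ℕ → Type
  | meet : Func 2
  | H : Func 1

/-- The only function symbol of the language without `H`. -/
inductive Func' : ℕ → Type
  | meet : Func' 2

/-- Relation symbols: the predicates `P`, `Q` and the tree order. -/
inductive Rel : ℕ → Type
  | P : Rel 1
  | Q : Rel 1
  | lt : Rel 2

/-- The language `{P, Q, H, <, ∧}`. -/
def lang : FirstOrder.Language.{0, 0} := ⟨Func, Rel⟩

/-- The language `{P, Q, <, ∧}`. -/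
def lang' : FirstOrder.Language.{0, 0} := ⟨Func', Rel⟩

/-- The inclusion of the language without `H`. -/
def incl : lang' →ᴸ lang where
  onFunction := fun _ s => match s with
    | Func'.meet => Func.meet
  onRelation := fun _ r => r

section Symbols

variable {α : Type u} {n : ℕ}

/-- The atomic formula `P(t)`. -/
def fP (t : lang.Term (α ⊕ Fin n)) : lang.BoundedFormula α n :=
  Relations.boundedFormula₁ (L := lang) Rel.P t

/-- The atomic formula `Q(t)`. -/
def fQ (t : lang.Term (α ⊕ Fin n)) : lang.BoundedFormula α n :=
  Relations.boundedFormula₁ (L := lang) Rel.Q t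

/-- The atomic formula `s < t`. -/
def fLt (s t : lang.Term (α ⊕ Fin n)) : lang.BoundedFormula α n :=
  Relations.boundedFormula₂ (L := lang) Rel.lt s t

/-- The formula `s ≤ t`, i.e. `s < t` or `s = t`. -/
def fLe (s t : lang.Term (α ⊕ Fin n)) : lang.BoundedFormula α n :=
  fLt s t ⊔ Term.bdEqual s t

/-- The term `H(t)`. -/
def tH {β : Type u} (t : lang.Term β) : lang.Term β :=
  Functions.apply₁ (L := lang) Func.H t

/-- The term `s ∧ t`. -/
def tMeet {β : Type u} (s t : lang.Term β) : lang.Term β :=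
  Functions.apply₂ (L := lang) Func.meet s t

end Symbols

/-- The universal theory of a tree `P` with meets, a set `Q` disjoint from `P` and a function `H`
from `P` to `Q`. Function symbols are total: `H` is the identity outside `P`, and `x ∧ y = x`
unless `x` and `y` are both in `P`. -/
def univTheory : lang.Theory :=
  { -- `P` and `Q` are disjoint
    ∀' ∼(fP &0 ⊓ fQ &0),
    -- `H` maps `P` to `Q` and is the identity outside `P`
    ∀' (fP &0 ⟹ fQ (tH &0)),
    ∀' (∼(fP &0) ⟹ Term.bdEqual (tH &0) &0),
    -- `<` is a strict partial order on `P`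
    ∀' ∀' (fLt &0 &1 ⟹ fP &0 ⊓ fP &1),
    ∀' ∼(fLt &0 &0),
    ∀' ∀' ∀' (fLt &0 &1 ⊓ fLt &1 &2 ⟹ fLt &0 &2),
    -- the elements below a given element are linearly ordered
    ∀' ∀' ∀' (fLt &0 &2 ⊓ fLt &1 &2 ⟹ fLe &0 &1 ⊔ fLt &1 &0),
    -- `x ∧ y` is the greatest common lower bound of `x` and `y` in `P`
    ∀' ∀' (fP &0 ⊓ fP &1 ⟹ fLe (tMeet &0 &1) &0 ⊓ fLe (tMeet &0 &1) &1),
    ∀' ∀' ∀' (fP &0 ⊓ fP &1 ⟹ fLe &2 &0 ⊓ fLe &2 &1 ⟹ fLe &2 (tMeet &0 &1)),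
    -- `x ∧ y = x` unless `x` and `y` are both in `P`
    ∀' ∀' (∼(fP &0 ⊓ fP &1) ⟹ Term.bdEqual (tMeet &0 &1) &0) }

section Models

variable (M : Type u) [lang.Structure M]

/-- The set `P^M`. -/
def setP : Set M := {a | Structure.RelMap (L := lang) Rel.P ![a]}

/-- The set `Q^M`. -/
def setQ : Set M := {a | Structure.RelMap (L := lang) Rel.Q ![a]}

variable {M}

/-- A branch in `P^M`: a maximal linearly ordered subset. -/
def IsBranch (B : Set M) : Prop :=
  Maximal (fun B' : Set M => B' ⊆ setP M ∧
    IsChain (fun a b : M => Structure.RelMap (L := lang) Rel.lt ![a, b]) B') B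

/-- The formula `b < x` over `M` in one variable `x`. -/
def gtFormula (b : M) : lang.Formula (Fin 1 ⊕ M) :=
  Relations.formula₂ (L := lang) Rel.lt (Term.var (Sum.inr b)) (Term.var (Sum.inl 0))

/-- The formula `H(x) = m` over `M` in one variable `x`. -/
def hEqFormula (m : M) : lang.Formula (Fin 1 ⊕ M) :=
  Term.equal (tH (Term.var (Sum.inl 0))) (Term.var (Sum.inr m))

end Models

end Directionality

namespace Directionality

/-! ### Ultrafilter limits of tuples and co-heirs. -/

section General

variable {L : FirstOrder.Language.{0, 0}}

/-! The model completion is the theory of rich trees (`IsRich`): `Q` and the complement of `P ∪ Q`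
are infinite, every colour occurs just below every point of `P`, and over every point `d` of `P` a
new cone can be entered at a point of any prescribed colour. Finite partial isomorphisms extend into
a rich tree (`PIso.exists_extend`), so rich trees eliminate quantifiers (`AtomEq.realize_iff`). One
explicit rich tree, `GenericTree`, gives consistency, since every tree embeds into an ultrapower of
it. Conversely a model of any model completion sits inside a rich tree, which sits inside another
model of it. The model is elementary in the outer one, so it inherits richness
(`IsModelCompletion.isRich`).

The upper bound on co-heirs comes from the geometry of one point. A co-heir of a type over `M` is
the limit of an ultrafilter on tuples from `M`, and it is realized in an ultrapower of the big model
`C`. Let `w` be a meet of two entries of the realizing tuple, with `w` in `P`. All meets `w ∧ c` (`c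
∈ P` in `C`) that lie outside `C` coincide (`IsInternal.meet_eq_of_not`), so `w` creates at most one
new point over `C`. By finite satisfiability in `M`, the set of elements of `C` below `w`, and with
it the knowledge of which meets lie in `C`, depends only on the type over `M` and one bit, `HasSide`
(`le_iff_le_of_profile`, `isInternal_iff_of_profile`). If the colour of the new point lies in `C`,
then it lies in `M` (`IsCoheirPoint.exists_of_Hf_meet_eq_of_not_isInternal`). By quantifier
elimination a co-heir is therefore given by its type over `M`, finitely many bits, and for each
entry at most one colour from `M` (`ultraType_eq_of_data`). Hence a type has at most `|M|` co-heirs,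
which is stronger than the bound in (4).

Without `H` only the bits remain, so there are finitely many co-heirs. To run a single argument for
both languages, a model without `H` is viewed as a tree with `H = id`; the parameter `flag` says
whether `H` is a genuine colouring.

For the lower bound, take a point `c` of the monster above a branch of `M`. A point above the branch
can leave `c` at a level whose colour is any prescribed element of `Q` in `M`, without changing the
type over `M` (`exists_coheirs_of_branch`). The single formula `H(x ∧ y₀) = y₁` separates these
co-heirs, and together with models having a large `Q` this gives medium directionality.

Dependence is a count as well. The independence property would produce `2 ^ 2 ^ ℵ₀` limit types over
a countable elementary substructure, while there are at most `2 ^ ℵ₀` types over it with at most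
`ℵ₀` co-heirs each (`isDependent_of_isRich`). -/

theorem exists_ultrafilter_of_finset {I ι : Type*} (S : ι → Set I)
    (h : ∀ s : Finset ι, ∃ a, ∀ i ∈ s, a ∈ S i) : ∃ U : Ultrafilter I, ∀ i, S i ∈ U := by
  obtain ⟨U, hU⟩ := Ultrafilter.exists_ultrafilter_of_finite_inter_nonempty (Set.range S) (by
    intro T hT
    classical
    obtain ⟨s, rfl⟩ : ∃ s : Finset ι, s.image S = T := by
      obtain ⟨s, -, hs⟩ := Finset.subset_set_image_iff.1
        (show (T : Set (Set I)) ⊆ S '' Set.univ by simpa using hT)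
      exact ⟨s, hs⟩
    obtain ⟨a, ha⟩ := h s
    exact ⟨a, by simpa using ha⟩)
  exact ⟨U, fun i => hU ⟨i, rfl⟩⟩

/-- The limit type of an ultrafilter of tuples: the formulas over `C` that hold almost everywhere
along `f : A → C`. -/
def ultraType {A C : Type u} [L.Structure C] (f : A → C) {n : ℕ} (U : Ultrafilter (Fin n → A)) :
    Set (L.Formula (Fin n ⊕ C)) :=
  {φ | ∀ᶠ a in (U : Filter (Fin n → A)), φ.Realize (Sum.elim (fun i => f (a i)) id)}

theorem ultraType_finSatIn {A C : Type u} [L.Structure C] (f : A → C) {n : ℕ}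
    (U : Ultrafilter (Fin n → A)) : FinSatIn f (ultraType (L := L) f U) := by
  intro s hs
  have : ∀ᶠ a in (U : Filter (Fin n → A)), ∀ φ ∈ s,
      φ.Realize (Sum.elim (fun i => f (a i)) id) :=
    (Filter.eventually_all_finset s).2 fun φ hφ => hs hφ
  exact this.exists

theorem FinSatIn.exists_ultraType {A C : Type u} [L.Structure C] {f : A → C} {n : ℕ}
    {Γ : Set (L.Formula (Fin n ⊕ C))} (h : FinSatIn f Γ) :
    ∃ U : Ultrafilter (Fin n → A), Γ ⊆ ultraType f U := by
  classical
  obtain ⟨U, hU⟩ := exists_ultrafilter_of_finset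
    (fun φ : Γ => {a : Fin n → A | φ.1.Realize (Sum.elim (fun i => f (a i)) id)}) (by
      intro s
      obtain ⟨a, ha⟩ := h (s.image Subtype.val) (by intro φ; simp; tauto)
      exact ⟨a, fun i hi => ha i.1 (Finset.mem_image_of_mem _ hi)⟩)
  exact ⟨U, fun φ hφ => hU ⟨φ, hφ⟩⟩

theorem FinSatIn.mono {A C : Type u} [L.Structure C] {f : A → C} {n : ℕ}
    {Γ Γ' : Set (L.Formula (Fin n ⊕ C))} (h : FinSatIn f Γ) (hs : Γ' ⊆ Γ) : FinSatIn f Γ' :=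
  fun s hs' => h s (hs'.trans hs)

theorem FinSatIn.comp {A C : Type u} [L.Structure C] {f : A → C} {n : ℕ}
    {Γ : Set (L.Formula (Fin n ⊕ C))} (h : FinSatIn f Γ) : FinSatIn (id : C → C) Γ := by
  intro s hs
  obtain ⟨a, ha⟩ := h s hs
  exact ⟨fun i => f (a i), ha⟩

theorem ultraType_mem_or {A C : Type u} [L.Structure C] (f : A → C) {n : ℕ}
    (U : Ultrafilter (Fin n → A)) (φ : L.Formula (Fin n ⊕ C)) :
    φ ∈ ultraType f U ∨ φ.not ∈ ultraType f U := by
  simp only [ultraType, Set.mem_ofPred_eq, Formula.realize_not]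
  exact (Ultrafilter.em U _)

theorem ultraType_not_mem {A C : Type u} [L.Structure C] (f : A → C) {n : ℕ}
    (U : Ultrafilter (Fin n → A)) (φ : L.Formula (Fin n ⊕ C)) :
    φ.not ∈ ultraType f U ↔ φ ∉ ultraType f U := by
  simp only [ultraType, Set.mem_ofPred_eq, Formula.realize_not]
  exact Ultrafilter.eventually_not

theorem ultraType_mem_completeTypes {A C : Type u} [L.Structure C] (f : A → C) {n : ℕ}
    (U : Ultrafilter (Fin n → A)) : ultraType f U ∈ completeTypes L C n :=
  ⟨(ultraType_finSatIn f U).comp, ultraType_mem_or f U⟩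

/-- A complete type contained in a limit type is equal to it. -/
theorem eq_ultraType_of_subset {A C : Type u} [L.Structure C] {f : A → C} {n : ℕ}
    {U : Ultrafilter (Fin n → A)} {q : Set (L.Formula (Fin n ⊕ C))}
    (hq : ∀ φ : L.Formula (Fin n ⊕ C), φ ∈ q ∨ φ.not ∈ q) (h : q ⊆ ultraType f U) :
    q = ultraType f U := by
  refine h.antisymm fun φ hφ => (hq φ).resolve_right fun h' => ?_
  exact (ultraType_not_mem f U φ).1 (h h') hφ

theorem exists_eq_ultraType_of_mem_completeTypes {C : Type u} [L.Structure C] {n : ℕ}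
    {q : Set (L.Formula (Fin n ⊕ C))} (hq : q ∈ completeTypes L C n) :
    ∃ U : Ultrafilter (Fin n → C), q = ultraType id U := by
  obtain ⟨U, hU⟩ := hq.1.exists_ultraType
  exact ⟨U, eq_ultraType_of_subset hq.2 hU⟩

/-- A coheir is the limit type of an ultrafilter on `M`. -/
theorem exists_eq_ultraType_of_mem_coheirs {M C : Type u} [L.Structure M] [L.Structure C]
    {f : M ↪ₑ[L] C} {n : ℕ} {p : Set (L.Formula (Fin n ⊕ M))} {q : Set (L.Formula (Fin n ⊕ C))}
    (hq : q ∈ coheirs f p) : ∃ U : Ultrafilter (Fin n → M), q = ultraType f U := by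
  classical
  have hfs : FinSatIn f q := by
    intro s hs
    obtain ⟨U, rfl⟩ := exists_eq_ultraType_of_mem_completeTypes hq.1
    -- The co-heir condition concerns one formula at a time. A finite set is handled through its
    -- conjunction, which belongs to `q` because a complete type is itself a limit type over `C`.
    have hmem : (Formula.iInf (fun φ : s => φ.1)) ∈ ultraType (L := L) (id : C → C) U := by
      simp only [ultraType, Set.mem_ofPred_eq, Formula.realize_iInf]
      exact (Filter.eventually_all).2 fun φ => hs φ.2
    obtain ⟨a, ha⟩ := hq.2.2 _ hmem
    rw [Formula.realize_iInf] at ha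
    exact ⟨a, fun φ hφ => ha ⟨φ, hφ⟩⟩
  obtain ⟨U, hU⟩ := hfs.exists_ultraType
  exact ⟨U, eq_ultraType_of_subset hq.1.2 hU⟩

@[simp]
theorem realize_mapParams {M C D : Type u} [L.Structure D] (f : M → C) {n : ℕ}
    (φ : L.Formula (Fin n ⊕ M)) (a : Fin n → D) (g : C → D) :
    (mapParams f φ).Realize (Sum.elim a g) ↔ φ.Realize (Sum.elim a (g ∘ f)) := by
  simp [mapParams, Formula.realize_relabel, Sum.elim_comp_map]

theorem mapParams_mem_ultraType {M C : Type u} [L.Structure M] [L.Structure C]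
    {f : M ↪ₑ[L] C} {n : ℕ} (U : Ultrafilter (Fin n → M)) (φ : L.Formula (Fin n ⊕ M)) :
    mapParams f φ ∈ ultraType f U ↔ φ ∈ ultraType id U := by
  simp only [ultraType, Set.mem_ofPred_eq, realize_mapParams]
  refine Filter.eventually_congr (Filter.Eventually.of_forall fun a => ?_)
  rw [← f.map_formula]
  exact iff_of_eq (congrArg _ (by funext x; rcases x with x | x <;> rfl))

theorem ultraType_mem_coheirs {M C : Type u} [L.Structure M] [L.Structure C]
    {f : M ↪ₑ[L] C} {n : ℕ} {p : Set (L.Formula (Fin n ⊕ M))} {U : Ultrafilter (Fin n → M)}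
    (h : mapParams f '' p ⊆ ultraType f U) : ultraType f U ∈ coheirs f p := by
  refine ⟨ultraType_mem_completeTypes f U, h, fun φ hφ => ?_⟩
  obtain ⟨a, ha⟩ := ultraType_finSatIn f U {φ} (by simpa using hφ)
  exact ⟨a, ha φ (by simp)⟩

theorem eq_of_mapParams_subset {M C : Type u} [L.Structure M] [L.Structure C]
    {f : M ↪ₑ[L] C} {n : ℕ} {p : Set (L.Formula (Fin n ⊕ M))} (hp : p ∈ completeTypes L M n)
    {U : Ultrafilter (Fin n → M)} (h : mapParams f '' p ⊆ ultraType f U) :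
    p = ultraType id U :=
  eq_ultraType_of_subset hp.2 fun φ hφ => (mapParams_mem_ultraType (f := f) U φ).1
    (h (Set.mem_image_of_mem _ hφ))

/-- Every element of `uf_Δ(p)` is the restriction to `L_Δ` of a coheir of `p`. -/
theorem exists_coheir_of_mem_deltaCoheirs {M C : Type u} [L.Structure M] [L.Structure C]
    {f : M ↪ₑ[L] C} {n : ℕ} {p : Set (L.Formula (Fin n ⊕ M))}
    {Δ : Set (L.Formula (Fin n ⊕ ℕ))} {q : Set (L.Formula (Fin n ⊕ C))}
    (hq : q ∈ deltaCoheirs f Δ p) : ∃ r ∈ coheirs f p, q = r ∩ deltaFormulas C Δ := by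
  obtain ⟨U, hU⟩ := hq.2.exists_ultraType
  refine ⟨_, ultraType_mem_coheirs (Set.subset_union_right.trans hU), ?_⟩
  have hqU : q ⊆ ultraType f U := Set.subset_union_left.trans hU
  refine (Set.subset_inter hqU hq.1.1).antisymm ?_
  rintro ψ ⟨hψ, φ, hφ, b, rfl | rfl⟩
  · refine (hq.1.2.2 φ hφ b).resolve_right fun h' => ?_
    exact (ultraType_not_mem _ _ _).1 (hqU h') hψ
  · refine (hq.1.2.2 φ hφ b).resolve_left fun h' => ?_
    exact (ultraType_not_mem _ _ _).1 hψ (hqU h')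

theorem deltaCoheirs_subset_image {M C : Type u} [L.Structure M] [L.Structure C]
    (f : M ↪ₑ[L] C) {n : ℕ} (p : Set (L.Formula (Fin n ⊕ M)))
    (Δ : Set (L.Formula (Fin n ⊕ ℕ))) :
    deltaCoheirs f Δ p ⊆ (fun r => r ∩ deltaFormulas C Δ) '' coheirs f p := by
  intro q hq
  obtain ⟨r, hr, rfl⟩ := exists_coheir_of_mem_deltaCoheirs hq
  exact ⟨r, hr, rfl⟩

/-- The restriction of a coheir of `p` to `L_Δ` belongs to `uf_Δ(p)`. -/
theorem inter_mem_deltaCoheirs {M C : Type u} [L.Structure M] [L.Structure C]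
    {f : M ↪ₑ[L] C} {n : ℕ} {p : Set (L.Formula (Fin n ⊕ M))}
    (Δ : Set (L.Formula (Fin n ⊕ ℕ))) {r : Set (L.Formula (Fin n ⊕ C))}
    (hr : r ∈ coheirs f p) : r ∩ deltaFormulas C Δ ∈ deltaCoheirs f Δ p := by
  obtain ⟨U, rfl⟩ := exists_eq_ultraType_of_mem_coheirs hr
  have hfs := ultraType_finSatIn (L := L) f U
  refine ⟨⟨Set.inter_subset_right, (hfs.mono Set.inter_subset_left).comp, fun φ hφ b => ?_⟩,
    hfs.mono (Set.union_subset Set.inter_subset_left hr.2.1)⟩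
  exact (ultraType_mem_or f U (inst φ b)).imp (fun h => ⟨h, φ, hφ, b, Or.inl rfl⟩)
    (fun h => ⟨h, φ, hφ, b, Or.inr rfl⟩)

/-- The sentence `∀ v, θ(v) → ∃ x, ψ(v, x)`. -/
noncomputable def forallExistsSentence {α : Type} [Finite α] (θ : L.Formula α)
    (ψ : L.Formula (α ⊕ Unit)) : L.Sentence :=
  Formula.iAlls α (Formula.relabel (Sum.inr : α → Empty ⊕ α) (θ.imp (Formula.iExs Unit ψ)))

theorem realize_forallExistsSentence {α : Type} [Finite α] (θ : L.Formula α)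
    (ψ : L.Formula (α ⊕ Unit)) (M : Type*) [L.Structure M] :
    M ⊨ forallExistsSentence θ ψ ↔ ∀ v : α → M, θ.Realize v →
      ∃ x : M, ψ.Realize (Sum.elim v fun _ => x) := by
  simp only [Sentence.Realize, forallExistsSentence, Formula.realize_iAlls,
    Formula.realize_relabel, Formula.realize_imp, Formula.realize_iExs]
  refine forall_congr' fun v => imp_congr Iff.rfl ⟨?_, ?_⟩
  · rintro ⟨x, hx⟩
    exact ⟨x (), hx⟩
  · rintro ⟨x, hx⟩
    exact ⟨fun _ => x, hx⟩

/-- Existential statements with parameters from `M` go down along an elementary map. -/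
theorem exists_of_elementary {M N : Type*} [L.Structure M] [L.Structure N] {g : M → N}
    (hg : ∀ φ : L.Formula M, φ.Realize id ↔ φ.Realize g)
    {ψ : L.Formula (M ⊕ Unit)} {x : N} (hx : ψ.Realize (Sum.elim g fun _ => x)) :
    ∃ x : M, ψ.Realize (Sum.elim id fun _ => x) := by
  have := (hg (Formula.iExs Unit ψ)).2 (by
    rw [Formula.realize_iExs]
    exact ⟨fun _ => x, hx⟩)
  rw [Formula.realize_iExs] at this
  obtain ⟨x, hx⟩ := this
  exact ⟨x (), hx⟩

end General

/-! ### Ultrapowers realizing limit types. -/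

section Ultrapower

variable {L : FirstOrder.Language.{0, 0}}

/-- The ultrapower of `C` by an ultrafilter `U`. -/
abbrev UPow {I : Type u} (U : Ultrafilter I) (C : Type u) : Type u :=
  (U : Filter I).Product fun _ : I => C

/-- The class of a function in the ultrapower. -/
def UPow.mk {I : Type u} (U : Ultrafilter I) {C : Type u} (x : I → C) : UPow U C :=
  (Quotient.mk _ x : Quotient ((U : Filter I).productSetoid fun _ => C))

theorem UPow.realize_mk {I : Type u} (U : Ultrafilter I) {C : Type u} [L.Structure C] [Nonempty C]
    {β : Type*} (φ : L.Formula β) (x : β → I → C) :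
    (φ.Realize fun i => UPow.mk U (x i)) ↔ ∀ᶠ a in (U : Filter I), φ.Realize fun i => x i a :=
  Ultraproduct.realize_formula_cast φ x

/-- The diagonal embedding into an ultrapower. -/
def UPow.diag (L : FirstOrder.Language.{0, 0}) {I : Type u} (U : Ultrafilter I) {C : Type u}
    [L.Structure C] [Nonempty C] : C ↪ₑ[L] UPow U C where
  toFun c := UPow.mk U fun _ => c
  map_formula' n φ x := by
    have := UPow.realize_mk U φ (fun i _ => x i)
    simpa [Function.comp_def] using this

/-- The tuple in the ultrapower of `C` along an ultrafilter on `M ^ n` that realizes its limit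
type. -/
def UPow.point {M C : Type u} (f : M → C) {n : ℕ} (U : Ultrafilter (Fin n → M)) (i : Fin n) :
    UPow U C :=
  UPow.mk U fun a => f (a i)

/-- This is Łoś's theorem for the class of the identity sequence of tuples. It replaces co-heirs by
actual points of an elementary extension of `C`, where meets and colours can be computed. -/
theorem UPow.realize_point {M C : Type u} [L.Structure C] [Nonempty C] (f : M → C) {n : ℕ}
    (U : Ultrafilter (Fin n → M)) (φ : L.Formula (Fin n ⊕ C)) :
    φ.Realize (Sum.elim (UPow.point f U) (UPow.diag L U)) ↔ φ ∈ ultraType f U := by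
  have h := UPow.realize_mk U φ (Sum.elim (fun i a => f (a i)) fun c _ => c)
  have h1 : (fun i => UPow.mk U (Sum.elim (fun i a => f (a i)) (fun c _ => c) i)) =
      Sum.elim (UPow.point f U) (UPow.diag L U) := by
    funext x; rcases x with x | x <;> rfl
  have h2 : ∀ a : Fin n → M, (fun i => Sum.elim (fun i (a : Fin n → M) => f (a i))
      (fun c _ => c) i a) = (Sum.elim (fun i => f (a i)) id : Fin n ⊕ C → C) := by
    intro a; funext x; rcases x with x | x <;> rfl
  rw [h1] at h
  simp only [h2] at h
  exact h

end Ultrapower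

/-! ### Names and partial types for a saturated extension. -/

section Saturation

variable {L : FirstOrder.Language.{0, 0}}

/-- Names for the elements of a saturated extension of `M`: elements of `M`, and witnesses for the
sets of formulas over `|M|` many previously introduced names. -/
inductive WitnessName (L : FirstOrder.Language.{0, 0}) (M : Type u) : Type u
  | base : M → WitnessName L M
  | node (n : ℕ) (p : M → WitnessName L M) (Γ : Set (L.Formula (Fin n ⊕ M))) (i : Fin n) :
      WitnessName L M

namespace WitnessName

variable {M : Type u}

/-- Assignments of values in `M` to names that are the identity on `M`. -/
abbrev Assignment (L : FirstOrder.Language.{0, 0}) (M : Type u) : Type u :=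
  {v : WitnessName L M → M // ∀ m, v (base m) = m}

instance [Nonempty M] : Nonempty (Assignment L M) := by
  classical
  obtain ⟨m⟩ := ‹Nonempty M›
  exact ⟨fun w => match w with
    | base m => m
    | node _ _ _ _ => m, fun _ => rfl⟩

theorem node_injective {n : ℕ} {p : M → WitnessName L M} {Γ : Set (L.Formula (Fin n ⊕ M))} :
    Function.Injective (node n p Γ) := by
  intro i j h
  cases h
  rfl

/-- The formula saying that `t` is realized by some tuple, for the parameters `p`. -/
noncomputable def existsFormula {n : ℕ} (t : Finset (L.Formula (Fin n ⊕ M)))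
    (p : M → WitnessName L M) : L.Formula (WitnessName L M) :=
  (Formula.iExs (Fin n) (Formula.relabel Sum.swap
    (Formula.iInf fun φ : t => φ.1))).relabel p

theorem realize_existsFormula {N : Type*} [L.Structure N] {n : ℕ}
    (t : Finset (L.Formula (Fin n ⊕ M))) (p : M → WitnessName L M) (v : WitnessName L M → N) :
    (existsFormula t p).Realize v ↔
      ∃ a : Fin n → N, ∀ φ ∈ t, φ.Realize (Sum.elim a (v ∘ p)) := by
  simp only [existsFormula, Formula.realize_relabel, Formula.realize_iExs, Formula.realize_iInf]
  refine exists_congr fun a => ?_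
  have : (Sum.elim (v ∘ p) a) ∘ Sum.swap = Sum.elim a (v ∘ p) := by
    ext x; rcases x with x | x <;> rfl
  rw [this]
  simp

variable [L.Structure M]

/-- The truth value of `φ` in `M` depends only on finitely many names from `D`. -/
def SupportedOn (D : Set (WitnessName L M)) (φ : L.Formula (WitnessName L M)) : Prop :=
  ∃ F : Finset (WitnessName L M), ↑F ⊆ D ∧ ∀ v v' : WitnessName L M → M,
    (∀ w ∈ F, v w = v' w) → (φ.Realize v ↔ φ.Realize v')

/-- The free variables of `φ` form such a set. Finite supports make unions of chains of partial
models complete, and they allow values of new names to be changed without affecting old formulas. -/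
theorem exists_finset_support {α : Type u} (φ : L.Formula α) : ∃ F : Finset α, ∀ v v' : α → M,
    (∀ w ∈ F, v w = v' w) → (φ.Realize v ↔ φ.Realize v') := by
  classical
  refine ⟨φ.freeVarFinset, fun v v' h => ?_⟩
  have h1 := BoundedFormula.realize_restrictFreeVar (φ := φ) (f := id)
    (v := fun a => v a) (xs := (default : Fin 0 → M)) v (fun _ => rfl)
  have h2 := BoundedFormula.realize_restrictFreeVar (φ := φ) (f := id)
    (v := fun a => v' a) (xs := (default : Fin 0 → M)) v' (fun _ => rfl)
  have h3 : (fun a : φ.freeVarFinset => v a) = fun a : φ.freeVarFinset => v' a := by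
    ext a; exact h a a.2
  rw [h3] at h1
  exact h1.symm.trans h2

theorem supportedOn_relabel {D : Set (WitnessName L M)} {α : Type u} (φ : L.Formula α)
    (p : α → WitnessName L M) (hp : ∀ a, p a ∈ D) : SupportedOn D (φ.relabel p) := by
  classical
  obtain ⟨F, hF⟩ := exists_finset_support (M := M) φ
  refine ⟨F.image p, by intro w; simp; rintro a - rfl; exact hp a, fun v v' h => ?_⟩
  rw [Formula.realize_relabel, Formula.realize_relabel]
  exact hF _ _ fun a ha => h _ (Finset.mem_image_of_mem _ ha)

theorem supportedOn_univ (φ : L.Formula (WitnessName L M)) : SupportedOn Set.univ φ := by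
  obtain ⟨F, hF⟩ := exists_finset_support (M := M) φ
  exact ⟨F, Set.subset_univ _, hF⟩

theorem SupportedOn.not {D : Set (WitnessName L M)} {φ : L.Formula (WitnessName L M)}
    (h : SupportedOn D φ) : SupportedOn D φ.not := by
  obtain ⟨F, hF, h⟩ := h
  exact ⟨F, hF, fun v v' hv => by rw [Formula.realize_not, Formula.realize_not, h v v' hv]⟩

theorem SupportedOn.mono {D D' : Set (WitnessName L M)} {φ : L.Formula (WitnessName L M)}
    (h : SupportedOn D φ) (hD : D ⊆ D') : SupportedOn D' φ := by
  obtain ⟨F, hF, h⟩ := h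
  exact ⟨F, hF.trans hD, h⟩

/-- The instance of `φ` at the witness `node n p Γ` and the parameters `p`. -/
def witnessFormula {n : ℕ} (p : M → WitnessName L M) (Γ : Set (L.Formula (Fin n ⊕ M)))
    (φ : L.Formula (Fin n ⊕ M)) : L.Formula (WitnessName L M) :=
  φ.relabel (Sum.elim (node n p Γ) p)

/-- Finite satisfiability by assignments in `M`. -/
def FinSat (S : Set (L.Formula (WitnessName L M))) : Prop :=
  ∀ s : Finset (L.Formula (WitnessName L M)), ↑s ⊆ S →
    ∃ v : Assignment L M, ∀ φ ∈ s, φ.Realize v.1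

/-- A set of names together with a complete type of these names over `M`, which realizes the
sets of formulas that the names stand for whenever they are finitely satisfiable. -/
structure IsPartialModel (D : Set (WitnessName L M)) (S : Set (L.Formula (WitnessName L M))) :
    Prop where
  base_mem : ∀ m, base m ∈ D
  param_mem : ∀ n p Γ i, node n p Γ i ∈ D → ∀ m, p m ∈ D
  node_mem : ∀ n p Γ i, node n p Γ i ∈ D → ∀ i', node n p Γ i' ∈ D
  supported : ∀ φ ∈ S, SupportedOn D φ
  finSat : FinSat S
  complete : ∀ φ, SupportedOn D φ → φ ∈ S ∨ φ.not ∈ S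
  witness : ∀ n p Γ i, node n p Γ i ∈ D →
    (∀ t : Finset (L.Formula (Fin n ⊕ M)), ↑t ⊆ Γ → existsFormula t p ∈ S) →
      ∀ φ ∈ Γ, witnessFormula p Γ φ ∈ S

theorem FinSat.not_mem {S : Set (L.Formula (WitnessName L M))} (h : FinSat S)
    {φ : L.Formula (WitnessName L M)} (h1 : φ ∈ S) : φ.not ∉ S := by
  classical
  intro h2
  obtain ⟨v, hv⟩ := h {φ, φ.not} (by intro ψ; simp; rintro (rfl | rfl) <;> assumption)
  have := hv φ.not (by simp)
  rw [Formula.realize_not] at this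
  exact this (hv φ (by simp))

/-- The complete type of the names in `D` given by an ultrafilter of assignments. -/
def typeOn (D : Set (WitnessName L M)) (U : Ultrafilter (Assignment L M)) :
    Set (L.Formula (WitnessName L M)) :=
  {φ | SupportedOn D φ ∧ ∀ᶠ v in (U : Filter (Assignment L M)), φ.Realize v.1}

theorem finSat_typeOn (D : Set (WitnessName L M)) (U : Ultrafilter (Assignment L M)) :
    FinSat (typeOn D U) := by
  intro s hs
  exact ((Filter.eventually_all_finset s).2 fun φ hφ => (hs hφ).2).exists

theorem typeOn_complete (D : Set (WitnessName L M)) (U : Ultrafilter (Assignment L M))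
    (φ : L.Formula (WitnessName L M)) (h : SupportedOn D φ) :
    φ ∈ typeOn D U ∨ φ.not ∈ typeOn D U := by
  refine (Ultrafilter.em U fun v => φ.Realize v.1).imp (fun h' => ⟨h, h'⟩) fun h' => ⟨h.not, ?_⟩
  simpa only [Formula.realize_not] using h'

theorem FinSat.exists_ultrafilter {S : Set (L.Formula (WitnessName L M))} (h : FinSat S) :
    ∃ U : Ultrafilter (Assignment L M), ∀ φ ∈ S,
      ∀ᶠ v in (U : Filter (Assignment L M)), φ.Realize v.1 := by
  classical
  obtain ⟨U, hU⟩ := exists_ultrafilter_of_finset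
    (fun φ : S => {v : Assignment L M | φ.1.Realize v.1}) (by
      intro s
      obtain ⟨a, ha⟩ := h (s.image Subtype.val) (by intro φ; simp; tauto)
      exact ⟨a, fun i hi => ha i.1 (Finset.mem_image_of_mem _ hi)⟩)
  exact ⟨U, fun φ hφ => hU ⟨φ, hφ⟩⟩

theorem isPartialModel_base [Nonempty M] : ∃ S, IsPartialModel (Set.range base) S (L := L)
    (M := M) := by
  -- Any principal ultrafilter works: assignments agree on the base names, so the type obtained is
  -- the elementary diagram of `M`.
  let U : Ultrafilter (Assignment L M) := pure (Classical.arbitrary _)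
  refine ⟨typeOn (Set.range base) U, fun m => ⟨m, rfl⟩, ?_, ?_, fun φ h => h.1,
    finSat_typeOn _ _, typeOn_complete _ _, ?_⟩
  all_goals
    rintro n p Γ i ⟨m, hm⟩
    cases hm

/-- The increasing union of partial models is a partial model. -/
theorem IsPartialModel.union_chain {c : Set (Set (WitnessName L M) × Set (L.Formula (WitnessName L M)))}
    (hc : ∀ x ∈ c, IsPartialModel x.1 x.2) (hch : IsChain (· ≤ ·) c) (hne : c.Nonempty) :
    IsPartialModel (⋃ x ∈ c, x.1) (⋃ x ∈ c, x.2) := by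
  classical
  have hdir : DirectedOn (· ≤ ·) c := hch.directedOn
  have hfin1 : ∀ F : Finset (WitnessName L M), (F : Set (WitnessName L M)) ⊆ (⋃ x ∈ c, x.1) →
      ∃ x ∈ c, (F : Set (WitnessName L M)) ⊆ x.1 := by
    intro F
    induction F using Finset.induction_on with
    | empty => intro _; obtain ⟨x, hx⟩ := hne; exact ⟨x, hx, by simp⟩
    | insert a F _ ih =>
      intro h
      rw [Finset.coe_insert, Set.insert_subset_iff] at h
      obtain ⟨x, hx, hFx⟩ := ih h.2
      obtain ⟨y, hy, hay⟩ := Set.mem_iUnion₂.1 h.1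
      obtain ⟨z, hz, hxz, hyz⟩ := hdir x hx y hy
      exact ⟨z, hz, by
        rw [Finset.coe_insert, Set.insert_subset_iff]; exact ⟨hyz.1 hay, hFx.trans hxz.1⟩⟩
  have hfin2 : ∀ F : Finset (L.Formula (WitnessName L M)), ↑F ⊆ (⋃ x ∈ c, x.2) →
      ∃ x ∈ c, ↑F ⊆ x.2 := by
    intro F
    induction F using Finset.induction_on with
    | empty => intro _; obtain ⟨x, hx⟩ := hne; exact ⟨x, hx, by simp⟩
    | insert a F _ ih =>
      intro h
      rw [Finset.coe_insert, Set.insert_subset_iff] at h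
      obtain ⟨x, hx, hFx⟩ := ih h.2
      obtain ⟨y, hy, hay⟩ := Set.mem_iUnion₂.1 h.1
      obtain ⟨z, hz, hxz, hyz⟩ := hdir x hx y hy
      exact ⟨z, hz, by
        rw [Finset.coe_insert, Set.insert_subset_iff]; exact ⟨hyz.2 hay, hFx.trans hxz.2⟩⟩
  have hsub1 : ∀ x ∈ c, x.1 ⊆ (⋃ x ∈ c, x.1) := fun x hx => Set.subset_biUnion_of_mem hx
  have hsub2 : ∀ x ∈ c, x.2 ⊆ (⋃ x ∈ c, x.2) := fun x hx =>
    Set.subset_biUnion_of_mem (u := fun x => x.2) hx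
  have hfs : FinSat (⋃ x ∈ c, x.2) := by
    intro s hs
    obtain ⟨x, hx, hsx⟩ := hfin2 s hs
    exact (hc x hx).finSat s hsx
  constructor
  · intro m
    obtain ⟨x, hx⟩ := hne
    exact hsub1 x hx ((hc x hx).base_mem m)
  · intro n p Γ i h m
    obtain ⟨x, hx, h⟩ := Set.mem_iUnion₂.1 h
    exact hsub1 x hx ((hc x hx).param_mem n p Γ i h m)
  · intro n p Γ i h i'
    obtain ⟨x, hx, h⟩ := Set.mem_iUnion₂.1 h
    exact hsub1 x hx ((hc x hx).node_mem n p Γ i h i')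
  · intro φ h
    obtain ⟨x, hx, h⟩ := Set.mem_iUnion₂.1 h
    exact ((hc x hx).supported φ h).mono (hsub1 x hx)
  · exact hfs
  · rintro φ ⟨F, hF, h⟩
    obtain ⟨x, hx, hFx⟩ := hfin1 F hF
    exact ((hc x hx).complete φ ⟨F, hFx, h⟩).imp (fun h => hsub2 x hx h) fun h => hsub2 x hx h
  · intro n p Γ i h hex φ hφ
    obtain ⟨x, hx, h⟩ := Set.mem_iUnion₂.1 h
    -- The existence formulas are supported on the names of the member `x` of the chain, so `x` has
    -- already decided them. Consistency of the union forces the positive decision.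
    refine hsub2 x hx ((hc x hx).witness n p Γ i h (fun t ht => ?_) φ hφ)
    refine ((hc x hx).complete _ (supportedOn_relabel _ _
      ((hc x hx).param_mem n p Γ i h))).resolve_right fun h' => ?_
    exact hfs.not_mem (hex t ht) (hsub2 x hx h')

/-- A partial model extends to the names of a new tuple. -/
theorem IsPartialModel.extend {D : Set (WitnessName L M)} {S : Set (L.Formula (WitnessName L M))}
    (h : IsPartialModel D S) {n : ℕ} {p : M → WitnessName L M}
    {Γ : Set (L.Formula (Fin n ⊕ M))} (hp : ∀ m, p m ∈ D) {i₀ : Fin n}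
    (hi₀ : node n p Γ i₀ ∉ D) :
    ∃ S', S ⊆ S' ∧ IsPartialModel (D ∪ Set.range (node n p Γ)) S' := by
  classical
  set D' := D ∪ Set.range (node n p Γ)
  have hnew : ∀ i, node n p Γ i ∉ D := fun i hi => hi₀ (h.node_mem _ _ _ _ hi _)
  have hexD : ∀ t, SupportedOn D (existsFormula (n := n) t p) := fun t =>
    supportedOn_relabel _ _ hp
  -- The new tuple is required to realize `Γ` only when `S` says that each finite part of `Γ` is
  -- realized; otherwise nothing is asked of it.
  let S₁ : Set (L.Formula (WitnessName L M)) :=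
    S ∪ {ψ | (∀ t : Finset (L.Formula (Fin n ⊕ M)), ↑t ⊆ Γ → existsFormula t p ∈ S) ∧
      ∃ φ ∈ Γ, ψ = witnessFormula p Γ φ}
  have hS₁ : FinSat S₁ := by
    by_cases hex : ∀ t : Finset (L.Formula (Fin n ⊕ M)), ↑t ⊆ Γ → existsFormula t p ∈ S
    · intro s hs
      have ht : ∃ t : Finset (L.Formula (Fin n ⊕ M)), ↑t ⊆ Γ ∧
          ∀ ψ ∈ s, ψ ∉ S → ∃ φ ∈ t, ψ = witnessFormula p Γ φ := by
        have : ((s.filter (· ∉ S) : Finset _) : Set (L.Formula (WitnessName L M))) ⊆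
            witnessFormula p Γ '' Γ := by
          intro ψ hψ
          rw [Finset.mem_coe, Finset.mem_filter] at hψ
          obtain ⟨φ, hφ, rfl⟩ := ((hs hψ.1).resolve_left hψ.2).2
          exact ⟨φ, hφ, rfl⟩
        obtain ⟨t, ht, hts⟩ := Finset.subset_set_image_iff.1 this
        refine ⟨t, ht, fun ψ hψ hψS => ?_⟩
        have : ψ ∈ t.image (witnessFormula p Γ) := by
          rw [hts]; exact Finset.mem_filter.2 ⟨hψ, hψS⟩
        obtain ⟨φ, hφ, rfl⟩ := Finset.mem_image.1 this
        exact ⟨φ, hφ, rfl⟩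
      obtain ⟨t, ht, hst⟩ := ht
      obtain ⟨v, hv⟩ := h.finSat (insert (existsFormula t p) (s.filter (· ∈ S))) (by
        intro ψ hψ
        rw [Finset.mem_coe, Finset.mem_insert, Finset.mem_filter] at hψ
        rcases hψ with rfl | hψ
        · exact hex t ht
        · exact hψ.2)
      obtain ⟨a, ha⟩ := (realize_existsFormula t p v.1).1 (hv _ (Finset.mem_insert_self _ _))
      -- Only the new names receive new values, namely the witnesses of the finite part `t`.
      -- Formulas of `S` are supported on `D` and keep their truth values.
      let v' : WitnessName L M → M := fun w =>
        if hw : ∃ i, w = node n p Γ i then a hw.choose else v.1 w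
      have hv'D : ∀ w ∈ D, v' w = v.1 w := by
        intro w hw
        have : ¬ ∃ i, w = node n p Γ i := by
          rintro ⟨i, rfl⟩; exact hnew i hw
        simp [v', this]
      have hv'n : ∀ i, v' (node n p Γ i) = a i := by
        intro i
        have hex : ∃ j, node n p Γ i = node n p Γ j := ⟨i, rfl⟩
        have : hex.choose = i := (node_injective hex.choose_spec).symm
        simp only [v', dif_pos hex, this]
      refine ⟨⟨v', fun m => by rw [hv'D _ (h.base_mem m), v.2]⟩, fun ψ hψ => ?_⟩
      by_cases hψS : ψ ∈ S
      · obtain ⟨F, hF, hFψ⟩ := h.supported ψ hψS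
        rw [hFψ v' v.1 fun w hw => hv'D w (hF hw)]
        exact hv ψ (Finset.mem_insert_of_mem (Finset.mem_filter.2 ⟨hψ, hψS⟩))
      · obtain ⟨φ, hφ, rfl⟩ := hst ψ hψ hψS
        have := ha φ hφ
        rw [witnessFormula, Formula.realize_relabel]
        convert this using 1
        ext x
        rcases x with x | x
        · exact hv'n x
        · exact hv'D _ (hp x)
    · intro s hs
      exact h.finSat s fun ψ hψ => (hs hψ).resolve_right fun h' => hex h'.1
  obtain ⟨U, hU⟩ := hS₁.exists_ultrafilter
  have hsub : S ⊆ typeOn D' U := fun φ hφ =>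
    ⟨(h.supported φ hφ).mono Set.subset_union_left, hU φ (Or.inl hφ)⟩
  have hback : ∀ φ, SupportedOn D φ → φ ∈ typeOn D' U → φ ∈ S := fun φ hφ hφ' =>
    (h.complete φ hφ).resolve_right fun h' => (finSat_typeOn D' U).not_mem hφ' (hsub h')
  have hparam : ∀ n₁ p₁ Γ₁ i₁, node n₁ p₁ Γ₁ i₁ ∈ D' → ∀ m, p₁ m ∈ D := by
    rintro n₁ p₁ Γ₁ i₁ (h₁ | ⟨i, hi⟩) m
    · exact h.param_mem _ _ _ _ h₁ m
    · cases hi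
      exact hp m
  refine ⟨typeOn D' U, hsub, fun m => Or.inl (h.base_mem m),
    fun n₁ p₁ Γ₁ i₁ h₁ m => Or.inl (hparam _ _ _ _ h₁ m), ?_, fun φ h => h.1,
    finSat_typeOn _ _, typeOn_complete _ _, ?_⟩
  · rintro n₁ p₁ Γ₁ i₁ (h₁ | ⟨i, hi⟩) i'
    · exact Or.inl (h.node_mem _ _ _ _ h₁ i')
    · cases hi
      exact Or.inr ⟨i', rfl⟩
  · intro n₁ p₁ Γ₁ i₁ h₁ hex φ hφ
    -- Parameters of node names in `D'` lie in `D`, so these formulas were already decided by `S`,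
    -- and the extension cannot change the decision.
    have hex' : ∀ t : Finset (L.Formula (Fin n₁ ⊕ M)), ↑t ⊆ Γ₁ → existsFormula t p₁ ∈ S :=
      fun t ht => hback _ (supportedOn_relabel _ _ (hparam _ _ _ _ h₁)) (hex t ht)
    rcases h₁ with h₁ | ⟨i, hi⟩
    · exact hsub (h.witness _ _ _ _ h₁ hex' φ hφ)
    · cases hi
      refine ⟨supportedOn_relabel _ _ ?_, hU _ (Or.inr ⟨hex', φ, hφ, rfl⟩)⟩
      rintro (x | x)
      · exact Or.inr ⟨x, rfl⟩
      · exact Or.inl (hp x)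

/-- A maximal partial model contains every name, by induction on the name: once all parameters of a
node are present, `IsPartialModel.extend` would add a missing node and contradict maximality. -/
theorem exists_isPartialModel_univ [Nonempty M] :
    ∃ S, IsPartialModel (Set.univ : Set (WitnessName L M)) S := by
  obtain ⟨S₀, hS₀⟩ := isPartialModel_base (L := L) (M := M)
  obtain ⟨⟨D, S⟩, -, hmax⟩ := zorn_le_nonempty₀
    {x : Set (WitnessName L M) × Set (L.Formula (WitnessName L M)) | IsPartialModel x.1 x.2} (by
      intro c hc hch y hy
      refine ⟨(⋃ x ∈ c, x.1, ⋃ x ∈ c, x.2),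
        IsPartialModel.union_chain (fun x hx => hc hx) hch ⟨y, hy⟩, fun z hz => ⟨?_, ?_⟩⟩
      · exact Set.subset_biUnion_of_mem (u := fun x => x.1) hz
      · exact Set.subset_biUnion_of_mem (u := fun x => x.2) hz) (Set.range base, S₀) hS₀
  have hD : IsPartialModel D S := hmax.1
  have : ∀ w, w ∈ D := by
    intro w
    induction w with
    | base m => exact hD.base_mem m
    | node n p Γ i ih =>
      by_contra hi
      obtain ⟨S', hS', h'⟩ := hD.extend ih hi
      have := hmax.2 (y := (D ∪ Set.range (node n p Γ), S')) h' ⟨Set.subset_union_left, hS'⟩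
      exact hi (this.1 (Or.inr ⟨i, rfl⟩))
  exact ⟨S, by rwa [Set.eq_univ_of_forall this] at hD⟩

end WitnessName

end Saturation

/-! ### Existence of saturated elementary extensions. -/

section Saturation

variable {L : FirstOrder.Language.{0, 0}}

open WitnessName in
/-- Every infinite structure `M` has an `|M|⁺`-saturated elementary extension. -/
theorem exists_isMonsterOver (M : Type u) [L.Structure M] [Infinite M] :
    ∃ (C : Type u) (_ : L.Structure C) (f : M ↪ₑ[L] C), IsMonsterOver f := by
  classical
  obtain ⟨S, hS⟩ := exists_isPartialModel_univ (L := L) (M := M)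
  obtain ⟨U, hU⟩ := hS.finSat.exists_ultrafilter
  have hUS : ∀ φ : L.Formula (WitnessName L M),
      φ ∈ S ↔ ∀ᶠ v in (U : Filter (Assignment L M)), φ.Realize v.1 := by
    refine fun φ => ⟨hU φ, fun h => (hS.complete φ (supportedOn_univ φ)).resolve_right fun h' => ?_⟩
    have := hU _ h'
    simp only [Formula.realize_not] at this
    exact Ultrafilter.eventually_not.1 this h
  -- Names are interpreted in the ultrapower of `M` along assignments. The ultrapower need not be
  -- saturated; the extension sought is the range of `ν`.
  let ν : WitnessName L M → UPow U M := fun w => UPow.mk U fun v => v.1 w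
  have hν : ∀ φ : L.Formula (WitnessName L M), φ.Realize ν ↔ φ ∈ S := fun φ => by
    rw [hUS]
    exact UPow.realize_mk U φ fun w v => v.1 w
  have hsat : ∀ (n : ℕ) (p : M → WitnessName L M) (Γ : Set (L.Formula (Fin n ⊕ M))),
      (∀ t : Finset (L.Formula (Fin n ⊕ M)), ↑t ⊆ Γ → ∃ a : Fin n → UPow U M,
        ∀ φ ∈ t, φ.Realize (Sum.elim a (ν ∘ p))) →
      ∀ φ ∈ Γ, φ.Realize (Sum.elim (ν ∘ node n p Γ) (ν ∘ p)) := by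
    intro n p Γ h φ hφ
    -- For `n = 0` there is no node name, so the witness property cannot be quoted; but then the
    -- tuple is unique.
    rcases Nat.eq_zero_or_pos n with rfl | hn
    · obtain ⟨a, ha⟩ := h {φ} (by simpa using hφ)
      have := ha φ (by simp)
      rwa [Subsingleton.elim a (ν ∘ node 0 p Γ)] at this
    · have := hS.witness n p Γ ⟨0, hn⟩ (Set.mem_univ _) (fun t ht => by
        rw [← hν, realize_existsFormula]
        exact h t ht) φ hφ
      rw [← hν, witnessFormula, Formula.realize_relabel] at this
      convert this using 1
      ext x; rcases x with x | x <;> rfl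
  have htv : ∀ (k : ℕ) (φ : L.Formula (Fin 1 ⊕ Fin k)) (w : Fin k → WitnessName L M) (x : UPow U M),
      φ.Realize (Sum.elim (fun _ => x) (ν ∘ w)) →
      ∃ w', φ.Realize (Sum.elim (fun _ => ν w') (ν ∘ w)) := by
    intro k φ w x hx
    -- Parameters of a node are indexed by `M`, so the `k` names in `w` are placed at `k` distinct
    -- elements of the infinite set `M` and the other places are filled with base names.
    let e : Fin k ↪ M := Fin.valEmbedding.trans (Infinite.natEmbedding M)
    let p : M → WitnessName L M := Function.extend e w base
    have hp : ∀ i, p (e i) = w i := e.injective.extend_apply w base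
    have hel : ∀ a : Fin 1 → UPow U M, (φ.relabel (Sum.map id e)).Realize (Sum.elim a (ν ∘ p)) ↔
        φ.Realize (Sum.elim a (ν ∘ w)) := by
      intro a
      rw [Formula.realize_relabel]
      refine iff_of_eq (congrArg _ ?_)
      funext y
      rcases y with y | y
      · rfl
      · simp [hp]
    refine ⟨node 1 p {φ.relabel (Sum.map id e)} 0, ?_⟩
    have := hsat 1 p {φ.relabel (Sum.map id e)} (fun t ht => ⟨fun _ => x, fun ψ hψ => by
      rw [Set.mem_singleton_iff.1 (ht hψ), hel]; exact hx⟩) _ rfl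
    rw [hel] at this
    convert this using 3 with i
    rw [Subsingleton.elim i 0]
    rfl
  -- Closure under a function symbol is the case of `htv` for the formula defining its value; the
  -- Tarski–Vaught test is the general case.
  let C₀ : L.Substructure (UPow U M) :=
    { carrier := Set.range ν
      fun_mem := by
        intro k f x hx
        choose w hw using hx
        obtain ⟨w', hw'⟩ := htv k (Term.equal (Term.var (Sum.inl 0))
          (Term.func f fun i => Term.var (Sum.inr i))) w (Structure.funMap f x) (by
            simp only [Formula.realize_equal, Term.realize_var, Sum.elim_inl, Term.realize_func,
              Sum.elim_inr, Function.comp_apply, hw])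
        simp only [Formula.realize_equal, Term.realize_var, Sum.elim_inl, Term.realize_func,
              Sum.elim_inr, Function.comp_apply, hw] at hw'
        exact ⟨w', hw'⟩ }
  have hC₀ : C₀.IsElementary := by
    refine C₀.isElementary_of_exists fun k φ x a ha => ?_
    have hx : ∀ i, ∃ w, ν w = x i := fun i => (x i).2
    choose w hw using hx
    let r : Empty ⊕ Fin (k + 1) → Fin 1 ⊕ Fin k :=
      Sum.elim Empty.elim (Fin.snoc Sum.inr (Sum.inl 0))
    have hr : ∀ y : UPow U M, (φ.toFormula.relabel r).Realize (Sum.elim (fun _ => y) (ν ∘ w)) ↔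
        φ.Realize default (Fin.snoc ((↑) ∘ x) y : _ → UPow U M) := by
      intro y
      rw [Formula.realize_relabel, BoundedFormula.realize_toFormula,
        Subsingleton.elim ((Sum.elim (fun _ => y) (ν ∘ w) ∘ r) ∘ Sum.inl) default]
      refine iff_of_eq (congrArg _ ?_)
      funext i
      refine Fin.lastCases ?_ (fun i => ?_) i
      · simp [r]
      · simp [r, hw]
    obtain ⟨w', hw'⟩ := htv k (φ.toFormula.relabel r) w a ((hr a).2 ha)
    exact ⟨⟨ν w', w', rfl⟩, (hr _).1 hw'⟩
  let E : L.ElementarySubstructure (UPow U M) := ⟨C₀, hC₀⟩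
  let f : M ↪ₑ[L] E :=
    { toFun := fun m => ⟨ν (base m), base m, rfl⟩
      map_formula' := by
        intro n φ x
        rw [← E.subtype.map_formula]
        have h1 := UPow.realize_mk U φ fun i v => v.1 (base (x i))
        have h2 : (fun i => UPow.mk U fun v : Assignment L M => v.1 (base (x i))) =
          (⇑E.subtype ∘ (fun m => (⟨ν (base m), base m, rfl⟩ : E)) ∘ x) := rfl
        rw [h2] at h1
        rw [h1]
        have h3 : ∀ v : Assignment L M, (fun i => v.1 (base (x i))) = x := fun v => by
          funext i; exact v.2 _
        simp only [h3, Filter.eventually_const] }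
  refine ⟨E, inferInstance, f, ?_⟩
  intro A hA n Γ hΓ
  have hA' : #A ≤ #M := Order.lt_succ_iff.1 hA
  -- Here fewer than `|M|⁺` parameters means at most `|M|`, exactly as many as a node name can
  -- carry; so one node names a realization of the whole set `Γ`.
  obtain ⟨ι⟩ : Nonempty (A ↪ M) := hA'
  have hA : ∀ a : A, ∃ w, ν w = (a : E).1 := fun a => a.1.2
  choose w hw using hA
  let p : M → WitnessName L M := Function.extend ι w base
  have hp : ∀ a, p (ι a) = w a := ι.injective.extend_apply w base
  let Γ' : Set (L.Formula (Fin n ⊕ M)) := (fun φ => φ.relabel (Sum.map id ι)) '' Γ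
  have hel : ∀ (φ : L.Formula (Fin n ⊕ A)) (a : Fin n → E),
      (φ.relabel (Sum.map id ι) : L.Formula (Fin n ⊕ M)).Realize
        (Sum.elim (fun i => (a i).1) (ν ∘ p)) ↔ φ.Realize (Sum.elim a (↑)) := by
    intro φ a
    rw [Formula.realize_relabel, ← E.subtype.map_formula]
    refine iff_of_eq (congrArg _ ?_)
    funext y
    rcases y with y | y
    · rfl
    · simp [hp, hw]
  have key := hsat n p Γ' (by
    intro t ht
    obtain ⟨s, hs, rfl⟩ := Finset.subset_set_image_iff.1 ht
    obtain ⟨a, ha⟩ := hΓ (s.image (mapParams (↑))) (by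
      intro ψ hψ
      rw [Finset.mem_coe, Finset.mem_image] at hψ
      obtain ⟨φ, hφ, rfl⟩ := hψ
      exact ⟨φ, hs hφ, rfl⟩)
    refine ⟨fun i => (a i).1, fun ψ hψ => ?_⟩
    obtain ⟨φ, hφ, rfl⟩ := Finset.mem_image.1 hψ
    rw [hel]
    have := ha _ (Finset.mem_image_of_mem _ hφ)
    rw [show (fun i => id (a i)) = a from rfl, realize_mapParams] at this
    exact this)
  refine ⟨fun i => ⟨ν (node n p Γ' i), _, rfl⟩, fun φ hφ => ?_⟩
  rw [← hel]
  exact key _ ⟨φ, hφ, rfl⟩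

end Saturation

/-! ### Trees as meet semilattices. -/

section Semantics

variable {M : Type*} [lang.Structure M]

/-- The predicate `P`. -/
def InP (x : M) : Prop := Structure.RelMap (L := lang) Rel.P ![x]

/-- The predicate `Q`. -/
def InQ (x : M) : Prop := Structure.RelMap (L := lang) Rel.Q ![x]

/-- The tree order. -/
def Lt (x y : M) : Prop := Structure.RelMap (L := lang) Rel.lt ![x, y]

/-- The meet. -/
def meet (x y : M) : M := Structure.funMap (L := lang) Func.meet ![x, y]

/-- The function `H`. -/
def Hf (x : M) : M := Structure.funMap (L := lang) Func.H ![x]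

/-- The nonstrict tree order on `P`. -/
def Le (x y : M) : Prop := InP x ∧ InP y ∧ meet x y = x

theorem funMap_meet (x : Fin 2 → M) :
    Structure.funMap (L := lang) Func.meet x = meet (x 0) (x 1) := by
  rw [meet]
  congr 1
  funext i
  fin_cases i <;> rfl

theorem funMap_H (x : Fin 1 → M) : Structure.funMap (L := lang) Func.H x = Hf (x 0) := by
  rw [Hf]
  congr 1
  funext i
  fin_cases i
  rfl

theorem relMap_P (x : Fin 1 → M) : Structure.RelMap (L := lang) Rel.P x ↔ InP (x 0) := by
  rw [InP]
  refine iff_of_eq (congrArg _ ?_)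
  funext i
  fin_cases i
  rfl

theorem relMap_Q (x : Fin 1 → M) : Structure.RelMap (L := lang) Rel.Q x ↔ InQ (x 0) := by
  rw [InQ]
  refine iff_of_eq (congrArg _ ?_)
  funext i
  fin_cases i
  rfl

theorem relMap_lt (x : Fin 2 → M) :
    Structure.RelMap (L := lang) Rel.lt x ↔ Lt (x 0) (x 1) := by
  rw [Lt]
  refine iff_of_eq (congrArg _ ?_)
  funext i
  fin_cases i <;> rfl

@[simp]
theorem realize_tH {β : Type u} (t : lang.Term β) (v : β → M) :
    (tH t).realize v = Hf (t.realize v) :=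
  Term.realize_functions_apply₁

@[simp]
theorem realize_tMeet {β : Type u} (s t : lang.Term β) (v : β → M) :
    (tMeet s t).realize v = meet (s.realize v) (t.realize v) :=
  Term.realize_functions_apply₂

@[simp]
theorem realize_fP {α : Type u} {n : ℕ} (t : lang.Term (α ⊕ Fin n)) (v : α → M) (xs : Fin n → M) :
    (fP t).Realize v xs ↔ InP (t.realize (Sum.elim v xs)) :=
  BoundedFormula.realize_rel₁

@[simp]
theorem realize_fQ {α : Type u} {n : ℕ} (t : lang.Term (α ⊕ Fin n)) (v : α → M) (xs : Fin n → M) :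
    (fQ t).Realize v xs ↔ InQ (t.realize (Sum.elim v xs)) :=
  BoundedFormula.realize_rel₁

@[simp]
theorem realize_fLt {α : Type u} {n : ℕ} (s t : lang.Term (α ⊕ Fin n)) (v : α → M)
    (xs : Fin n → M) :
    (fLt s t).Realize v xs ↔ Lt (s.realize (Sum.elim v xs)) (t.realize (Sum.elim v xs)) :=
  BoundedFormula.realize_rel₂

variable (M)

/-- A meet tree with a colouring `H` of `P` by `Q` if `flag` holds, and with `H = id` otherwise. -/
structure IsTree (flag : Prop) : Prop where
  disj : ∀ x : M, InP x → ¬ InQ x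
  H_mem : flag → ∀ x : M, InP x → InQ (Hf x)
  H_of_not : ∀ x : M, ¬ InP x → Hf x = x
  H_id : ¬ flag → ∀ x : M, Hf x = x
  lt_iff : ∀ x y : M, Lt x y ↔ Le x y ∧ x ≠ y
  meet_mem : ∀ x y : M, InP x → InP y → InP (meet x y)
  meet_comm : ∀ x y : M, InP x → InP y → meet x y = meet y x
  meet_self : ∀ x : M, meet x x = x
  meet_assoc : ∀ x y z : M, InP x → InP y → InP z → meet (meet x y) z = meet x (meet y z)
  le_total : ∀ x y z : M, Le x z → Le y z → Le x y ∨ Le y x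
  meet_of_not : ∀ x y : M, ¬ (InP x ∧ InP y) → meet x y = x

/-- The extension properties of the existentially closed trees. -/
structure IsRich (flag : Prop) : Prop where
  exists_other : ∀ F : Finset M, ∃ x ∉ F, ¬ InP x ∧ ¬ InQ x
  exists_Q : ∀ F : Finset M, ∃ x ∉ F, InQ x
  exists_P : ∃ x : M, InP x
  exists_between : ∀ m x : M, InQ m → InP x → ∀ E : Finset M, (∀ e ∈ E, Lt e x) →
    ∃ d : M, Lt d x ∧ (∀ e ∈ E, Lt e d) ∧ (flag → Hf d = m)
  exists_branch : ∀ m d : M, InQ m → InP d → ∀ F : Finset M, (∀ y ∈ F, Lt d y) →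
    ∃ a : M, Lt d a ∧ (∀ y ∈ F, meet a y = d) ∧ (flag → Hf a = m)

variable {M}

variable (M) in
/-- The semantic content of the axioms of `univTheory` other than `H(P) ⊆ Q`. -/
structure OrderAxioms : Prop where
  disj : ∀ x : M, InP x → ¬ InQ x
  H_of_not : ∀ x : M, ¬ InP x → Hf x = x
  mem_of_lt : ∀ x y : M, Lt x y → InP x ∧ InP y
  irrefl : ∀ x : M, ¬ Lt x x
  trans : ∀ x y z : M, Lt x y → Lt y z → Lt x z
  total : ∀ x y z : M, Lt x z → Lt y z → (Lt x y ∨ x = y) ∨ Lt y x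
  meet_le : ∀ x y : M, InP x → InP y → (Lt (meet x y) x ∨ meet x y = x) ∧
    (Lt (meet x y) y ∨ meet x y = y)
  le_meet : ∀ x y z : M, InP x → InP y → Lt z x ∨ z = x → Lt z y ∨ z = y →
    Lt z (meet x y) ∨ z = meet x y
  meet_of_not : ∀ x y : M, (InP x → ¬ InP y) → meet x y = x

/-- The axioms of `univTheory` other than `H(P) ⊆ Q`. -/
def treeTheory : lang.Theory :=
  { ∀' ∼(fP &0 ⊓ fQ &0),
    ∀' (∼(fP &0) ⟹ Term.bdEqual (tH &0) &0),
    ∀' ∀' (fLt &0 &1 ⟹ fP &0 ⊓ fP &1),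
    ∀' ∼(fLt &0 &0),
    ∀' ∀' ∀' (fLt &0 &1 ⊓ fLt &1 &2 ⟹ fLt &0 &2),
    ∀' ∀' ∀' (fLt &0 &2 ⊓ fLt &1 &2 ⟹ fLe &0 &1 ⊔ fLt &1 &0),
    ∀' ∀' (fP &0 ⊓ fP &1 ⟹ fLe (tMeet &0 &1) &0 ⊓ fLe (tMeet &0 &1) &1),
    ∀' ∀' ∀' (fP &0 ⊓ fP &1 ⟹ fLe &2 &0 ⊓ fLe &2 &1 ⟹ fLe &2 (tMeet &0 &1)),
    ∀' ∀' (∼(fP &0 ⊓ fP &1) ⟹ Term.bdEqual (tMeet &0 &1) &0) }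

theorem univTheory_eq : univTheory = insert (∀' (fP &0 ⟹ fQ (tH &0))) treeTheory :=
  Set.insert_comm _ _ _

theorem model_treeTheory_iff : M ⊨ treeTheory ↔ OrderAxioms M := by
  simp only [treeTheory, Theory.model_iff, Set.mem_insert_iff, Set.mem_singleton_iff,
    forall_eq_or_imp, forall_eq,
    Sentence.Realize, Formula.Realize, BoundedFormula.realize_all, BoundedFormula.realize_imp,
    BoundedFormula.realize_not, BoundedFormula.realize_inf, BoundedFormula.realize_sup, realize_fP,
    realize_fQ, realize_fLt, fLe, BoundedFormula.realize_bdEqual, realize_tH, realize_tMeet,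
    Term.realize_var, Sum.elim_inr, Function.comp_apply]
  simp only [Fin.snoc, Nat.reduceAdd, Fin.isValue, Fin.val_eq_zero, lt_self_iff_false, ↓reduceDIte,
    Fin.coe_ofNat_eq_mod]
  simp only [Nat.zero_lt_one, Nat.one_lt_two, Nat.zero_lt_two, not_and, Nat.zero_mod, Nat.one_mod,
    ↓reduceDIte, cast_eq, and_imp]
  constructor
  · rintro ⟨h1, h2, h3, h4, h5, h6, h7, h8, h9⟩
    exact ⟨h1, h2, h3, h4, h5, h6, h7, h8, h9⟩
  · rintro ⟨h1, h2, h3, h4, h5, h6, h7, h8, h9⟩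
    exact ⟨h1, h2, h3, h4, h5, h6, h7, h8, h9⟩

theorem model_univTheory_iff :
    M ⊨ univTheory ↔ (∀ x : M, InP x → InQ (Hf x)) ∧ OrderAxioms M := by
  rw [univTheory_eq, Theory.model_insert_iff, model_treeTheory_iff]
  simp [Sentence.Realize, Formula.Realize, Fin.snoc]

theorem IsTree.le_refl {flag : Prop} (h : IsTree M flag) {x : M} (hx : InP x) : Le x x :=
  ⟨hx, hx, h.meet_self x⟩

theorem IsTree.le_trans {flag : Prop} (h : IsTree M flag) {x y z : M} (hxy : Le x y)
    (hyz : Le y z) : Le x z := by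
  refine ⟨hxy.1, hyz.2.1, ?_⟩
  conv_lhs => rw [← hxy.2.2]
  rw [h.meet_assoc _ _ _ hxy.1 hxy.2.1 hyz.2.1, hyz.2.2, hxy.2.2]

theorem IsTree.le_antisymm {flag : Prop} (h : IsTree M flag) {x y : M} (hxy : Le x y)
    (hyx : Le y x) : x = y := by
  rw [← hxy.2.2, h.meet_comm _ _ hxy.1 hyx.1, hyx.2.2]

theorem IsTree.meet_le_left {flag : Prop} (h : IsTree M flag) {x y : M} (hx : InP x)
    (hy : InP y) : Le (meet x y) x := by
  refine ⟨h.meet_mem _ _ hx hy, hx, ?_⟩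
  rw [h.meet_comm _ _ (h.meet_mem _ _ hx hy) hx, ← h.meet_assoc _ _ _ hx hx hy, h.meet_self]

theorem IsTree.meet_le_right {flag : Prop} (h : IsTree M flag) {x y : M} (hx : InP x)
    (hy : InP y) : Le (meet x y) y := by
  rw [h.meet_comm _ _ hx hy]
  exact h.meet_le_left hy hx

theorem IsTree.le_meet {flag : Prop} (h : IsTree M flag) {x y z : M} (hx : Le z x)
    (hy : Le z y) : Le z (meet x y) := by
  refine ⟨hx.1, h.meet_mem _ _ hx.2.1 hy.2.1, ?_⟩
  rw [← h.meet_assoc _ _ _ hx.1 hx.2.1 hy.2.1, hx.2.2, hy.2.2]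

theorem IsTree.le_of_lt {flag : Prop} (h : IsTree M flag) {x y : M} (hxy : Lt x y) : Le x y :=
  ((h.lt_iff _ _).1 hxy).1

theorem IsTree.ne_of_lt {flag : Prop} (h : IsTree M flag) {x y : M} (hxy : Lt x y) : x ≠ y :=
  ((h.lt_iff _ _).1 hxy).2

theorem IsTree.lt_of_le_of_not {flag : Prop} (h : IsTree M flag) {x y : M} (hxy : Le x y)
    (hyx : ¬ Le y x) : Lt x y :=
  (h.lt_iff _ _).2 ⟨hxy, by rintro rfl; exact hyx hxy⟩

theorem IsTree.not_le_of_lt {flag : Prop} (h : IsTree M flag) {x y : M} (hxy : Lt x y) :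
    ¬ Le y x := fun hyx => h.ne_of_lt hxy (h.le_antisymm (h.le_of_lt hxy) hyx)

theorem IsTree.lt_of_lt_of_le {flag : Prop} (h : IsTree M flag) {x y z : M} (hxy : Lt x y)
    (hyz : Le y z) : Lt x z :=
  h.lt_of_le_of_not (h.le_trans (h.le_of_lt hxy) hyz) fun hzx =>
    h.not_le_of_lt hxy (h.le_trans hyz hzx)

theorem IsTree.lt_of_le_of_lt {flag : Prop} (h : IsTree M flag) {x y z : M} (hxy : Le x y)
    (hyz : Lt y z) : Lt x z :=
  h.lt_of_le_of_not (h.le_trans hxy (h.le_of_lt hyz)) fun hzx =>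
    h.not_le_of_lt hyz (h.le_trans hzx hxy)

/-- Below a common bound, elements that are not `≤` are `>`. -/
theorem IsTree.lt_of_not_le {flag : Prop} (h : IsTree M flag) {x y z : M} (hx : Le x z)
    (hy : Le y z) (hxy : ¬ Le x y) : Lt y x :=
  h.lt_of_le_of_not ((h.le_total _ _ _ hx hy).resolve_left hxy) hxy

/-- If `a` is below `x` and not below `y`, then `x ∧ y = a ∧ y`. -/
theorem IsTree.meet_eq_of_not_le {flag : Prop} (h : IsTree M flag) {a x y : M} (hax : Le a x)
    (hy : InP y) (hay : ¬ Le a y) : meet x y = meet a y := by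
  refine h.le_antisymm (h.le_meet ?_ (h.meet_le_right hax.2.1 hy))
    (h.le_meet (h.le_trans (h.meet_le_left hax.1 hy) hax) (h.meet_le_right hax.1 hy))
  refine (h.le_total _ _ _ hax (h.meet_le_left hax.2.1 hy)).resolve_left fun h' => ?_
  exact hay (h.le_trans h' (h.meet_le_right hax.2.1 hy))

theorem IsTree.meet_eq_right {flag : Prop} (h : IsTree M flag) {x y : M} (hxy : Le y x) :
    meet x y = y := by
  rw [h.meet_comm _ _ hxy.2.1 hxy.1, hxy.2.2]

theorem IsTree.Hf_Hf {flag : Prop} (h : IsTree M flag) (x : M) : Hf (Hf x) = Hf x := by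
  by_cases hf : flag
  · by_cases hx : InP x
    · exact h.H_of_not _ fun h' => h.disj _ h' (h.H_mem hf _ hx)
    · rw [h.H_of_not _ hx, h.H_of_not _ hx]
  · rw [h.H_id hf (Hf x)]

theorem IsTree.not_InP_Hf {flag : Prop} (h : IsTree M flag) (hf : flag) (x : M) :
    ¬ InP (Hf x) := by
  by_cases hx : InP x
  · exact fun h' => h.disj _ h' (h.H_mem hf _ hx)
  · rwa [h.H_of_not _ hx]

theorem IsTree.not_InP_of_InQ {flag : Prop} (h : IsTree M flag) {x : M} (hx : InQ x) : ¬ InP x :=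
  fun h' => h.disj _ h' hx

/-- Antisymmetry makes greatest lower bounds unique. Hence `x ≤ y` amounts to `x ∧ y = x`, and
commutativity and associativity follow by comparing both sides as lower bounds. The equational form
is the convenient one for partial isomorphisms. -/
theorem OrderAxioms.isTree {flag : Prop} (h : OrderAxioms M)
    (h1 : flag → ∀ x : M, InP x → InQ (Hf x)) (h2 : ¬ flag → ∀ x : M, Hf x = x) :
    IsTree M flag := by
  have hself : ∀ x : M, meet x x = x := by
    intro x
    by_cases hx : InP x
    · refine (h.meet_le x x hx hx).1.resolve_left fun h' => ?_
      rcases h.le_meet x x x hx hx (Or.inr rfl) (Or.inr rfl) with h'' | h''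
      · exact h.irrefl _ (h.trans _ _ _ h' h'')
      · rw [← h''] at h'; exact h.irrefl _ h'
    · exact h.meet_of_not _ _ fun h' => (hx h').elim
  have hanti : ∀ x y : M, (Lt x y ∨ x = y) → (Lt y x ∨ y = x) → x = y := by
    rintro x y (hxy | hxy) (hyx | hyx)
    · exact (h.irrefl _ (h.trans _ _ _ hxy hyx)).elim
    all_goals first | exact hxy | exact hyx.symm
  have htrans : ∀ x y z : M, (Lt x y ∨ x = y) → (Lt y z ∨ y = z) → (Lt x z ∨ x = z) := by
    rintro x y z (hxy | rfl) (hyz | rfl)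
    · exact Or.inl (h.trans _ _ _ hxy hyz)
    · exact Or.inl hxy
    · exact Or.inl hyz
    · exact Or.inr rfl
  have hmem : ∀ x y : M, InP x → InP y → InP (meet x y) := by
    intro x y hx hy
    rcases (h.meet_le x y hx hy).1 with h' | h'
    · exact (h.mem_of_lt _ _ h').1
    · rwa [h']
  have hle : ∀ x y : M, Le x y ↔ InP x ∧ InP y ∧ (Lt x y ∨ x = y) := by
    intro x y
    refine ⟨fun ⟨hx, hy, hxy⟩ => ⟨hx, hy, ?_⟩, fun ⟨hx, hy, hxy⟩ => ⟨hx, hy, ?_⟩⟩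
    · have := (h.meet_le x y hx hy).2
      rwa [hxy] at this
    · exact hanti _ _ (h.meet_le x y hx hy).1 (h.le_meet _ _ _ hx hy (Or.inr rfl) hxy)
  refine ⟨h.disj, h1, h.H_of_not, h2, ?_, hmem, ?_, hself, ?_, ?_, ?_⟩
  · intro x y
    rw [hle]
    refine ⟨fun hxy => ⟨⟨(h.mem_of_lt _ _ hxy).1, (h.mem_of_lt _ _ hxy).2, Or.inl hxy⟩, ?_⟩,
      fun hxy => hxy.1.2.2.resolve_right hxy.2⟩
    rintro rfl
    exact h.irrefl _ hxy
  · intro x y hx hy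
    have h1 := h.meet_le x y hx hy
    have h2 := h.meet_le y x hy hx
    exact hanti _ _ (h.le_meet _ _ _ hy hx h1.2 h1.1) (h.le_meet _ _ _ hx hy h2.2 h2.1)
  · intro x y z hx hy hz
    have h1 := h.meet_le x y hx hy
    have h2 := h.meet_le y z hy hz
    have h3 := h.meet_le (meet x y) z (hmem _ _ hx hy) hz
    have h4 := h.meet_le x (meet y z) hx (hmem _ _ hy hz)
    refine hanti _ _ ?_ ?_
    · exact h.le_meet _ _ _ hx (hmem _ _ hy hz) (htrans _ _ _ h3.1 h1.1)
        (h.le_meet _ _ _ hy hz (htrans _ _ _ h3.1 h1.2) h3.2)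
    · exact h.le_meet _ _ _ (hmem _ _ hx hy) hz
        (h.le_meet _ _ _ hx hy h4.1 (htrans _ _ _ h4.2 h2.1)) (htrans _ _ _ h4.2 h2.2)
  · intro x y z hx hy
    rw [hle] at hx hy ⊢
    rw [hle]
    rcases hx with ⟨hx, hz, hxz | rfl⟩ <;> rcases hy with ⟨hy, -, hyz | rfl⟩
    · rcases h.total _ _ _ hxz hyz with h' | h'
      · exact Or.inl ⟨hx, hy, h'⟩
      · exact Or.inr ⟨hy, hx, Or.inl h'⟩
    · exact Or.inl ⟨hx, hy, Or.inl hxz⟩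
    · exact Or.inr ⟨hy, hx, Or.inl hyz⟩
    · exact Or.inl ⟨hx, hy, Or.inr rfl⟩
  · intro x y hxy
    exact h.meet_of_not _ _ fun hx hy => hxy ⟨hx, hy⟩

theorem IsTree.orderAxioms {flag : Prop} (h : IsTree M flag) : OrderAxioms M where
  disj := h.disj
  H_of_not := h.H_of_not
  mem_of_lt x y hxy := ⟨(h.le_of_lt hxy).1, (h.le_of_lt hxy).2.1⟩
  irrefl x hx := h.ne_of_lt hx rfl
  trans x y z hxy hyz := h.lt_of_lt_of_le hxy (h.le_of_lt hyz)
  total x y z hxz hyz := by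
    by_cases hxy : x = y
    · exact Or.inl (Or.inr hxy)
    · rcases h.le_total _ _ _ (h.le_of_lt hxz) (h.le_of_lt hyz) with h' | h'
      · exact Or.inl (Or.inl ((h.lt_iff _ _).2 ⟨h', hxy⟩))
      · exact Or.inr ((h.lt_iff _ _).2 ⟨h', fun h' => hxy h'.symm⟩)
  meet_le x y hx hy := by
    simp only [h.lt_iff, h.meet_le_left hx hy, h.meet_le_right hx hy, true_and]
    exact ⟨ne_or_eq _ _, ne_or_eq _ _⟩
  le_meet x y z hx hy hzx hzy := by
    have h1 : Le z x := by
      rcases hzx with h' | rfl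
      exacts [h.le_of_lt h', h.le_refl hx]
    have h2 : Le z y := by
      rcases hzy with h' | rfl
      exacts [h.le_of_lt h', h.le_refl hy]
    simp only [h.lt_iff, h.le_meet h1 h2, true_and]
    exact ne_or_eq _ _
  meet_of_not x y hxy := h.meet_of_not _ _ fun h' => hxy h'.1 h'.2

theorem isTree_of_model [h : M ⊨ univTheory] : IsTree M True :=
  (model_univTheory_iff.1 h).2.isTree (fun _ => (model_univTheory_iff.1 h).1) fun h' =>
    (h' trivial).elim

theorem IsTree.model_univTheory (h : IsTree M True) : M ⊨ univTheory :=
  model_univTheory_iff.2 ⟨h.H_mem trivial, h.orderAxioms⟩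

end Semantics

/-! ### Back and forth between rich trees. -/

section BackAndForth

variable {M N : Type*} [lang.Structure M] [lang.Structure N]

/-- A partial isomorphism between substructures, given as a set of pairs. -/
structure PIso (s : Set (M × N)) : Prop where
  eq_iff : ∀ p ∈ s, ∀ q ∈ s, p.1 = q.1 ↔ p.2 = q.2
  P_iff : ∀ p ∈ s, InP p.1 ↔ InP p.2
  Q_iff : ∀ p ∈ s, InQ p.1 ↔ InQ p.2
  meet_mem : ∀ p ∈ s, ∀ q ∈ s, (meet p.1 q.1, meet p.2 q.2) ∈ s
  H_mem : ∀ p ∈ s, (Hf p.1, Hf p.2) ∈ s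

theorem PIso.le_iff {s : Set (M × N)} (h : PIso s) {p q : M × N} (hp : p ∈ s) (hq : q ∈ s) :
    Le p.1 q.1 ↔ Le p.2 q.2 := by
  rw [Le, Le, h.P_iff p hp, h.P_iff q hq]
  exact and_congr_right fun _ => and_congr_right fun _ =>
    h.eq_iff _ (h.meet_mem p hp q hq) _ hp

theorem PIso.lt_iff {fM fN : Prop} (hM : IsTree M fM) (hN : IsTree N fN) {s : Set (M × N)}
    (h : PIso s) {p q : M × N} (hp : p ∈ s) (hq : q ∈ s) : Lt p.1 q.1 ↔ Lt p.2 q.2 := by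
  rw [hM.lt_iff, hN.lt_iff, h.le_iff hp hq, Ne, Ne, h.eq_iff p hp q hq]

theorem PIso.symm {s : Set (M × N)} (h : PIso s) : PIso (Prod.swap '' s) := by
  constructor
  · rintro _ ⟨p, hp, rfl⟩ _ ⟨q, hq, rfl⟩
    exact (h.eq_iff p hp q hq).symm
  · rintro _ ⟨p, hp, rfl⟩
    exact (h.P_iff p hp).symm
  · rintro _ ⟨p, hp, rfl⟩
    exact (h.Q_iff p hp).symm
  · rintro _ ⟨p, hp, rfl⟩ _ ⟨q, hq, rfl⟩
    exact ⟨_, h.meet_mem p hp q hq, rfl⟩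
  · rintro _ ⟨p, hp, rfl⟩
    exact ⟨_, h.H_mem p hp, rfl⟩

theorem PIso.empty : PIso (∅ : Set (M × N)) := by
  constructor <;> simp

/-- Adding one pair to a partial isomorphism. -/
theorem PIso.insert {fM fN : Prop} (hM : IsTree M fM) (hN : IsTree N fN) {s : Set (M × N)}
    (h : PIso s) {a : M} {a' : N} (ha : ∀ p ∈ s, p.1 ≠ a) (ha' : ∀ p ∈ s, p.2 ≠ a')
    (hP : InP a ↔ InP a') (hQ : InQ a ↔ InQ a')
    (hH : (Hf a, Hf a') ∈ insert (a, a') s)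
    (hmeet : ∀ p ∈ s, InP a → InP p.1 → (meet a p.1, meet a' p.2) ∈ insert (a, a') s) :
    PIso (insert (a, a') s) := by
  have hm : ∀ p ∈ s, (meet a p.1, meet a' p.2) ∈ Insert.insert (a, a') s ∧
      (meet p.1 a, meet p.2 a') ∈ Insert.insert (a, a') s := by
    intro p hp
    by_cases hap : InP a ∧ InP p.1
    · have h1 := hmeet p hp hap.1 hap.2
      refine ⟨h1, ?_⟩
      rwa [hM.meet_comm _ _ hap.2 hap.1,
        hN.meet_comm _ _ ((h.P_iff p hp).1 hap.2) (hP.1 hap.1)]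
    · have hap' : ¬ (InP a' ∧ InP p.2) := by rwa [← hP, ← h.P_iff p hp]
      rw [hM.meet_of_not _ _ hap, hN.meet_of_not _ _ hap',
        hM.meet_of_not _ _ fun h => hap h.symm, hN.meet_of_not _ _ fun h => hap' h.symm]
      exact ⟨Or.inl rfl, Or.inr hp⟩
  constructor
  · rintro p (rfl | hp) q (rfl | hq)
    · exact iff_of_true rfl rfl
    · exact iff_of_false (ha q hq).symm (ha' q hq).symm
    · exact iff_of_false (ha p hp) (ha' p hp)
    · exact h.eq_iff p hp q hq
  · rintro p (rfl | hp)
    exacts [hP, h.P_iff p hp]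
  · rintro p (rfl | hp)
    exacts [hQ, h.Q_iff p hp]
  · rintro p (rfl | hp) q (rfl | hq)
    · rw [hM.meet_self, hN.meet_self]
      exact Or.inl rfl
    · exact (hm q hq).1
    · exact (hm p hp).2
    · exact Or.inr (h.meet_mem p hp q hq)
  · rintro p (rfl | hp)
    exacts [hH, Or.inr (h.H_mem p hp)]

variable {flag : Prop}

/-- Outside `P` the functions are trivial, so a fresh point of the same kind is a correct image. The
final clause, that no point of `P` is added, lets colours be inserted later without disturbing the
minimal or maximal choices made in the tree. -/
theorem PIso.exists_extend_of_not_InP (hM : IsTree M flag) (hN : IsTree N flag)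
    (rN : IsRich N flag) {s : Set (M × N)} (h : PIso s) (hs : s.Finite) {a : M} (ha : ¬ InP a) :
    ∃ s', s ⊆ s' ∧ s'.Finite ∧ PIso s' ∧ (∃ a', (a, a') ∈ s' ∧ (InQ a → InQ a')) ∧
      ∀ p ∈ s', InP p.1 → p ∈ s := by
  classical
  by_cases hd : ∃ p ∈ s, p.1 = a
  · obtain ⟨p, hp, rfl⟩ := hd
    exact ⟨s, subset_rfl, hs, h, ⟨p.2, hp, (h.Q_iff p hp).1⟩, fun _ h _ => h⟩
  · have hd' : ∀ p ∈ s, p.1 ≠ a := fun p hp hpa => hd ⟨p, hp, hpa⟩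
    have : ∃ a' : N, (∀ p ∈ s, p.2 ≠ a') ∧ ¬ InP a' ∧ (InQ a ↔ InQ a') := by
      by_cases haQ : InQ a
      · obtain ⟨a', h1, h2⟩ := rN.exists_Q (hs.toFinset.image Prod.snd)
        refine ⟨a', fun p hp hpa => h1 ?_, hN.not_InP_of_InQ h2, iff_of_true haQ h2⟩
        exact Finset.mem_image.2 ⟨p, hs.mem_toFinset.2 hp, hpa⟩
      · obtain ⟨a', h1, h2, h3⟩ := rN.exists_other (hs.toFinset.image Prod.snd)
        refine ⟨a', fun p hp hpa => h1 ?_, h2, iff_of_false haQ h3⟩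
        exact Finset.mem_image.2 ⟨p, hs.mem_toFinset.2 hp, hpa⟩
    obtain ⟨a', h1, h2, h3⟩ := this
    refine ⟨Insert.insert (a, a') s, Set.subset_insert _ _, hs.insert _,
      h.insert hM hN hd' h1 (iff_of_false ha h2) h3 ?_ (fun _ _ h' => (ha h').elim),
      ⟨a', Or.inl rfl, h3.1⟩, ?_⟩
    · rw [hM.H_of_not _ ha, hN.H_of_not _ h2]
      exact Or.inl rfl
    · rintro p (rfl | hp) hP
      exacts [(ha hP).elim, hp]

/-- Make room for the colour of `a`. -/
theorem PIso.exists_extend_H (hM : IsTree M flag) (hN : IsTree N flag)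
    (rN : IsRich N flag) {s : Set (M × N)} (h : PIso s) (hs : s.Finite) {a : M} (ha : InP a) :
    ∃ s', s ⊆ s' ∧ s'.Finite ∧ PIso s' ∧ (∃ m', InQ m' ∧ (flag → (Hf a, m') ∈ s')) ∧
      ∀ p ∈ s', InP p.1 → p ∈ s := by
  by_cases hf : flag
  · obtain ⟨s', h1, h2, h3, ⟨m', h4, h5⟩, h6⟩ :=
      h.exists_extend_of_not_InP hM hN rN hs (hM.not_InP_Hf hf a)
    exact ⟨s', h1, h2, h3, ⟨m', h5 (hM.H_mem hf a ha), fun _ => h4⟩, h6⟩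
  · obtain ⟨m', -, hm'⟩ := rN.exists_Q ∅
    exact ⟨s, subset_rfl, hs, h, ⟨m', hm', fun h => (hf h).elim⟩, fun _ h _ => h⟩

theorem PIso.H_mem_insert (hM : IsTree M flag) (hN : IsTree N flag) {s : Set (M × N)}
    {a : M} {a' m' : N} (hm' : flag → (Hf a, m') ∈ s) (ha' : flag → Hf a' = m') :
    (Hf a, Hf a') ∈ Insert.insert (a, a') s := by
  by_cases hf : flag
  · rw [ha' hf]; exact Or.inr (hm' hf)
  · rw [hM.H_id hf, hN.H_id hf]; exact Or.inl rfl

/-- A finite nonempty family closed under meets has a least element. -/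
theorem PIso.exists_least (hM : IsTree M flag) {s : Set (M × N)} (h : PIso s) (hs : s.Finite)
    {R : M → Prop} (hR : ∀ x y, R x → R y → (∃ b, (meet x y, b) ∈ s) → R (meet x y))
    (hRP : ∀ x, R x → InP x) (hne : ∃ p ∈ s, R p.1) :
    ∃ p ∈ s, R p.1 ∧ ∀ q ∈ s, R q.1 → Le p.1 q.1 := by
  have : ∀ t : Set (M × N), t.Finite → t ⊆ s →
      ∃ p ∈ s, R p.1 ∧ ∀ q ∈ t, R q.1 → Le p.1 q.1 := by
    intro t ht
    induction t, ht using Set.Finite.induction_on with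
    | empty => intro _; obtain ⟨p, hp, hpR⟩ := hne; exact ⟨p, hp, hpR, by simp⟩
    | @insert q t _ _ ih =>
      intro hts
      obtain ⟨p, hp, hpR, hpt⟩ := ih ((Set.subset_insert _ _).trans hts)
      have hq := hts (Set.mem_insert _ _)
      by_cases hqR : R q.1
      · have hm := h.meet_mem p hp q hq
        refine ⟨_, hm, hR _ _ hpR hqR ⟨_, hm⟩, ?_⟩
        rintro r (rfl | hr) hrR
        · exact hM.meet_le_right (hRP _ hpR) (hRP _ hqR)
        · exact hM.le_trans (hM.meet_le_left (hRP _ hpR) (hRP _ hqR)) (hpt r hr hrR)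
      · refine ⟨p, hp, hpR, ?_⟩
        rintro r (rfl | hr) hrR
        exacts [(hqR hrR).elim, hpt r hr hrR]
  obtain ⟨p, hp, h1, h2⟩ := this s hs subset_rfl
  exact ⟨p, hp, h1, h2⟩

/-- Extend a partial isomorphism to a point below its domain. -/
theorem PIso.exists_extend_below (hM : IsTree M flag) (hN : IsTree N flag)
    (rN : IsRich N flag) {s : Set (M × N)} (h : PIso s) (hs : s.Finite) {d : M}
    (hd : ∃ p ∈ s, Le d p.1) :
    ∃ s', s ⊆ s' ∧ s'.Finite ∧ PIso s' ∧ (∃ d', (d, d') ∈ s') ∧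
      ∀ p ∈ s', InP p.1 → p ∈ s ∨ p.1 = d := by
  classical
  by_cases hdom : ∃ p ∈ s, p.1 = d
  · obtain ⟨p, hp, rfl⟩ := hdom
    exact ⟨s, subset_rfl, hs, h, ⟨p.2, hp⟩, fun _ h _ => Or.inl h⟩
  obtain ⟨p₀, hp₀, hdp₀⟩ := hd
  have hdP : InP d := hdp₀.1
  obtain ⟨s₁, hs₁, hfin, h₁, ⟨m', hm'Q, hm'⟩, hP₁⟩ := h.exists_extend_H hM hN rN hs hdP
  have hdom : ∀ p ∈ s₁, p.1 ≠ d := fun p hp hpd => hdom ⟨p, hP₁ p hp (hpd ▸ hdP), hpd⟩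
  have hlt : ∀ p ∈ s₁, Le d p.1 → Lt d p.1 := fun p hp hp' =>
    (hM.lt_iff _ _).2 ⟨hp', (hdom p hp).symm⟩
  -- Let `x` be the least point of the domain above `d`. The image of `d` goes just below that of
  -- `x`, above the images of all domain points below `d`, with the prescribed colour.
  obtain ⟨x, hx, hdx, hmin⟩ := h₁.exists_least hM hfin (R := fun x => Lt d x)
    (fun x y hx hy ⟨b, hb⟩ => hlt _ hb (hM.le_meet (hM.le_of_lt hx) (hM.le_of_lt hy)))
    (fun x hx => (hM.le_of_lt hx).2.1) ⟨p₀, hs₁ hp₀, hlt _ (hs₁ hp₀) hdp₀⟩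
  have hxP := (hM.le_of_lt hdx).2.1
  have hxP' := (h₁.P_iff x hx).1 hxP
  obtain ⟨d', hd'x, hd'E, hd'H⟩ := rN.exists_between m' x.2 hm'Q hxP'
    ((hfin.toFinset.filter fun p => Lt p.1 d).image Prod.snd) (by
      intro e he
      obtain ⟨p, hp, rfl⟩ := Finset.mem_image.1 he
      rw [Finset.mem_filter, Set.Finite.mem_toFinset] at hp
      exact (h₁.lt_iff hM hN hp.1 hx).1 (hM.lt_of_lt_of_le hp.2 (hM.le_of_lt hdx)))
  have hd'P := (hN.le_of_lt hd'x).1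
  have hE : ∀ p ∈ s₁, Lt p.1 d → Lt p.2 d' := fun p hp hpd =>
    hd'E _ (Finset.mem_image_of_mem _ (Finset.mem_filter.2 ⟨hfin.mem_toFinset.2 hp, hpd⟩))
  refine ⟨Insert.insert (d, d') s₁, hs₁.trans (Set.subset_insert _ _), hfin.insert _,
    h₁.insert hM hN hdom ?_ (iff_of_true hdP hd'P)
      (iff_of_false (hM.disj _ hdP) (hN.disj _ hd'P)) (PIso.H_mem_insert hM hN hm' hd'H) ?_,
    ⟨d', Or.inl rfl⟩, ?_⟩
  · rintro p hp rfl
    have hpx : Lt p.1 x.1 := (h₁.lt_iff hM hN hp hx).2 hd'x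
    by_cases hpd : Le d p.1
    · exact hM.not_le_of_lt hpx (hmin p hp (hlt p hp hpd))
    · exact hN.ne_of_lt (hE p hp (hM.lt_of_not_le (hM.le_of_lt hdx) (hM.le_of_lt hpx) hpd)) rfl
  · intro p hp _ hpP
    have hpP' := (h₁.P_iff p hp).1 hpP
    by_cases hpd : Le d p.1
    · have h1 := hmin p hp (hlt p hp hpd)
      have h2 := (h₁.le_iff hx hp).1 h1
      rw [hpd.2.2, (hN.le_trans (hN.le_of_lt hd'x) h2).2.2]
      exact Or.inl rfl
    · have hxp := h₁.meet_mem x hx p hp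
      -- If `d` is not below `p`, then `d ∧ p = x ∧ p`, which is a point of the domain strictly
      -- below `d`. The same replacement has to be justified on the other side.
      rw [← hM.meet_eq_of_not_le (hM.le_of_lt hdx) hpP hpd]
      have hlt1 : Lt (meet x.1 p.1) d := hM.lt_of_not_le (hM.le_of_lt hdx)
        (hM.meet_le_left hxP hpP) fun h' => hpd (hM.le_trans h' (hM.meet_le_right hxP hpP))
      have hlt2 := hE _ hxp hlt1
      have hnot : ¬ Le d' p.2 := fun h' =>
        hN.not_le_of_lt hlt2 (hN.le_meet (hN.le_of_lt hd'x) h')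
      rw [← hN.meet_eq_of_not_le (hN.le_of_lt hd'x) hpP' hnot]
      exact Or.inr hxp
  · rintro p (rfl | hp) hpP
    exacts [Or.inr rfl, Or.inl (hP₁ p hp hpP)]

/-- The forth step: a finite partial isomorphism into a rich tree extends to any point. -/
theorem PIso.exists_extend (hM : IsTree M flag) (hN : IsTree N flag)
    (rN : IsRich N flag) {s : Set (M × N)} (h : PIso s) (hs : s.Finite) (a : M) :
    ∃ s', s ⊆ s' ∧ s'.Finite ∧ PIso s' ∧ ∃ a', (a, a') ∈ s' := by
  classical
  by_cases haP : InP a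
  swap
  · obtain ⟨s', h1, h2, h3, ⟨a', h4, -⟩, -⟩ := h.exists_extend_of_not_InP hM hN rN hs haP
    exact ⟨s', h1, h2, h3, a', h4⟩
  by_cases hne : ∃ p ∈ s, InP p.1
  -- The points `a ∧ q` form a finite chain below `a`. The largest, `d`, is where `a` leaves the
  -- tree spanned by the domain; it is added first, and then `a` is placed in a fresh cone over it.
  · have : ∀ t : Set (M × N), t.Finite → t ⊆ s →
        ∃ p ∈ s, InP p.1 ∧ ∀ q ∈ t, InP q.1 → Le (meet a q.1) (meet a p.1) := by
      intro t ht
      induction t, ht using Set.Finite.induction_on with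
      | empty => intro _; obtain ⟨p, hp, hpR⟩ := hne; exact ⟨p, hp, hpR, by simp⟩
      | @insert q t _ _ ih =>
        intro hts
        obtain ⟨p, hp, hpP, hpt⟩ := ih ((Set.subset_insert _ _).trans hts)
        have hq := hts (Set.mem_insert _ _)
        by_cases hqP : InP q.1
        · rcases hM.le_total _ _ _ (hM.meet_le_left haP hpP) (hM.meet_le_left haP hqP) with h' | h'
          · refine ⟨q, hq, hqP, ?_⟩
            rintro r (rfl | hr) hrP
            exacts [hM.le_refl (hM.meet_mem _ _ haP hrP), hM.le_trans (hpt r hr hrP) h']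
          · refine ⟨p, hp, hpP, ?_⟩
            rintro r (rfl | hr) hrP
            exacts [h', hpt r hr hrP]
        · refine ⟨p, hp, hpP, ?_⟩
          rintro r (rfl | hr) hrP
          exacts [(hqP hrP).elim, hpt r hr hrP]
    obtain ⟨p₀, hp₀, hp₀P, hmax⟩ := this s hs subset_rfl
    set d := meet a p₀.1 with hd
    have hda : Le d a := hM.meet_le_left haP hp₀P
    obtain ⟨s₁, hs₁, hfin₁, h₁, ⟨d', hd'⟩, hP₁⟩ := h.exists_extend_below hM hN rN hs
      ⟨p₀, hp₀, hM.meet_le_right haP hp₀P⟩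
    obtain ⟨s₂, hs₂, hfin₂, h₂, ⟨m', hm'Q, hm'⟩, hP₂⟩ := h₁.exists_extend_H hM hN rN hfin₁ haP
    have hd₂ := hs₂ hd'
    have hd'P : InP d' := (h₂.P_iff _ hd₂).1 hda.1
    by_cases had : a = d
    · exact ⟨s₂, hs₁.trans hs₂, hfin₂, h₂, d', had ▸ hd₂⟩
    have hda' : Lt d a := (hM.lt_iff _ _).2 ⟨hda, fun h => had h.symm⟩
    have hmax₂ : ∀ q ∈ s₂, InP q.1 → Le (meet a q.1) d := by
      intro q hq hqP
      rcases hP₁ q (hP₂ q hq hqP) hqP with hq | hq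
      · exact hmax q hq hqP
      · rw [hq]; exact hM.meet_le_right haP hda.1
    have hdom : ∀ q ∈ s₂, q.1 ≠ a := by
      rintro q hq rfl
      have := hmax₂ q hq haP
      rw [hM.meet_self] at this
      exact hM.not_le_of_lt hda' this
    obtain ⟨a', hda', haF, haH⟩ := rN.exists_branch m' d' hm'Q hd'P
      ((hfin₂.toFinset.filter fun p => Lt d p.1).image Prod.snd) (by
        intro y hy
        obtain ⟨p, hp, rfl⟩ := Finset.mem_image.1 hy
        rw [Finset.mem_filter, Set.Finite.mem_toFinset] at hp
        exact (h₂.lt_iff hM hN hd₂ hp.1).1 hp.2)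
    have ha'P := (hN.le_of_lt hda').2.1
    have hF : ∀ p ∈ s₂, Lt d p.1 → meet a' p.2 = d' := fun p hp hpd =>
      haF _ (Finset.mem_image_of_mem _ (Finset.mem_filter.2 ⟨hfin₂.mem_toFinset.2 hp, hpd⟩))
    refine ⟨Insert.insert (a, a') s₂, (hs₁.trans hs₂).trans (Set.subset_insert _ _), hfin₂.insert _,
      h₂.insert hM hN hdom ?_ (iff_of_true haP ha'P)
        (iff_of_false (hM.disj _ haP) (hN.disj _ ha'P)) (PIso.H_mem_insert hM hN hm' haH) ?_,
      a', Or.inl rfl⟩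
    · rintro p hp rfl
      have := hF p hp ((h₂.lt_iff hM hN hd₂ hp).2 hda')
      rw [hN.meet_self] at this
      exact hN.ne_of_lt hda' this.symm
    · intro p hp _ hpP
      have hpP' := (h₂.P_iff p hp).1 hpP
      refine Or.inr ?_
      -- For `p` above `d`, maximality of `d` gives `a ∧ p = d`; otherwise `a ∧ p = d ∧ p`. Both lie
      -- in the domain already.
      by_cases hdp : Le d p.1
      · have h1 : meet a p.1 = d := hM.le_antisymm (hmax₂ p hp hpP) (hM.le_meet hda hdp)
        have h2 : meet a' p.2 = d' := by
          by_cases hdp' : d = p.1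
          · have : d' = p.2 := (h₂.eq_iff _ hd₂ _ hp).1 hdp'
            rw [← this, hN.meet_eq_right (hN.le_of_lt hda')]
          · exact hF p hp ((hM.lt_iff _ _).2 ⟨hdp, hdp'⟩)
        rw [h1, h2]
        exact hd₂
      · rw [hM.meet_eq_of_not_le hda hpP hdp, hN.meet_eq_of_not_le (hN.le_of_lt hda') hpP'
          fun h' => hdp ((h₂.le_iff hd₂ hp).2 h')]
        exact h₂.meet_mem _ hd₂ p hp
  · obtain ⟨s₁, hs₁, hfin, h₁, ⟨m', hm'Q, hm'⟩, hP₁⟩ := h.exists_extend_H hM hN rN hs haP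
    have hnP : ∀ p ∈ s₁, ¬ InP p.1 := fun p hp hpP => hne ⟨p, hP₁ p hp hpP, hpP⟩
    obtain ⟨x, hx⟩ := rN.exists_P
    -- With no point of `P` in the domain, only the colour of the image matters. An arbitrary `x` in
    -- `P` may have the wrong colour, but some point below it has the right one.
    obtain ⟨a', ha'x, -, ha'H⟩ := rN.exists_between m' x hm'Q hx ∅ (by simp)
    have ha'P := (hN.le_of_lt ha'x).1
    refine ⟨Insert.insert (a, a') s₁, hs₁.trans (Set.subset_insert _ _), hfin.insert _,
      h₁.insert hM hN ?_ ?_ (iff_of_true haP ha'P)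
        (iff_of_false (hM.disj _ haP) (hN.disj _ ha'P)) (PIso.H_mem_insert hM hN hm' ha'H)
        (fun p hp _ hpP => (hnP p hp hpP).elim), a', Or.inl rfl⟩
    · rintro p hp rfl
      exact hnP p hp haP
    · rintro p hp rfl
      exact hnP p hp ((h₁.P_iff p hp).2 ha'P)

theorem PIso.funMap_mem {s : Set (M × N)} (h : PIso s) {k : ℕ} (f : lang.Functions k)
    {x : Fin k → M} {y : Fin k → N} (hxy : ∀ i, (x i, y i) ∈ s) :
    (Structure.funMap f x, Structure.funMap f y) ∈ s := by
  cases f with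
  | meet => rw [funMap_meet, funMap_meet]; exact h.meet_mem _ (hxy 0) _ (hxy 1)
  | H => rw [funMap_H, funMap_H]; exact h.H_mem _ (hxy 0)

theorem PIso.relMap_iff (hM : IsTree M flag) (hN : IsTree N flag) {s : Set (M × N)} (h : PIso s)
    {k : ℕ} (R : lang.Relations k) {x : Fin k → M} {y : Fin k → N} (hxy : ∀ i, (x i, y i) ∈ s) :
    Structure.RelMap R x ↔ Structure.RelMap R y := by
  cases R with
  | P => rw [relMap_P, relMap_P]; exact h.P_iff _ (hxy 0)
  | Q => rw [relMap_Q, relMap_Q]; exact h.Q_iff _ (hxy 0)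
  | lt => rw [relMap_lt, relMap_lt]; exact h.lt_iff hM hN (hxy 0) (hxy 1)

theorem PIso.term_mem {s : Set (M × N)} (h : PIso s) {α : Type*} (t : lang.Term α) {v : α → M}
    {w : α → N} (hvw : ∀ i, (v i, w i) ∈ s) : (t.realize v, t.realize w) ∈ s := by
  induction t with
  | var i => exact hvw i
  | func f ts ih => exact h.funMap_mem f ih

/-- Finite partial isomorphisms between rich trees are elementary. -/
theorem PIso.realize_boundedFormula (hM : IsTree M flag) (hN : IsTree N flag)
    (rM : IsRich M flag) (rN : IsRich N flag) {α : Type*} {n : ℕ} (φ : lang.BoundedFormula α n)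
    {s : Set (M × N)} (h : PIso s) (hs : s.Finite) {v : α → M} {w : α → N} {xs : Fin n → M}
    {ys : Fin n → N} (hvw : ∀ i, (v i, w i) ∈ s) (hxy : ∀ i, (xs i, ys i) ∈ s) :
    φ.Realize v xs ↔ φ.Realize w ys := by
  induction φ generalizing s with
  | falsum => rfl
  | equal t₁ t₂ =>
    have hz : ∀ i, (Sum.elim v xs i, Sum.elim w ys i) ∈ s := by rintro (i | i); exacts [hvw i, hxy i]
    exact h.eq_iff _ (h.term_mem t₁ hz) _ (h.term_mem t₂ hz)
  | rel R ts =>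
    have hz : ∀ i, (Sum.elim v xs i, Sum.elim w ys i) ∈ s := by rintro (i | i); exacts [hvw i, hxy i]
    exact h.relMap_iff hM hN R fun i => h.term_mem (ts i) hz
  | imp φ ψ ihφ ihψ =>
    rw [BoundedFormula.realize_imp, BoundedFormula.realize_imp, ihφ h hs hvw hxy, ihψ h hs hvw hxy]
  | @all n φ ih =>
    rw [BoundedFormula.realize_all, BoundedFormula.realize_all]
    have hsnoc : ∀ {s' : Set (M × N)} {a : M} {b : N}, s ⊆ s' → (a, b) ∈ s' →
        ∀ i, (Fin.snoc (α := fun _ => M) xs a i, Fin.snoc (α := fun _ => N) ys b i) ∈ s' := by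
      intro s' a b hss hab i
      refine Fin.lastCases ?_ (fun i => ?_) i
      · simpa using hab
      · simpa using hss (hxy i)
    constructor
    · intro H b
      obtain ⟨s', hss, hfin, h', a, ha⟩ := h.symm.exists_extend hN hM rM (hs.image _) b
      have hss' : s ⊆ Prod.swap '' s' := fun p hp => ⟨_, hss ⟨p, hp, rfl⟩, Prod.swap_swap p⟩
      have hab : (a, b) ∈ Prod.swap '' s' := ⟨_, ha, rfl⟩
      exact (ih h'.symm (hfin.image _) (fun i => hss' (hvw i)) (hsnoc hss' hab)).1 (H a)
    · intro H a
      obtain ⟨s', hss, hfin, h', b, hab⟩ := h.exists_extend hM hN rN hs a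
      exact (ih h' hfin (fun i => hss (hvw i)) (hsnoc hss hab)).2 (H b)

theorem PIso.realize_formula (hM : IsTree M flag) (hN : IsTree N flag)
    (rM : IsRich M flag) (rN : IsRich N flag) {α : Type*} (φ : lang.Formula α)
    {s : Set (M × N)} (h : PIso s) (hs : s.Finite) {v : α → M} {w : α → N}
    (hvw : ∀ i, (v i, w i) ∈ s) : φ.Realize v ↔ φ.Realize w :=
  h.realize_boundedFormula hM hN rM rN φ hs hvw fun i => i.elim0

end BackAndForth

/-! ### Generated substructures and quantifier elimination. -/

section AtomicEquivalence

variable {M N : Type*} [lang.Structure M] [lang.Structure N] {flag : Prop}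

/-- The meets `v i ∧ v j` that generate the closure of a tuple: both points are in `P`, or the meet
is the trivial one. -/
def OkPair {α : Type*} (v : α → M) (i j : α) : Prop := i = j ∨ InP (v i) ∧ InP (v j)

/-- Two tuples satisfy the same atomic formulas (in trees). -/
structure AtomEq (flag : Prop) {α : Type*} (v : α → M) (w : α → N) : Prop where
  P_iff : ∀ i, InP (v i) ↔ InP (w i)
  Q_iff : ∀ i, InQ (v i) ↔ InQ (w i)
  eq_iff : ∀ i j, v i = v j ↔ w i = w j
  le_iff : ∀ i j k, InP (v i) → InP (v j) → InP (v k) →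
    (Le (meet (v i) (v j)) (v k) ↔ Le (meet (w i) (w j)) (w k))
  H_iff : flag → ∀ i j k l, OkPair v i j → OkPair v k l →
    (Hf (meet (v i) (v j)) = Hf (meet (v k) (v l)) ↔
      Hf (meet (w i) (w j)) = Hf (meet (w k) (w l)))

theorem AtomEq.comp {α β : Type*} {v : α → M} {w : α → N} (h : AtomEq flag v w) (e : β → α) :
    AtomEq flag (v ∘ e) (w ∘ e) where
  P_iff _ := h.P_iff _
  Q_iff _ := h.Q_iff _
  eq_iff _ _ := h.eq_iff _ _
  le_iff _ _ _ := h.le_iff _ _ _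
  H_iff hf _ _ _ _ h1 h2 := h.H_iff hf _ _ _ _ (h1.imp_left (congrArg e)) (h2.imp_left (congrArg e))

/-- The graph of the isomorphism between the substructures generated by two tuples. -/
def closureGraph {α : Type*} (v : α → M) (w : α → N) : Set (M × N) :=
  {p | ∃ i j, OkPair v i j ∧ (p = (meet (v i) (v j), meet (w i) (w j)) ∨
    p = (Hf (meet (v i) (v j)), Hf (meet (w i) (w j))))}

theorem closureGraph_finite {α : Type*} [Finite α] (v : α → M) (w : α → N) :
    (closureGraph v w).Finite := by
  refine ((Set.finite_range fun x : α × α =>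
    (meet (v x.1) (v x.2), meet (w x.1) (w x.2))).union (Set.finite_range fun x : α × α =>
    (Hf (meet (v x.1) (v x.2)), Hf (meet (w x.1) (w x.2))))).subset ?_
  rintro p ⟨i, j, -, rfl | rfl⟩
  exacts [Or.inl ⟨(i, j), rfl⟩, Or.inr ⟨(i, j), rfl⟩]

theorem mem_closureGraph {α : Type*} (hM : IsTree M flag) (hN : IsTree N flag) (v : α → M)
    (w : α → N) (i : α) : (v i, w i) ∈ closureGraph v w :=
  ⟨i, i, Or.inl rfl, Or.inl (by rw [hM.meet_self, hN.meet_self])⟩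

theorem OkPair.InP_iff {α : Type*} (hM : IsTree M flag) {v : α → M} {i j : α}
    (h : OkPair v i j) : InP (meet (v i) (v j)) ↔ InP (v i) ∧ InP (v j) := by
  rcases h with rfl | h
  · rw [hM.meet_self, and_self]
  · exact iff_of_true (hM.meet_mem _ _ h.1 h.2) h

theorem OkPair.of_atomEq {α : Type*} {v : α → M} {w : α → N} (h : AtomEq flag v w) {i j : α}
    (hij : OkPair v i j) : OkPair w i j :=
  hij.imp_right fun h' => ⟨(h.P_iff _).1 h'.1, (h.P_iff _).1 h'.2⟩

theorem OkPair.eq_of_not {α : Type*} {v : α → M} {i j : α}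
    (h : OkPair v i j) (hP : ¬ (InP (v i) ∧ InP (v j))) : i = j := h.resolve_right hP

/-- `(vᵢ ∧ vⱼ) ∧ vₖ` is `vᵢ ∧ vⱼ` or `vᵢ ∧ vₖ`, depending on the atomic type. -/
theorem AtomEq.meet_meet {α : Type*} (hM : IsTree M flag) (hN : IsTree N flag) {v : α → M}
    {w : α → N} (h : AtomEq flag v w) {i j k : α} (hi : InP (v i)) (hj : InP (v j))
    (hk : InP (v k)) :
    ∃ l, InP (v l) ∧ meet (meet (v i) (v j)) (v k) = meet (v i) (v l) ∧
      meet (meet (w i) (w j)) (w k) = meet (w i) (w l) := by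
  have hi' := (h.P_iff i).1 hi
  have hj' := (h.P_iff j).1 hj
  have hk' := (h.P_iff k).1 hk
  by_cases hle : Le (meet (v i) (v j)) (v k)
  · exact ⟨j, hj, hle.2.2, ((h.le_iff i j k hi hj hk).1 hle).2.2⟩
  · have hle' : ¬ Le (meet (w i) (w j)) (w k) := fun h' => hle ((h.le_iff i j k hi hj hk).2 h')
    exact ⟨k, hk, (hM.meet_eq_of_not_le (hM.meet_le_left hi hj) hk hle).symm,
      (hN.meet_eq_of_not_le (hN.meet_le_left hi' hj') hk' hle').symm⟩

/-- An equality of greatest lower bounds becomes four comparisons of a meet with a generator, the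
form recorded in `AtomEq.le_iff`. -/
theorem IsTree.meet_le_iff (hM : IsTree M flag) {x y z t : M} (hx : InP x) (hy : InP y)
    (hz : InP z) (ht : InP t) :
    meet x y = meet z t ↔ (Le (meet x y) z ∧ Le (meet x y) t) ∧
      (Le (meet z t) x ∧ Le (meet z t) y) := by
  constructor
  · intro h
    refine ⟨?_, ?_⟩
    · rw [h]; exact ⟨hM.meet_le_left hz ht, hM.meet_le_right hz ht⟩
    · rw [← h]; exact ⟨hM.meet_le_left hx hy, hM.meet_le_right hx hy⟩
  · rintro ⟨h1, h2⟩
    exact hM.le_antisymm (hM.le_meet h1.1 h1.2) (hM.le_meet h2.1 h2.2)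

theorem AtomEq.meet_eq_iff {α : Type*} (hM : IsTree M flag) (hN : IsTree N flag) {v : α → M}
    {w : α → N} (h : AtomEq flag v w) {i j k l : α} (hij : OkPair v i j) (hkl : OkPair v k l) :
    meet (v i) (v j) = meet (v k) (v l) ↔ meet (w i) (w j) = meet (w k) (w l) := by
  by_cases h1 : InP (v i) ∧ InP (v j) <;> by_cases h2 : InP (v k) ∧ InP (v l)
  · rw [hM.meet_le_iff h1.1 h1.2 h2.1 h2.2, hN.meet_le_iff ((h.P_iff _).1 h1.1)
      ((h.P_iff _).1 h1.2) ((h.P_iff _).1 h2.1) ((h.P_iff _).1 h2.2),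
      h.le_iff _ _ _ h1.1 h1.2 h2.1, h.le_iff _ _ _ h1.1 h1.2 h2.2, h.le_iff _ _ _ h2.1 h2.2 h1.1,
      h.le_iff _ _ _ h2.1 h2.2 h1.2]
  · have e := hkl.eq_of_not h2
    subst e
    refine iff_of_false (fun h' => h2 ?_) fun h' => h2 ?_
    · rw [← hkl.InP_iff hM, ← h', hij.InP_iff hM]; exact h1
    · rw [h.P_iff, ← (hkl.of_atomEq h).InP_iff hN, ← h', (hij.of_atomEq h).InP_iff hN, ← h.P_iff,
        ← h.P_iff]
      exact h1
  · have e := hij.eq_of_not h1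
    subst e
    refine iff_of_false (fun h' => h1 ?_) fun h' => h1 ?_
    · rw [← hij.InP_iff hM, h', hkl.InP_iff hM]; exact h2
    · rw [h.P_iff, ← (hij.of_atomEq h).InP_iff hN, h', (hkl.of_atomEq h).InP_iff hN, ← h.P_iff,
        ← h.P_iff]
      exact h2
  · have e := hkl.eq_of_not h2
    subst e
    have e := hij.eq_of_not h1
    subst e
    rw [hM.meet_self, hM.meet_self, hN.meet_self, hN.meet_self, h.eq_iff]

/-- Iterated meets of generators reduce to pairwise meets by `AtomEq.meet_meet`, and colours are
fixed by `H`. So pairwise meets and their colours already form a substructure, finite for a finite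
tuple, and the atomic data determine the correspondence on it. -/
theorem AtomEq.pIso {α : Type*} (hM : IsTree M flag) (hN : IsTree N flag) {v : α → M}
    {w : α → N} (h : AtomEq flag v w) : PIso (closureGraph v w) := by
  have hmP : ∀ {i j}, OkPair v i j → (InP (meet (v i) (v j)) ↔ InP (meet (w i) (w j))) := by
    intro i j hij
    rw [hij.InP_iff hM, (hij.of_atomEq h).InP_iff hN, h.P_iff, h.P_iff]
  -- With a genuine colouring no colour lies in `P`, so both sides fail for a meet in `P`. A meet
  -- outside `P` is its own colour, and the statement becomes one about two colours.
  have hmix : ∀ {i j k l}, OkPair v i j → OkPair v k l →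
      (meet (v i) (v j) = Hf (meet (v k) (v l)) ↔ meet (w i) (w j) = Hf (meet (w k) (w l))) := by
    intro i j k l hij hkl
    by_cases hf : flag
    · by_cases hP : InP (meet (v i) (v j))
      · refine iff_of_false (fun h' => ?_) fun h' => ?_
        · rw [h'] at hP; exact hM.not_InP_Hf hf _ hP
        · rw [hmP hij, h'] at hP; exact hN.not_InP_Hf hf _ hP
      · have hP' := hP
        rw [hmP hij] at hP'
        have := h.H_iff hf i j k l hij hkl
        rwa [hM.H_of_not _ hP, hN.H_of_not _ hP'] at this
    · rw [hM.H_id hf, hN.H_id hf]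
      exact h.meet_eq_iff hM hN hij hkl
  have hHH : ∀ {i j k l}, OkPair v i j → OkPair v k l →
      (Hf (meet (v i) (v j)) = Hf (meet (v k) (v l)) ↔
        Hf (meet (w i) (w j)) = Hf (meet (w k) (w l))) := by
    intro i j k l hij hkl
    by_cases hf : flag
    · exact h.H_iff hf i j k l hij hkl
    · rw [hM.H_id hf, hN.H_id hf, hM.H_id hf, hN.H_id hf]
      exact h.meet_eq_iff hM hN hij hkl
  have hHP : ∀ {i j}, OkPair v i j →
      (InP (Hf (meet (v i) (v j))) ↔ InP (Hf (meet (w i) (w j)))) := by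
    intro i j hij
    by_cases hf : flag
    · exact iff_of_false (hM.not_InP_Hf hf _) (hN.not_InP_Hf hf _)
    · rw [hM.H_id hf, hN.H_id hf, hmP hij]
  have hP : ∀ p ∈ closureGraph v w, InP p.1 ↔ InP p.2 := by
    rintro p ⟨i, j, hij, rfl | rfl⟩
    exacts [hmP hij, hHP hij]
  have hmQ : ∀ {i j}, OkPair v i j → (InQ (meet (v i) (v j)) ↔ InQ (meet (w i) (w j))) := by
    intro i j hij
    by_cases hp : InP (meet (v i) (v j))
    · exact iff_of_false (hM.disj _ hp) (hN.disj _ ((hmP hij).1 hp))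
    · have := hij.eq_of_not (fun h' => hp ((hij.InP_iff hM).2 h'))
      subst this
      rw [hM.meet_self, hN.meet_self, h.Q_iff]
  constructor
  · rintro p ⟨i, j, hij, rfl | rfl⟩ q ⟨k, l, hkl, rfl | rfl⟩
    · exact h.meet_eq_iff hM hN hij hkl
    · exact hmix hij hkl
    · exact eq_comm.trans ((hmix hkl hij).trans eq_comm)
    · exact hHH hij hkl
  · exact hP
  · rintro p ⟨i, j, hij, rfl | rfl⟩
    · exact hmQ hij
    · by_cases hp : InP (meet (v i) (v j))
      · by_cases hf : flag
        · exact iff_of_true (hM.H_mem hf _ hp) (hN.H_mem hf _ ((hmP hij).1 hp))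
        · rw [hM.H_id hf, hN.H_id hf, hmQ hij]
      · rw [hM.H_of_not _ hp, hN.H_of_not _ fun h' => hp ((hmP hij).2 h'), hmQ hij]
  · intro p hp q hq
    by_cases hPP : InP p.1 ∧ InP q.1
    · have hPP' := hPP
      rw [hP p hp, hP q hq] at hPP'
      have hpm : ∀ p ∈ closureGraph v w, InP p.1 →
          ∃ i j, InP (v i) ∧ InP (v j) ∧ p = (meet (v i) (v j), meet (w i) (w j)) := by
        rintro p ⟨i, j, hij, rfl | rfl⟩ hp
        · exact ⟨i, j, ((hij.InP_iff hM).1 hp).1, ((hij.InP_iff hM).1 hp).2, rfl⟩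
        · by_cases hf : flag
          · exact (hM.not_InP_Hf hf _ hp).elim
          · rw [hM.H_id hf] at hp ⊢
            rw [hN.H_id hf]
            exact ⟨i, j, ((hij.InP_iff hM).1 hp).1, ((hij.InP_iff hM).1 hp).2, rfl⟩
      obtain ⟨i, j, hi, hj, rfl⟩ := hpm p hp hPP.1
      obtain ⟨k, l, hk, hl, rfl⟩ := hpm q hq hPP.2
      -- Meeting with `v k` and then with `v l` each time merely changes the second generator, and
      -- in the same way on both sides.
      obtain ⟨a, ha, e1, e2⟩ := h.meet_meet hM hN hi hj hk
      obtain ⟨b, hb, e3, e4⟩ := h.meet_meet hM hN hi ha hl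
      refine ⟨i, b, Or.inr ⟨hi, hb⟩, Or.inl ?_⟩
      dsimp only
      rw [← hM.meet_assoc _ _ _ hPP.1 hk hl, e1, e3,
        ← hN.meet_assoc _ _ _ hPP'.1 ((h.P_iff k).1 hk) ((h.P_iff l).1 hl), e2, e4]
    · have hPP' := hPP
      rw [hP p hp, hP q hq] at hPP'
      rw [hM.meet_of_not _ _ hPP, hN.meet_of_not _ _ hPP']
      exact hp
  · rintro p ⟨i, j, hij, rfl | rfl⟩
    · exact ⟨i, j, hij, Or.inr rfl⟩
    · exact ⟨i, j, hij, Or.inr (by rw [hM.Hf_Hf, hN.Hf_Hf])⟩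

/-- Quantifier elimination for rich trees. -/
theorem AtomEq.realize_iff (hM : IsTree M flag) (hN : IsTree N flag)
    (rM : IsRich M flag) (rN : IsRich N flag) {α : Type*} {v : α → M} {w : α → N}
    (h : AtomEq flag v w) (φ : lang.Formula α) : φ.Realize v ↔ φ.Realize w := by
  classical
  have hv := BoundedFormula.realize_restrictFreeVar (φ := φ) (f := id)
    (v := fun a => v a) (xs := (default : Fin 0 → M)) v (fun _ => rfl)
  have hw := BoundedFormula.realize_restrictFreeVar (φ := φ) (f := id)
    (v := fun a => w a) (xs := (default : Fin 0 → N)) w (fun _ => rfl)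
  have h' := h.comp (Subtype.val : φ.freeVarFinset → α)
  exact hv.symm.trans (((h'.pIso hM hN).realize_formula hM hN rM rN (φ.restrictFreeVar id)
    (closureGraph_finite _ _) (mem_closureGraph hM hN _ _)).trans hw)

section Embedding

variable (f : M ↪[lang] N)

@[simp]
theorem embedding_InP (x : M) : InP (f x) ↔ InP x := by
  have := f.map_rel (Rel.P : lang.Relations 1) ![x]
  rwa [relMap_P, relMap_P] at this

@[simp]
theorem embedding_InQ (x : M) : InQ (f x) ↔ InQ x := by
  have := f.map_rel (Rel.Q : lang.Relations 1) ![x]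
  rwa [relMap_Q, relMap_Q] at this

theorem embedding_meet (x y : M) : f (meet x y) = meet (f x) (f y) := by
  have := f.map_fun (Func.meet : lang.Functions 2) ![x, y]
  rwa [funMap_meet, funMap_meet] at this

theorem embedding_Hf (x : M) : f (Hf x) = Hf (f x) := by
  have := f.map_fun (Func.H : lang.Functions 1) ![x]
  rwa [funMap_H, funMap_H] at this

@[simp]
theorem embedding_Le (x y : M) : Le (f x) (f y) ↔ Le x y := by
  rw [Le, Le, embedding_InP, embedding_InP, ← embedding_meet, f.injective.eq_iff]

@[simp]
theorem embedding_Lt (x y : M) : Lt (f x) (f y) ↔ Lt x y := by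
  have := f.map_rel (Rel.lt : lang.Relations 2) ![x, y]
  rwa [relMap_lt, relMap_lt] at this

end Embedding

/-- Tuples that correspond under embeddings of a common structure are atomically equivalent. -/
theorem atomEq_of_embedding {A : Type*} [lang.Structure A] {α : Type*} (f : A ↪[lang] M)
    (g : A ↪[lang] N) (v : α → A) : AtomEq flag (f ∘ v) (g ∘ v) := by
  constructor <;> intros <;>
    simp only [Function.comp_apply, embedding_InP, embedding_InQ, ← embedding_meet, embedding_Le,
      ← embedding_Hf, f.injective.eq_iff, g.injective.eq_iff]

end AtomicEquivalence

/-! ### An explicit rich tree. -/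

section GenericTree

/-- The colours of the generic tree. -/
abbrev Colour : Type := ℝ ⧸ (Rat.castHom ℝ).toAddMonoidHom.range

/-- A colour is a coset of `ℚ` in `ℝ`, hence dense. Colouring nodes by the class of their level
therefore makes every colour dense along every path. -/
theorem exists_colour_eq {a b : ℝ} (hab : a < b) (c : Colour) :
    ∃ t, a < t ∧ t < b ∧ (t : Colour) = c := by
  obtain ⟨r, rfl⟩ := QuotientAddGroup.mk_surjective c
  obtain ⟨q, h1, h2⟩ := exists_rat_btwn (sub_lt_sub_right hab r)
  refine ⟨r + q, by linarith, by linarith, ?_⟩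
  rw [eq_comm, QuotientAddGroup.eq]
  exact ⟨q, by simp⟩

instance : Infinite Colour := by
  by_contra h
  rw [not_infinite_iff_finite] at h
  have : Countable (Rat.castHom ℝ).toAddMonoidHom.range :=
    (Set.countable_range fun q : ℚ => (Rat.castHom ℝ).toAddMonoidHom q).to_subtype
  have h2 : Countable ℝ :=
    (AddSubgroup.addGroupEquivQuotientProdAddSubgroup
      (s := (Rat.castHom ℝ).toAddMonoidHom.range)).injective.countable
  exact Cardinal.not_countable_real (Set.countable_univ_iff.2 h2)

/-- A node at level `q` is a finitely supported function on the levels below `q`. -/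
@[ext]
structure TreeNode where
  /-- The level of the node. -/
  level : ℝ
  /-- The branching of the path to the node. -/
  path : ℝ →₀ ℕ
  path_eq_zero : ∀ s, level ≤ s → path s = 0

namespace TreeNode

instance : PartialOrder TreeNode where
  le x y := x.level ≤ y.level ∧ ∀ s < x.level, x.path s = y.path s
  le_refl x := ⟨le_rfl, fun _ _ => rfl⟩
  le_trans x y z h1 h2 := ⟨h1.1.trans h2.1, fun s hs => (h1.2 s hs).trans (h2.2 s (hs.trans_le h1.1))⟩
  le_antisymm x y h1 h2 := by
    have h := h1.1.antisymm h2.1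
    ext s
    · exact h
    · rcases lt_or_ge s x.level with hs | hs
      · exact h1.2 s hs
      · rw [x.path_eq_zero s hs, y.path_eq_zero s (h ▸ hs)]

theorem lt_iff {x y : TreeNode} :
    x < y ↔ x.level < y.level ∧ ∀ s < x.level, x.path s = y.path s := by
  rw [lt_iff_le_and_ne]
  refine ⟨fun h => ⟨h.1.1.lt_of_ne fun h' => h.2 ?_, h.1.2⟩, fun h => ⟨⟨h.1.le, h.2⟩, ?_⟩⟩
  · exact le_antisymm h.1 ⟨h'.ge, fun s hs => (h.1.2 s (h' ▸ hs)).symm⟩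
  · rintro rfl
    exact lt_irrefl _ h.1

/-- The restriction of a node to a lower level. -/
noncomputable def trunc (x : TreeNode) (t : ℝ) : TreeNode where
  level := t
  path := x.path.filter (· < t)
  path_eq_zero s hs := by simp [hs]

theorem trunc_path {x : TreeNode} {t s : ℝ} (hs : s < t) : (x.trunc t).path s = x.path s := by
  simp [trunc, hs]

/-- The level of the meet. -/
noncomputable def meetLevel (x y : TreeNode) : ℝ :=
  (insert x.level (insert y.level ((x.path.support ∪ y.path.support).filter
    fun s => x.path s ≠ y.path s))).min' (Finset.insert_nonempty _ _)

/-- Finite support of paths leaves only finitely many levels of disagreement, so a first one exists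
even though the levels are real. The equivalence is the universal property behind `⊓`. -/
theorem le_meetLevel_iff {x y : TreeNode} {t : ℝ} :
    t ≤ meetLevel x y ↔ t ≤ x.level ∧ t ≤ y.level ∧ ∀ s < t, x.path s = y.path s := by
  simp only [meetLevel, Finset.le_min'_iff, Finset.forall_mem_insert, Finset.mem_filter,
    Finset.mem_union, Finsupp.mem_support_iff]
  refine and_congr_right fun _ => and_congr_right fun _ => ⟨fun h s hs => ?_, fun h s hs => ?_⟩
  · by_contra hne
    refine absurd (h s ⟨?_, hne⟩) hs.not_ge
    by_contra h'
    push Not at h'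
    exact hne (h'.1.trans h'.2.symm)
  · by_contra hlt
    exact hs.2 (h s (not_le.1 hlt))

noncomputable instance : SemilatticeInf TreeNode where
  inf x y := x.trunc (meetLevel x y)
  inf_le_left x y :=
    ⟨(le_meetLevel_iff.1 le_rfl).1, fun _ hs => trunc_path hs⟩
  inf_le_right x y :=
    ⟨(le_meetLevel_iff.1 le_rfl).2.1, fun _ hs =>
      (trunc_path hs).trans ((le_meetLevel_iff.1 le_rfl).2.2 _ hs)⟩
  le_inf z x y h1 h2 := by
    have : z.level ≤ meetLevel x y :=
      le_meetLevel_iff.2 ⟨h1.1, h2.1, fun s hs => (h1.2 s hs).symm.trans (h2.2 s hs)⟩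
    exact ⟨this, fun s hs => (h1.2 s hs).trans (trunc_path (hs.trans_le this)).symm⟩

theorem le_total_of_le {x y z : TreeNode} (hx : x ≤ z) (hy : y ≤ z) : x ≤ y ∨ y ≤ x := by
  rcases le_total x.level y.level with h | h
  · exact Or.inl ⟨h, fun s hs => (hx.2 s hs).trans (hy.2 s (hs.trans_le h)).symm⟩
  · exact Or.inr ⟨h, fun s hs => (hy.2 s hs).trans (hx.2 s (hs.trans_le h)).symm⟩

end TreeNode

/-- The generic tree: nodes, colours, and points outside `P` and `Q`. -/
inductive GenericTree : Type
  | node : TreeNode → GenericTree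
  | colour : Colour → GenericTree
  | other : ℕ → GenericTree

namespace GenericTree

/-- The meet. -/
noncomputable def meetFun : GenericTree → GenericTree → GenericTree
  | node x, node y => node (x ⊓ y)
  | a, _ => a

/-- The colouring. -/
noncomputable def colourFun : GenericTree → GenericTree
  | node x => colour x.level
  | a => a

noncomputable instance : lang.Structure GenericTree where
  funMap := fun f v => match f with
    | Func.meet => meetFun (v 0) (v 1)
    | Func.H => colourFun (v 0)
  RelMap := fun r v => match r with
    | Rel.P => ∃ x, v 0 = node x
    | Rel.Q => ∃ x, v 0 = colour x
    | Rel.lt => ∃ x y, v 0 = node x ∧ v 1 = node y ∧ x < y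

@[simp]
theorem InP_iff {a : GenericTree} : InP a ↔ ∃ x, a = node x := Iff.rfl

@[simp]
theorem InQ_iff {a : GenericTree} : InQ a ↔ ∃ x, a = colour x := Iff.rfl

@[simp]
theorem Lt_node {x y : TreeNode} : Lt (node x) (node y) ↔ x < y := by
  refine ⟨?_, fun h => ⟨x, y, rfl, rfl, h⟩⟩
  rintro ⟨x', y', hx, hy, h⟩
  cases hx
  cases hy
  exact h

theorem exists_node_of_Lt {a b : GenericTree} (h : Lt a b) :
    ∃ x y, a = node x ∧ b = node y ∧ x < y := h

@[simp]
theorem meet_node (x y : TreeNode) : meet (node x) (node y) = node (x ⊓ y) := rfl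

theorem isTree : IsTree GenericTree True := by
  have hle : ∀ x y : TreeNode, (Lt (node x) (node y) ∨ node x = node y) ↔ x ≤ y := by
    intro x y
    rw [Lt_node, node.injEq, le_iff_lt_or_eq]
  refine OrderAxioms.isTree ⟨?_, ?_, ?_, ?_, ?_, ?_, ?_, ?_, ?_⟩ ?_ fun h => (h trivial).elim
  · rintro _ ⟨x, rfl⟩ ⟨y, hy⟩
    cases hy
  · rintro (x | x | x) hx
    · exact (hx ⟨x, rfl⟩).elim
    · rfl
    · rfl
  · intro a b h
    obtain ⟨x, y, rfl, rfl, -⟩ := exists_node_of_Lt h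
    exact ⟨⟨x, rfl⟩, ⟨y, rfl⟩⟩
  · intro a h
    obtain ⟨x, y, rfl, h', h⟩ := exists_node_of_Lt h
    cases h'
    exact lt_irrefl _ h
  · intro a b c h1 h2
    obtain ⟨x, y, rfl, rfl, hxy⟩ := exists_node_of_Lt h1
    obtain ⟨y', z, e, rfl, hyz⟩ := exists_node_of_Lt h2
    cases e
    exact Lt_node.2 (hxy.trans hyz)
  · intro a b c h1 h2
    obtain ⟨x, z, rfl, rfl, hxz⟩ := exists_node_of_Lt h1
    obtain ⟨y, z', rfl, e, hyz⟩ := exists_node_of_Lt h2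
    cases e
    rw [hle, Lt_node]
    rcases TreeNode.le_total_of_le hxz.le hyz.le with h | h
    · exact Or.inl h
    · rcases h.lt_or_eq with h | h
      · exact Or.inr h
      · exact Or.inl h.ge
  · rintro _ _ ⟨x, rfl⟩ ⟨y, rfl⟩
    rw [meet_node, hle, hle]
    exact ⟨inf_le_left, inf_le_right⟩
  · rintro _ _ a ⟨x, rfl⟩ ⟨y, rfl⟩ h1 h2
    obtain ⟨z, rfl⟩ : ∃ z, a = node z := by
      rcases h1 with h1 | rfl
      · obtain ⟨z, -, rfl, -⟩ := exists_node_of_Lt h1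
        exact ⟨z, rfl⟩
      · exact ⟨x, rfl⟩
    rw [hle] at h1 h2
    rw [meet_node, hle]
    exact le_inf h1 h2
  · rintro (x | x | x) (y | y | y) h
    · exact (h ⟨x, rfl⟩ ⟨y, rfl⟩).elim
    all_goals rfl
  · rintro - _ ⟨x, rfl⟩
    exact ⟨_, rfl⟩

/-- Truncating a path at a level from the right coset gives points between. An unused natural number
as the path value at the level of `d` opens a new cone over `d`. -/
theorem isRich : IsRich GenericTree True := by
  classical
  have hinf : ∀ {ι : Type} [Infinite ι] (g : ι → GenericTree), Function.Injective g →
      ∀ F : Finset GenericTree, ∃ i, g i ∉ F := by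
    intro ι _ g hg F
    by_contra h
    push Not at h
    exact (Set.infinite_range_of_injective hg)
      (F.finite_toSet.subset (by rintro _ ⟨i, rfl⟩; exact h i))
  constructor
  · intro F
    obtain ⟨i, hi⟩ := hinf other (fun a b h => by cases h; rfl) F
    refine ⟨_, hi, ?_, ?_⟩ <;> simp
  · intro F
    obtain ⟨i, hi⟩ := hinf colour (fun a b h => by cases h; rfl) F
    exact ⟨_, hi, i, rfl⟩
  · exact ⟨node ⟨0, 0, by simp⟩, _, rfl⟩
  · rintro _ _ ⟨c, rfl⟩ ⟨x, rfl⟩ E hE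
    have : ∃ r < x.level, ∀ y, node y ∈ E → y.level ≤ r := by
      -- The values off the nodes are placeholders: `E` contains only nodes. The extra value
      -- `x.level - 1` keeps the maximum defined when `E` is empty.
      let g : GenericTree → ℝ := fun a => match a with
        | node y => y.level
        | _ => x.level - 1
      have hne : (insert (x.level - 1) (E.image g)).Nonempty := Finset.insert_nonempty _ _
      refine ⟨(insert (x.level - 1) (E.image g)).max' hne, ?_, fun y hy => ?_⟩
      · rw [Finset.max'_lt_iff]
        intro r hr
        rw [Finset.mem_insert, Finset.mem_image] at hr
        rcases hr with rfl | ⟨a, ha, rfl⟩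
        · exact sub_one_lt _
        · obtain ⟨y, x', rfl, e, h⟩ := exists_node_of_Lt (hE a ha)
          cases e
          exact (TreeNode.lt_iff.1 h).1
      · have : g (node y) ∈ E.image g := Finset.mem_image_of_mem g hy
        exact Finset.le_max' (insert (x.level - 1) (E.image g)) y.level
          (Finset.mem_insert_of_mem this)
    obtain ⟨r, hr, hrE⟩ := this
    obtain ⟨t, hrt, htx, htc⟩ := exists_colour_eq hr c
    refine ⟨node (x.trunc t), Lt_node.2 (TreeNode.lt_iff.2 ⟨htx, fun s hs =>
      TreeNode.trunc_path hs⟩), fun e he => ?_, fun _ => congrArg colour htc⟩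
    obtain ⟨y, x', rfl, e, h⟩ := exists_node_of_Lt (hE e he)
    cases e
    have hyt : y.level < t := (hrE y he).trans_lt hrt
    exact Lt_node.2 (TreeNode.lt_iff.2 ⟨hyt, fun s hs =>
      (h.le.2 s hs).trans (TreeNode.trunc_path (hs.trans hyt)).symm⟩)
  · rintro _ _ ⟨c, rfl⟩ ⟨d, rfl⟩ F hF
    let g : GenericTree → ℕ := fun a => match a with
      | node y => y.path d.level
      | _ => 0
    obtain ⟨n, hn⟩ := Infinite.exists_notMem_finset (F.image g)
    obtain ⟨t, hdt, -, htc⟩ := exists_colour_eq (lt_add_one d.level) c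
    let a : TreeNode :=
      { level := t
        path := d.path + Finsupp.single d.level n
        path_eq_zero := fun s hs => by
          have hds : d.level < s := hdt.trans_le hs
          simp [d.path_eq_zero s hds.le, hds.ne] }
    have ha : ∀ s < d.level, d.path s = a.path s := fun s hs => by
      simp [a, hs.ne']
    have hda : d < a := TreeNode.lt_iff.2 ⟨hdt, ha⟩
    have had : a.path d.level = n := by simp [a, d.path_eq_zero _ le_rfl]
    refine ⟨node a, Lt_node.2 hda, fun b hb => ?_, fun _ => congrArg colour htc⟩
    obtain ⟨d', y, e, rfl, h⟩ := exists_node_of_Lt (hF b hb)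
    cases e
    rw [meet_node]
    refine congrArg node (le_antisymm ?_ (le_inf hda.le h.le))
    -- A meet at a level above that of `d` would make the paths of `a` and `y` agree at `d.level`,
    -- where the value of `a` is the unused number `n`.
    have hlev : (a ⊓ y).level ≤ d.level := by
      by_contra hlt
      rw [not_le] at hlt
      have h1 := (inf_le_left : a ⊓ y ≤ a).2 _ hlt
      have h2 := (inf_le_right : a ⊓ y ≤ y).2 _ hlt
      refine hn (Finset.mem_image.2 ⟨_, hb, ?_⟩)
      change y.path d.level = n
      rw [← h2, h1, had]
    exact ⟨hlev, fun s hs => ((inf_le_left : a ⊓ y ≤ a).2 s hs).trans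
      (ha s (hs.trans_le hlev)).symm⟩

end GenericTree

end GenericTree

/-! ### Axiomatizing rich trees. -/

section RichTheory

variable {α : Type u}

/-- The formula `t ∈ P`. -/
def memP (t : lang.Term α) : lang.Formula α := Relations.formula₁ (L := lang) Rel.P t

/-- The formula `t ∈ Q`. -/
def memQ (t : lang.Term α) : lang.Formula α := Relations.formula₁ (L := lang) Rel.Q t

/-- The formula `s < t`. -/
def ltFormula (s t : lang.Term α) : lang.Formula α := Relations.formula₂ (L := lang) Rel.lt s t

variable {M : Type*} [lang.Structure M]

@[simp]
theorem realize_memP (t : lang.Term α) (v : α → M) : (memP t).Realize v ↔ InP (t.realize v) :=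
  Formula.realize_rel₁

@[simp]
theorem realize_memQ (t : lang.Term α) (v : α → M) : (memQ t).Realize v ↔ InQ (t.realize v) :=
  Formula.realize_rel₁

@[simp]
theorem realize_ltFormula (s t : lang.Term α) (v : α → M) :
    (ltFormula s t).Realize v ↔ Lt (s.realize v) (t.realize v) :=
  Formula.realize_rel₂

/-- The new variable. -/
abbrev newVar : lang.Term (α ⊕ Unit) := Term.var (Sum.inr ())

/-- An old variable. -/
abbrev oldVar (a : α) : lang.Term (α ⊕ Unit) := Term.var (Sum.inl a)

/-- `x` is different from all `y i`. -/
noncomputable def freshFormula {n : ℕ} (y : Fin n → α) : lang.Formula (α ⊕ Unit) :=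
  Formula.iInf fun i => (Term.equal newVar (oldVar (y i))).not

/-- `H(x) = m`, required only if `flag` holds. -/
noncomputable def colourFormula (flag : Prop) (m : α) : lang.Formula (α ⊕ Unit) :=
  open Classical in if flag then Term.equal (tH newVar) (oldVar m) else ⊤

/-- `x` is a fresh point outside `P` and `Q`. -/
noncomputable def otherFormula {n : ℕ} (y : Fin n → α) : lang.Formula (α ⊕ Unit) :=
  freshFormula y ⊓ ((memP newVar).not ⊓ (memQ newVar).not)

/-- `x` is a fresh point of `Q`. -/
noncomputable def freshQFormula {n : ℕ} (y : Fin n → α) : lang.Formula (α ⊕ Unit) :=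
  freshFormula y ⊓ memQ newVar

/-- `x` has colour `m` and lies below `c` and above all `e i`. -/
noncomputable def betweenFormula (flag : Prop) {n : ℕ} (m c : α) (e : Fin n → α) :
    lang.Formula (α ⊕ Unit) :=
  ltFormula newVar (oldVar c) ⊓
    (Formula.iInf (fun i => ltFormula (oldVar (e i)) newVar) ⊓ colourFormula flag m)

/-- `x` has colour `m` and lies above `d` in a cone containing no `y i`. -/
noncomputable def branchFormula (flag : Prop) {n : ℕ} (m d : α) (y : Fin n → α) :
    lang.Formula (α ⊕ Unit) :=
  ltFormula (oldVar d) newVar ⊓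
    (Formula.iInf (fun i => Term.equal (tMeet newVar (oldVar (y i))) (oldVar d)) ⊓
      colourFormula flag m)

theorem realize_freshFormula {n : ℕ} (y : Fin n → α) (v : α → M) (x : M) :
    (freshFormula y).Realize (Sum.elim v fun _ => x) ↔ ∀ i, x ≠ v (y i) := by
  simp [freshFormula]

theorem realize_colourFormula (flag : Prop) (m : α) (v : α → M) (x : M) :
    (colourFormula flag m).Realize (Sum.elim v fun _ => x) ↔ (flag → Hf x = v m) := by
  by_cases hf : flag
  · simp [colourFormula, hf]
  · simp [colourFormula, hf]

theorem realize_otherFormula {n : ℕ} (y : Fin n → α) (v : α → M) (x : M) :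
    (otherFormula y).Realize (Sum.elim v fun _ => x) ↔
      (∀ i, x ≠ v (y i)) ∧ ¬ InP x ∧ ¬ InQ x := by
  simp [otherFormula, realize_freshFormula]

theorem realize_freshQFormula {n : ℕ} (y : Fin n → α) (v : α → M) (x : M) :
    (freshQFormula y).Realize (Sum.elim v fun _ => x) ↔ (∀ i, x ≠ v (y i)) ∧ InQ x := by
  simp [freshQFormula, realize_freshFormula]

theorem realize_betweenFormula (flag : Prop) {n : ℕ} (m c : α) (e : Fin n → α) (v : α → M)
    (x : M) : (betweenFormula flag m c e).Realize (Sum.elim v fun _ => x) ↔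
      Lt x (v c) ∧ (∀ i, Lt (v (e i)) x) ∧ (flag → Hf x = v m) := by
  simp [betweenFormula, realize_colourFormula]

theorem realize_branchFormula (flag : Prop) {n : ℕ} (m d : α) (y : Fin n → α) (v : α → M)
    (x : M) : (branchFormula flag m d y).Realize (Sum.elim v fun _ => x) ↔
      Lt (v d) x ∧ (∀ i, meet x (v (y i)) = v d) ∧ (flag → Hf x = v m) := by
  simp [branchFormula, realize_colourFormula]

/-- The axioms of rich trees. -/
noncomputable def richTheory (flag : Prop) : lang.Theory :=
  (Set.range fun n : ℕ => forallExistsSentence (α := Fin n) ⊤ (otherFormula id)) ∪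
  (Set.range fun n : ℕ => forallExistsSentence (α := Fin n) ⊤ (freshQFormula id)) ∪
  {forallExistsSentence (α := Empty) ⊤ (memP newVar)} ∪
  (Set.range fun n : ℕ => forallExistsSentence (α := Fin 2 ⊕ Fin n)
    (memQ (Term.var (Sum.inl 0)) ⊓ (memP (Term.var (Sum.inl 1)) ⊓
      Formula.iInf fun i => ltFormula (Term.var (Sum.inr i)) (Term.var (Sum.inl 1))))
    (betweenFormula flag (Sum.inl 0) (Sum.inl 1) Sum.inr)) ∪
  (Set.range fun n : ℕ => forallExistsSentence (α := Fin 2 ⊕ Fin n)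
    (memQ (Term.var (Sum.inl 0)) ⊓ (memP (Term.var (Sum.inl 1)) ⊓
      Formula.iInf fun i => ltFormula (Term.var (Sum.inl 1)) (Term.var (Sum.inr i))))
    (branchFormula flag (Sum.inl 0) (Sum.inl 1) Sum.inr))

theorem exists_enum {X : Type*} (F : Finset X) : ∃ (n : ℕ) (y : Fin n → X), ∀ a, a ∈ F ↔ ∃ i, y i = a :=
  ⟨F.card, fun i => F.equivFin.symm i, fun a => ⟨fun ha => ⟨F.equivFin ⟨a, ha⟩, by simp⟩,
    by rintro ⟨i, rfl⟩; exact (F.equivFin.symm i).2⟩⟩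

theorem exists_finset_range {X : Type*} {n : ℕ} (y : Fin n → X) :
    ∃ F : Finset X, ∀ a, a ∈ F ↔ ∃ i, y i = a :=
  ⟨(Set.finite_range y).toFinset, fun a => by simp⟩

theorem model_richTheory_iff (flag : Prop) : M ⊨ richTheory flag ↔ IsRich M flag := by
  simp only [richTheory, Theory.model_iff, Set.mem_union, or_imp, forall_and, Set.forall_mem_range,
    Set.mem_singleton_iff, forall_eq, realize_forallExistsSentence, realize_otherFormula,
    realize_freshQFormula, realize_betweenFormula, realize_branchFormula, Formula.realize_inf,
    Formula.realize_iInf, realize_memP, realize_memQ, realize_ltFormula, Term.realize_var,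
    Formula.realize_top, forall_true_left, Sum.elim_inr, id_eq, and_imp]
  constructor
  · rintro ⟨⟨⟨⟨h1, h2⟩, h3⟩, h4⟩, h5⟩
    constructor
    · intro F
      obtain ⟨n, y, hy⟩ := exists_enum F
      obtain ⟨x, hx, h⟩ := h1 n y
      exact ⟨x, fun h' => by obtain ⟨i, hi⟩ := (hy x).1 h'; exact hx i hi.symm, h⟩
    · intro F
      obtain ⟨n, y, hy⟩ := exists_enum F
      obtain ⟨x, hx, h⟩ := h2 n y
      exact ⟨x, fun h' => by obtain ⟨i, hi⟩ := (hy x).1 h'; exact hx i hi.symm, h⟩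
    · exact h3 Empty.elim
    · intro m c hm hc E hE
      obtain ⟨n, y, hy⟩ := exists_enum E
      obtain ⟨x, hx, hx1, hx2⟩ := h4 n (Sum.elim ![m, c] y) hm hc fun i => hE _ ((hy _).2 ⟨i, rfl⟩)
      refine ⟨x, hx, fun e he => ?_, hx2⟩
      obtain ⟨i, rfl⟩ := (hy e).1 he
      exact hx1 i
    · intro m d hm hd F hF
      obtain ⟨n, y, hy⟩ := exists_enum F
      obtain ⟨x, hx, hx1, hx2⟩ := h5 n (Sum.elim ![m, d] y) hm hd fun i => hF _ ((hy _).2 ⟨i, rfl⟩)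
      refine ⟨x, hx, fun e he => ?_, hx2⟩
      obtain ⟨i, rfl⟩ := (hy e).1 he
      exact hx1 i
  · rintro ⟨h1, h2, h3, h4, h5⟩
    refine ⟨⟨⟨⟨fun n y => ?_, fun n y => ?_⟩, fun _ => h3⟩, fun n v hm hc hE => ?_⟩,
      fun n v hm hd hF => ?_⟩
    · obtain ⟨F, hF⟩ := exists_finset_range y
      obtain ⟨x, hx, h⟩ := h1 F
      exact ⟨x, fun i hi => hx ((hF x).2 ⟨i, hi.symm⟩), h⟩
    · obtain ⟨F, hF⟩ := exists_finset_range y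
      obtain ⟨x, hx, h⟩ := h2 F
      exact ⟨x, fun i hi => hx ((hF x).2 ⟨i, hi.symm⟩), h⟩
    · obtain ⟨E, hE'⟩ := exists_finset_range (v ∘ Sum.inr)
      obtain ⟨x, hx, hx1, hx2⟩ := h4 _ _ hm hc E fun e he => by
        obtain ⟨i, rfl⟩ := (hE' e).1 he; exact hE i
      exact ⟨x, hx, fun i => hx1 _ ((hE' _).2 ⟨i, rfl⟩), hx2⟩
    · obtain ⟨F, hF'⟩ := exists_finset_range (v ∘ Sum.inr)
      obtain ⟨x, hx, hx1, hx2⟩ := h5 _ _ hm hd F fun e he => by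
        obtain ⟨i, rfl⟩ := (hF' e).1 he; exact hF i
      exact ⟨x, hx, fun i => hx1 _ ((hF' _).2 ⟨i, rfl⟩), hx2⟩

/-- A tree that is elementary over `id` in an extension of a rich extension is rich. -/
theorem isRich_of_elementary {N M' : Type*} [lang.Structure N] [lang.Structure M'] {flag : Prop}
    (rN : IsRich N flag)
    (e : M ↪[lang] N) (e' : N ↪[lang] M')
    (h : ∀ φ : lang.Formula M, φ.Realize id ↔ φ.Realize (e' ∘ e)) : IsRich M flag := by
  classical
  constructor
  · intro F
    obtain ⟨n, y, hy⟩ := exists_enum F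
    obtain ⟨x, hx, hP, hQ⟩ := rN.exists_other (F.image e)
    obtain ⟨x, hx⟩ := exists_of_elementary h (ψ := otherFormula y) (x := e' x) (by
      rw [realize_otherFormula]
      refine ⟨fun i hi => hx ?_, by simpa using hP, by simpa using hQ⟩
      rw [e'.injective hi]
      exact Finset.mem_image_of_mem _ ((hy _).2 ⟨i, rfl⟩))
    rw [realize_otherFormula] at hx
    refine ⟨x, fun h' => ?_, hx.2⟩
    obtain ⟨i, rfl⟩ := (hy x).1 h'
    exact hx.1 i rfl
  · intro F
    obtain ⟨n, y, hy⟩ := exists_enum F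
    obtain ⟨x, hx, hQ⟩ := rN.exists_Q (F.image e)
    obtain ⟨x, hx⟩ := exists_of_elementary h (ψ := freshQFormula y) (x := e' x) (by
      rw [realize_freshQFormula]
      refine ⟨fun i hi => hx ?_, by simpa using hQ⟩
      rw [e'.injective hi]
      exact Finset.mem_image_of_mem _ ((hy _).2 ⟨i, rfl⟩))
    rw [realize_freshQFormula] at hx
    refine ⟨x, fun h' => ?_, hx.2⟩
    obtain ⟨i, rfl⟩ := (hy x).1 h'
    exact hx.1 i rfl
  · obtain ⟨x, hx⟩ := rN.exists_P
    obtain ⟨x, hx⟩ := exists_of_elementary h (ψ := memP newVar) (x := e' x) (by simpa using hx)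
    exact ⟨x, by simpa using hx⟩
  · intro m c hm hc E hE
    obtain ⟨n, y, hy⟩ := exists_enum E
    obtain ⟨x, hx, hx1, hx2⟩ := rN.exists_between (e m) (e c) (by simpa using hm)
      (by simpa using hc) (E.image e) (by simpa using hE)
    obtain ⟨x, hx⟩ := exists_of_elementary h (ψ := betweenFormula flag m c y) (x := e' x) (by
      rw [realize_betweenFormula]
      refine ⟨by simpa using hx, fun i => ?_, fun hf => ?_⟩
      · simpa using hx1 _ (Finset.mem_image_of_mem _ ((hy _).2 ⟨i, rfl⟩))
      · rw [← embedding_Hf, hx2 hf]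
        rfl)
    rw [realize_betweenFormula] at hx
    refine ⟨x, hx.1, fun a ha => ?_, hx.2.2⟩
    obtain ⟨i, rfl⟩ := (hy a).1 ha
    exact hx.2.1 i
  · intro m d hm hd F hF
    obtain ⟨n, y, hy⟩ := exists_enum F
    obtain ⟨x, hx, hx1, hx2⟩ := rN.exists_branch (e m) (e d) (by simpa using hm)
      (by simpa using hd) (F.image e) (by simpa using hF)
    obtain ⟨x, hx⟩ := exists_of_elementary h (ψ := branchFormula flag m d y) (x := e' x) (by
      rw [realize_branchFormula]
      refine ⟨by simpa using hx, fun i => ?_, fun hf => ?_⟩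
      · have := hx1 _ (Finset.mem_image_of_mem _ ((hy _).2 ⟨i, rfl⟩))
        rw [Function.comp_apply, Function.comp_apply, ← embedding_meet, this]
      · rw [← embedding_Hf, hx2 hf]
        rfl)
    rw [realize_branchFormula] at hx
    refine ⟨x, hx.1, fun a ha => ?_, hx.2.2⟩
    obtain ⟨i, rfl⟩ := (hy a).1 ha
    exact hx.2.1 i

end RichTheory

/-! ### Existence of the model completion and richness of its models. -/

section ModelCompletion

/-- Only the forth step is iterated, and it needs richness of the target alone; `A` may be any
coloured tree. -/
theorem exists_pIso_genericTree {A : Type*} [lang.Structure A] (hA : IsTree A True)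
    (F : Finset A) : ∃ s : Set (A × GenericTree), PIso s ∧ s.Finite ∧
      ∀ a ∈ F, ∃ b, (a, b) ∈ s := by
  classical
  induction F using Finset.induction_on with
  | empty => exact ⟨∅, PIso.empty, Set.finite_empty, by simp⟩
  | insert a F _ ih =>
    obtain ⟨s, hs, hfin, h⟩ := ih
    obtain ⟨s', hss, hfin', hs', b, hb⟩ :=
      hs.exists_extend hA GenericTree.isTree GenericTree.isRich hfin a
    refine ⟨s', hs', hfin', fun x hx => ?_⟩
    rcases Finset.mem_insert.1 hx with rfl | hx
    · exact ⟨b, hb⟩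
    · obtain ⟨b, hb⟩ := h x hx
      exact ⟨b, hss hb⟩

instance : Nonempty GenericTree := ⟨GenericTree.other 0⟩

/-- Every tree embeds into an ultrapower of the generic tree. -/
theorem exists_embedding_ultraproduct (A : Type u) [lang.Structure A] (hA : IsTree A True) :
    ∃ U : Ultrafilter (Finset A),
      Nonempty (A ↪[lang] (U : Filter (Finset A)).Product fun _ => GenericTree) := by
  classical
  choose s hs _ hdom using exists_pIso_genericTree hA
  -- Every element of `A` belongs to almost every finite set, so the partial maps on finite sets
  -- assemble to a map defined on all of `A`. The default value used when `a ∉ F` is irrelevant in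
  -- the limit.
  let U : Ultrafilter (Finset A) := Ultrafilter.of Filter.atTop
  have hU : ∀ a : A, ∀ᶠ F in (U : Filter (Finset A)), a ∈ F := fun a =>
    Ultrafilter.of_le _ ((Filter.eventually_ge_atTop {a}).mono fun F hF => hF (by simp))
  let e : A → Finset A → GenericTree := fun a F =>
    if h : a ∈ F then (hdom F a h).choose else GenericTree.other 0
  have he : ∀ a, ∀ F, a ∈ F → (a, e a F) ∈ s F := fun a F h => by
    simp only [e, dif_pos h]
    exact (hdom F a h).choose_spec
  let g : A → (U : Filter (Finset A)).Product fun _ => GenericTree := fun a =>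
    (Quotient.mk _ (e a) : Quotient ((U : Filter (Finset A)).productSetoid fun _ => GenericTree))
  have hg : ∀ a (y : Finset A → GenericTree), (∀ᶠ F in (U : Filter (Finset A)), e a F = y F) →
      g a = (Quotient.mk _ y :
        Quotient ((U : Filter (Finset A)).productSetoid fun _ => GenericTree)) :=
    fun a y h => Quotient.sound h
  refine ⟨U, ⟨⟨⟨g, fun a b hab => ?_⟩, fun {n} f x => ?_, fun {n} R x => ?_⟩⟩⟩
  · have h : ∀ᶠ F in (U : Filter (Finset A)), e a F = e b F := Quotient.exact hab
    obtain ⟨F, hF, ha, hb⟩ := (h.and ((hU a).and (hU b))).exists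
    exact ((hs F).eq_iff _ (he a F ha) _ (he b F hb)).2 hF
  · refine (hg _ _ ?_).trans (Ultraproduct.funMap_cast f fun i => e (x i)).symm
    -- Requiring `F` to contain the value as well as the arguments makes the chosen image of the
    -- value agree with the value at the chosen images.
    filter_upwards [hU (Structure.funMap f x), Filter.eventually_all.2 fun i => hU (x i)]
      with F h1 h2
    exact ((hs F).eq_iff _ (he _ F h1) _ ((hs F).funMap_mem f fun i => he _ F (h2 i))).1 rfl
  · refine Iff.trans (b := ∀ᶠ F in (U : Filter (Finset A)),
      Structure.RelMap R fun i => e (x i) F) ?_ ?_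
    · exact relMap_quotient_mk' (L := lang)
        (s := (U : Filter (Finset A)).productSetoid fun _ => GenericTree) R fun i => e (x i)
    · rw [← Filter.eventually_const (f := (U : Filter (Finset A))) (p := Structure.RelMap R x)]
      refine Filter.eventually_congr ?_
      filter_upwards [Filter.eventually_all.2 fun i => hU (x i)] with F h2
      exact ((hs F).relMap_iff hA GenericTree.isTree R fun i => he _ F (h2 i)).symm

/-- The theory of rich trees is the model completion of the theory of trees. -/
theorem isModelCompletion_richTheory :
    IsModelCompletion.{u} (univTheory ∪ richTheory True) univTheory where
  model_of_model M _ _ h := h.mono Set.subset_union_left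
  exists_embedding A _ _ h := by
    obtain ⟨U, ⟨f⟩⟩ := exists_embedding_ultraproduct A isTree_of_model
    refine ⟨_, inferInstance, ?_, ⟨f⟩⟩
    have hG : GenericTree ⊨ univTheory ∪ richTheory True :=
      (GenericTree.isTree.model_univTheory).union ((model_richTheory_iff _).2 GenericTree.isRich)
    rw [Theory.model_iff] at hG ⊢
    intro φ hφ
    rw [Ultraproduct.sentence_realize]
    exact Filter.Eventually.of_forall fun _ => hG φ hφ
  equivalent_over A M N _ _ _ _ _ hM hN f g φ := by
    have hM1 : M ⊨ univTheory := hM.mono Set.subset_union_left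
    have hN1 : N ⊨ univTheory := hN.mono Set.subset_union_left
    exact (atomEq_of_embedding f g id).realize_iff isTree_of_model isTree_of_model
      ((model_richTheory_iff _).1 (hM.mono Set.subset_union_right))
      ((model_richTheory_iff _).1 (hN.mono Set.subset_union_right)) φ

variable {T : lang.Theory}

theorem IsModelCompletion.isTree (hT : IsModelCompletion.{u} T univTheory) (M : Type u)
    [lang.Structure M] [Nonempty M] [hM : M ⊨ T] : IsTree M True :=
  have := hT.model_of_model M hM
  isTree_of_model

/-- The models of any model completion are rich. -/
theorem IsModelCompletion.isRich (hT : IsModelCompletion.{u} T univTheory) (M : Type u)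
    [lang.Structure M] [Nonempty M] [hM : M ⊨ T] : IsRich M True := by
  have hM' := hT.model_of_model M hM
  -- The chain is `M → N → M'` with `N` rich and `M'` a model of `T`. Witnesses found in `N` survive
  -- in `M'`, since the formulas involved are quantifier free, and come down to `M` because `M'` is
  -- elementary over `M`.
  obtain ⟨N, _, hN, ⟨e⟩⟩ := isModelCompletion_richTheory.exists_embedding M hM'
  have : Nonempty N := ‹Nonempty M›.map e
  obtain ⟨M', _, hM'', ⟨e'⟩⟩ :=
    hT.exists_embedding N (isModelCompletion_richTheory.model_of_model N hN)
  exact isRich_of_elementary ((model_richTheory_iff _).1 (hN.mono Set.subset_union_right)) e e'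
    fun φ => hT.equivalent_over M M M' hM' hM hM'' (Embedding.refl lang M) (e'.comp e) φ

end ModelCompletion

/-! ### One point finitely satisfiable in the small model. -/

section CoheirPoints

variable {M C D : Type u} [lang.Structure M] [lang.Structure C] [lang.Structure D] {flag : Prop}

/-- `w` realizes a type over `C` that is finitely satisfiable in `M`. -/
def IsCoheirPoint (f : M ↪[lang] C) (j : C ↪[lang] D) (w : D) : Prop :=
  ∀ φ : lang.Formula (C ⊕ Unit), φ.Realize (Sum.elim j fun _ => w) →
    ∃ m : M, φ.Realize (Sum.elim id fun _ => f m)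

/-- The formula `s ≤ t`. -/
def leFormula {α : Type u} (s t : lang.Term α) : lang.Formula α :=
  memP s ⊓ (memP t ⊓ Term.equal (tMeet s t) s)

@[simp]
theorem realize_leFormula {α : Type u} (s t : lang.Term α) (v : α → M) :
    (leFormula s t).Realize v ↔ Le (s.realize v) (t.realize v) := by
  simp [leFormula, Le]

/-- The meet of `w` and `c` belongs to `C`. -/
def IsInternal (j : C ↪[lang] D) (w : D) (c : C) : Prop := ∃ γ, meet w (j c) = j γ

/-- Some element of `C` below `w` is above all elements of `M` below `w`. -/
def HasSide (f : M ↪[lang] C) (j : C ↪[lang] D) (w : D) : Prop :=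
  ∃ γ, Le (j γ) w ∧ ∀ b, Le (j (f b)) w → Lt (f b) γ

/-- The meet of `w` and `m` is above all elements of `M` below `w`. -/
def MeetsHigh (f : M ↪[lang] C) (j : C ↪[lang] D) (w : D) (m : M) : Prop :=
  InP m ∧ ∀ b, Le (j (f b)) w → Lt (j (f b)) (meet w (j (f m)))

/-- Both meets lie below `w`, hence are comparable. If they differed, the smaller one would be `c ∧
c'` and so belong to `C`. -/
theorem IsInternal.meet_eq_of_not (hD : IsTree D flag) {j : C ↪[lang] D} {w : D} (hw : InP w)
    {c c' : C} (hc : InP c) (hc' : InP c') (h : ¬ IsInternal j w c) (h' : ¬ IsInternal j w c') :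
    meet w (j c) = meet w (j c') := by
  have key : ∀ {c c' : C}, InP c → InP c' → ¬ IsInternal j w c →
      Le (meet w (j c)) (meet w (j c')) → meet w (j c) = meet w (j c') := by
    intro c c' hc hc' h hle
    have hjc : InP (j c) := by simpa using hc
    have hjc' : InP (j c') := by simpa using hc'
    have h1 : Le (meet w (j c)) (meet (j c) (j c')) :=
      hD.le_meet (hD.meet_le_right hw hjc) (hD.le_trans hle (hD.meet_le_right hw hjc'))
    by_cases h2 : Le (meet (j c) (j c')) (meet w (j c'))
    · refine (h ⟨meet c c', ?_⟩).elim
      rw [embedding_meet]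
      refine hD.le_antisymm h1 (hD.le_meet (hD.le_trans h2 (hD.meet_le_left hw hjc'))
        (hD.meet_le_left hjc hjc'))
    · have h3 := hD.lt_of_not_le (hD.meet_le_right hjc hjc') (hD.meet_le_right hw hjc') h2
      exact hD.le_antisymm hle (hD.le_meet (hD.meet_le_left hw hjc')
        (hD.le_trans (hD.le_of_lt h3) (hD.meet_le_left hjc hjc')))
  rcases hD.le_total _ _ _ (hD.meet_le_left hw (y := j c) (by simpa using hc))
    (hD.meet_le_left hw (y := j c') (by simpa using hc')) with hle | hle
  · exact key hc hc' h hle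
  · exact (key hc' hc h' hle).symm

variable {f : M ↪[lang] C} {j : C ↪[lang] D} {w : D}

/-- Here and in the lemmas that follow, a condition on `w` over `C` is reflected to a point of `M`.
In particular an element of `C` pinned down by `w` and parameters from `M` comes from `M`. -/
theorem IsCoheirPoint.exists_of_eq (h : IsCoheirPoint f j w) {γ : C} (hγ : w = j γ) :
    ∃ a, f a = γ := by
  obtain ⟨a, ha⟩ := h (Term.equal newVar (oldVar γ)) (by simpa using hγ)
  exact ⟨a, by simpa using ha⟩

theorem IsCoheirPoint.exists_of_meet_eq (h : IsCoheirPoint f j w) {m : M} {γ : C}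
    (hγ : meet w (j (f m)) = j γ) : ∃ a, f (meet a m) = γ := by
  obtain ⟨a, ha⟩ := h (Term.equal (tMeet newVar (oldVar (f m))) (oldVar γ)) (by simpa using hγ)
  exact ⟨a, by simpa [embedding_meet] using ha⟩

theorem IsCoheirPoint.exists_ge (h : IsCoheirPoint f j w) {γ : C} (hγ : Le (j γ) w) :
    ∃ a, Le γ (f a) := by
  obtain ⟨a, ha⟩ := h (leFormula (oldVar γ) newVar) (by simpa using hγ)
  exact ⟨a, by simpa using ha⟩

theorem IsCoheirPoint.exists_between (h : IsCoheirPoint f j w) {m : M} {γ γ' : C}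
    (hγ : Le (j γ) (meet w (j (f m)))) (hγ' : Lt (meet w (j (f m))) (j γ')) :
    ∃ a, Le γ (f (meet a m)) ∧ Lt (f (meet a m)) γ' := by
  obtain ⟨a, ha⟩ := h (leFormula (oldVar γ) (tMeet newVar (oldVar (f m))) ⊓
    ltFormula (tMeet newVar (oldVar (f m))) (oldVar γ')) (by simpa using ⟨hγ, hγ'⟩)
  exact ⟨a, by simpa [embedding_meet] using ha⟩

theorem IsCoheirPoint.exists_meet_gt (h : IsCoheirPoint f j w) {b c : C}
    (hb : Lt (j b) (meet w (j c))) : ∃ a, Lt b (meet (f a) c) := by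
  obtain ⟨a, ha⟩ := h (ltFormula (oldVar b) (tMeet newVar (oldVar c))) (by simpa using hb)
  exact ⟨a, by simpa using ha⟩

theorem IsCoheirPoint.exists_of_Hf_eq (h : IsCoheirPoint f j w) {γ : C} (hγ : Hf w = j γ) :
    ∃ a, f a = γ := by
  obtain ⟨a, ha⟩ := h (Term.equal (tH newVar) (oldVar γ)) (by simpa using hγ)
  exact ⟨Hf a, by simpa [embedding_Hf] using ha⟩

theorem IsCoheirPoint.exists_of_Hf_meet_eq (h : IsCoheirPoint f j w) {c γ : C}
    (hγ : Hf (meet w (j c)) = j γ) : ∃ a : M, Hf (meet (f a) c) = γ := by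
  obtain ⟨a, ha⟩ := h (Term.equal (tH (tMeet newVar (oldVar c))) (oldVar γ)) (by simpa using hγ)
  exact ⟨a, by simpa using ha⟩

/-- If `w ∧ m` is above all elements of `M` below `w`, it does not belong to `C`. -/
theorem MeetsHigh.not_isInternal (hD : IsTree D flag) (h : IsCoheirPoint f j w) (hw : InP w)
    {m : M} (hm : MeetsHigh f j w m) : ¬ IsInternal j w (f m) := by
  rintro ⟨γ, hγ⟩
  obtain ⟨a, rfl⟩ := h.exists_of_meet_eq hγ
  have h1 : Le (j (f (meet a m))) w := by
    rw [← hγ]; exact hD.meet_le_left hw (by simpa using hm.1)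
  have := hm.2 _ h1
  rw [hγ] at this
  exact hD.ne_of_lt this rfl

/-- Otherwise `w ∧ m` would equal `γ ∧ m`, an element of `C`. -/
theorem MeetsHigh.le_of_le (hD : IsTree D flag) (h : IsCoheirPoint f j w) (hw : InP w)
    {m : M} (hm : MeetsHigh f j w m) {γ : C} (hγ : Le (j γ) w) : Le γ (f m) := by
  by_contra hle
  refine hm.not_isInternal hD h hw ⟨meet γ (f m), ?_⟩
  rw [embedding_meet]
  exact hD.meet_eq_of_not_le hγ (by simpa using hm.1) (by simpa using hle)

theorem le_or_forall_lt (hC : IsTree C flag) (hD : IsTree D flag) {γ : C} (hγ : Le (j γ) w) :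
    (∃ b, Le (j (f b)) w ∧ Le γ (f b)) ∨ ∀ b, Le (j (f b)) w → Lt (f b) γ := by
  by_cases h : ∃ b, Le (j (f b)) w ∧ Le γ (f b)
  · exact Or.inl h
  · refine Or.inr fun b hb => ?_
    refine hC.lt_of_le_of_not ?_ fun h' => h ⟨b, hb, h'⟩
    have := (hD.le_total _ _ _ hγ hb).resolve_left fun h' => h ⟨b, hb, by simpa using h'⟩
    simpa using this

/-- The elements of `C` below `w`, if `w` is not approached from above. -/
theorem le_iff_of_not_hasSide (hC : IsTree C flag) (hD : IsTree D flag)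
    (hs : ¬ HasSide f j w) (γ : C) : Le (j γ) w ↔ ∃ b, Le (j (f b)) w ∧ Le γ (f b) := by
  refine ⟨fun hγ => (le_or_forall_lt hC hD hγ).resolve_right fun h' => hs ⟨γ, hγ, h'⟩, ?_⟩
  rintro ⟨b, hb, hγ⟩
  exact hD.le_trans (by simpa using hγ) hb

/-- By finite satisfiability the witness `γ` below `w` lies below some `m` in `M`. Then `γ ≤ w ∧ m`,
and `γ` already exceeds all of `M` below `w`. -/
theorem HasSide.exists_meetsHigh (hD : IsTree D flag) (h : IsCoheirPoint f j w)
    (hs : HasSide f j w) : ∃ m, MeetsHigh f j w m := by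
  obtain ⟨γ, hγ, hb⟩ := hs
  obtain ⟨m, hm⟩ := h.exists_ge hγ
  refine ⟨m, by simpa using hm.2.1, fun b hbw => ?_⟩
  refine hD.lt_of_lt_of_le ((embedding_Lt j _ _).2 (hb b hbw)) (hD.le_meet hγ ?_)
  simpa using hm

/-- The elements of `C` below `w`, if `w` is approached from above. -/
theorem le_iff_of_hasSide (hC : IsTree C flag) (hD : IsTree D flag) (h : IsCoheirPoint f j w)
    (hw : InP w) (hs : HasSide f j w) {m : M} (hm : MeetsHigh f j w m) (γ : C) :
    Le (j γ) w ↔ (∃ b, Le (j (f b)) w ∧ Le γ (f b)) ∨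
      (∀ b, Le (j (f b)) w → Lt (f b) γ) ∧ Le γ (f m) ∧
        ∀ a : M, Le (f a) (f m) → (∀ b, Le (j (f b)) w → Lt (f b) (f a)) → Lt γ (f a) := by
  have hmP : InP (j (f m)) := by simpa using hm.1
  constructor
  · intro hγ
    refine (le_or_forall_lt hC hD hγ).imp_right fun h' => ⟨h', hm.le_of_le hD h hw hγ, ?_⟩
    intro a ham hab
    refine hC.lt_of_not_le ham (hm.le_of_le hD h hw hγ) fun hle => ?_
    have haw : Le (j (f a)) w := hD.le_trans (by simpa using hle) hγ
    exact hC.ne_of_lt (hab a haw) rfl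
  · rintro (⟨b, hb, hγ⟩ | ⟨h1, h2, h3⟩)
    · exact hD.le_trans (by simpa using hγ) hb
    · obtain ⟨γ₀, hγ₀, hbγ₀⟩ := hs
      by_contra hγ
      -- If `γ` were not below `w`, then `γ₀ ≤ w ∧ m < γ`. Reflecting this to `M` yields `a ∧ m` in
      -- `M` with `γ₀ ≤ a ∧ m < γ`, contrary to `γ` being below all such points of `M`.
      have h4 : Lt (meet w (j (f m))) (j γ) := by
        refine hD.lt_of_not_le (z := j (f m)) (by simpa using h2) (hD.meet_le_right hw hmP) ?_
        exact fun h' => hγ (hD.le_trans h' (hD.meet_le_left hw hmP))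
      have h5 : Le (j γ₀) (meet w (j (f m))) :=
        hD.le_meet hγ₀ (by simpa using hm.le_of_le hD h hw hγ₀)
      obtain ⟨a, ha1, ha2⟩ := h.exists_between h5 h4
      have h6 := h3 (meet a m) (hC.le_trans (hC.le_of_lt ha2) h2) fun b hb =>
        hC.lt_of_lt_of_le (hbγ₀ b hb) ha1
      exact hC.not_le_of_lt h6 (hC.le_of_lt ha2)

/-- The meet `w ∧ c` is above all elements of `M` below `w`. -/
def IsHigh (f : M ↪[lang] C) (j : C ↪[lang] D) (w : D) (c : C) : Prop :=
  ∀ b, Le (j (f b)) w → Lt (j (f b)) (meet w (j c))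

/-- If `w ∧ c` is not above some `b ≤ w` from `M`, it is at most `b`, and therefore equals `b ∧ c`.
-/
theorem isInternal_of_not_isHigh (hD : IsTree D flag) (hw : InP w) {c : C} (hc : InP c)
    (h : ¬ IsHigh f j w c) : IsInternal j w c := by
  have hjc : InP (j c) := by simpa using hc
  simp only [IsHigh, not_forall] at h
  obtain ⟨b, hb, hlt⟩ := h
  have h1 : Le (meet w (j c)) (j (f b)) := by
    by_contra h'
    exact hlt (hD.lt_of_not_le (hD.meet_le_left hw hjc) hb h')
  refine ⟨meet (f b) c, ?_⟩
  rw [embedding_meet]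
  exact hD.le_antisymm (hD.le_meet h1 (hD.meet_le_right hw hjc))
    (hD.le_meet (hD.le_trans (hD.meet_le_left hb.1 hjc) hb) (hD.meet_le_right hb.1 hjc))

/-- A meet that is high and lies in `C` would itself be a witness for `HasSide`. -/
theorem isInternal_iff_of_not_hasSide (hD : IsTree D flag) (hw : InP w)
    (hs : ¬ HasSide f j w) {c : C} (hc : InP c) : IsInternal j w c ↔ ¬ IsHigh f j w c := by
  refine ⟨?_, isInternal_of_not_isHigh hD hw hc⟩
  rintro ⟨γ, hγ⟩ hh
  refine hs ⟨γ, ?_, fun b hb => ?_⟩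
  · rw [← hγ]; exact hD.meet_le_left hw (by simpa using hc)
  · have := hh b hb
    rw [hγ] at this
    simpa using this

/-- The meet `w ∧ m` is outside `C`. Among `w ∧ c`, `w ∧ m` and `c ∧ m` the two smallest coincide,
so `w ∧ c` is in `C` exactly when it equals `c ∧ m`, that is, when `c ∧ m` lies below `w`. -/
theorem isInternal_iff_of_meetsHigh (hD : IsTree D flag) (h : IsCoheirPoint f j w) (hw : InP w)
    {m : M} (hm : MeetsHigh f j w m) {c : C} (hc : InP c) :
    IsInternal j w c ↔ Le (j (meet c (f m))) w := by
  have hjc : InP (j c) := by simpa using hc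
  have hjm : InP (j (f m)) := by simpa using hm.1
  rw [embedding_meet]
  constructor
  · rintro ⟨γ, hγ⟩
    have hγw : Le (j γ) w := by rw [← hγ]; exact hD.meet_le_left hw hjc
    have hγm : Le (j γ) (j (f m)) := by simpa using hm.le_of_le hD h hw hγw
    by_contra hnot
    have h1 : Lt (meet w (j (f m))) (meet (j c) (j (f m))) :=
      hD.lt_of_not_le (hD.meet_le_right hjc hjm) (hD.meet_le_right hw hjm)
        fun h' => hnot (hD.le_trans h' (hD.meet_le_left hw hjm))
    refine hm.not_isInternal hD h hw ⟨γ, hD.le_antisymm ?_ (hD.le_meet hγw hγm)⟩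
    rw [← hγ]
    exact hD.le_meet (hD.meet_le_left hw hjm)
      (hD.le_trans (hD.le_of_lt h1) (hD.meet_le_left hjc hjm))
  · intro hle
    refine ⟨meet c (f m), ?_⟩
    rw [embedding_meet]
    refine hD.le_antisymm (hD.le_meet (hD.meet_le_right hw hjc) ?_)
      (hD.le_meet hle (hD.meet_le_left hjc hjm))
    rcases hD.le_total _ _ _ (hD.meet_le_left hw hjc) (hD.meet_le_left hw hjm) with h' | h'
    · exact hD.le_trans h' (hD.meet_le_right hw hjm)
    · refine (hm.not_isInternal hD h hw ⟨meet c (f m), ?_⟩).elim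
      rw [embedding_meet]
      exact hD.le_antisymm (hD.le_meet (hD.le_trans h' (hD.meet_le_right hw hjc))
        (hD.meet_le_right hw hjm)) (hD.le_meet hle (hD.meet_le_right hjc hjm))

/-- Of three pairwise meets, the two smallest coincide. -/
theorem IsTree.lt_meet_of_lt (hD : IsTree D flag) {b x y z : D} (hx : InP x) (hy : InP y)
    (hz : InP z) (h1 : Lt b (meet x y)) (h2 : Lt b (meet x z)) : Lt b (meet y z) := by
  rcases hD.le_total _ _ _ (hD.meet_le_left hx hy) (hD.meet_le_left hx hz) with h | h
  · exact hD.lt_of_lt_of_le h1 (hD.le_meet (hD.meet_le_right hx hy)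
      (hD.le_trans h (hD.meet_le_right hx hz)))
  · exact hD.lt_of_lt_of_le h2 (hD.le_meet (hD.le_trans h (hD.meet_le_right hx hy))
      (hD.meet_le_right hx hz))

theorem isHigh_iff_of_meetsHigh (hD : IsTree D flag) (hw : InP w) {m : M}
    (hm : MeetsHigh f j w m) {c : C} (hc : InP c) :
    IsHigh f j w c ↔ ∀ b, Le (j (f b)) w → Lt (f b) (meet c (f m)) := by
  have hjc : InP (j c) := by simpa using hc
  have hjm : InP (j (f m)) := by simpa using hm.1
  refine forall_congr' fun b => forall_congr' fun hb => ?_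
  rw [← embedding_Lt j, embedding_meet]
  refine ⟨fun h => hD.lt_meet_of_lt hw hjc hjm h (hm.2 b hb), fun h => ?_⟩
  have h1 := hm.2 b hb
  rw [hD.meet_comm _ _ hw hjm] at h1
  rw [hD.meet_comm _ _ hjc hjm] at h
  exact hD.lt_meet_of_lt hjm hw hjc h1 h

/-- If `M` had a greatest element `b₀` below `w`, reflecting `b₀ < w ∧ c` would give `a` in `M` with
`b₀ < a ∧ c`, and this `a` would meet `w` high. So there is no greatest one, and being high reduces
to `c` bounding all elements of `M` below `w`. -/
theorem isHigh_iff_of_not_meetsHigh (hC : IsTree C flag) (hD : IsTree D flag)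
    (h : IsCoheirPoint f j w) (hw : InP w)
    (hm : ∀ m, ¬ MeetsHigh f j w m) {c : C} (hc : InP c) :
    IsHigh f j w c ↔ (∀ b₀, Le (j (f b₀)) w → ∃ b, Le (j (f b)) w ∧ ¬ Le (f b) (f b₀)) ∧
      ∀ b, Le (j (f b)) w → Le (f b) c := by
  have hjc : InP (j c) := by simpa using hc
  constructor
  · intro hh
    refine ⟨fun b₀ hb₀ => ?_, fun b hb => ?_⟩
    · by_contra hmax
      push Not at hmax
      have h0 := hh b₀ hb₀
      obtain ⟨a, ha⟩ := h.exists_meet_gt h0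
      have haP : InP a := by
        by_contra hn
        have hn' : ¬ InP (f a) := by simpa using hn
        rw [hC.meet_of_not _ _ fun h' => hn' h'.1] at ha
        exact hn' (hC.le_of_lt ha).2.1
      have hja : InP (j (f a)) := by simpa using haP
      refine hm a ⟨haP, fun b hb => ?_⟩
      have h1 : Lt (j (f b₀)) (meet (j c) (j (f a))) := by
        rw [← embedding_meet, embedding_Lt, hC.meet_comm _ _ hc (by simpa using haP)]
        exact ha
      rw [hD.meet_comm _ _ hw hjc] at h0
      exact hD.lt_of_le_of_lt ((embedding_Le j _ _).2 (hmax b hb)) (hD.lt_meet_of_lt hjc hw hja h0 h1)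
    · have := hD.le_trans (hD.le_of_lt (hh b hb)) (hD.meet_le_right hw hjc)
      simpa using this
  · rintro ⟨hmax, hle⟩ b hb
    obtain ⟨b', hb', hbb'⟩ := hmax b hb
    have h1 : Lt (j (f b)) (j (f b')) := hD.lt_of_not_le hb' hb (by simpa using hbb')
    exact hD.lt_of_lt_of_le h1 (hD.le_meet hb' (by simpa using hle b' hb'))

/-- If some `m` in `M` meets `w` high, `w ∧ c` may be replaced by `w ∧ m`, and reflection gives a
colour of a point of `M`. Otherwise reflect with parameter `c` to get `a` in `M`. For `a` in `P`,
some `b` in `M` below `w` and `c` is not below `a`, so `a ∧ c = b ∧ a` is in `M`. -/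
theorem IsCoheirPoint.exists_of_Hf_meet_eq_of_not_isInternal (hC : IsTree C flag)
    (hD : IsTree D flag) (h : IsCoheirPoint f j w) (hw : InP w) {c γ : C} (hc : InP c)
    (hint : ¬ IsInternal j w c) (hγ : Hf (meet w (j c)) = j γ) : ∃ a, f a = γ := by
  by_cases hm : ∃ m, MeetsHigh f j w m
  · obtain ⟨m, hm⟩ := hm
    have hmP : InP (f m) := by simpa using hm.1
    rw [IsInternal.meet_eq_of_not hD hw hc hmP hint (hm.not_isInternal hD h hw)] at hγ
    obtain ⟨a, ha⟩ := h.exists_of_Hf_meet_eq hγ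
    exact ⟨Hf (meet a m), by rw [embedding_Hf, embedding_meet, ha]⟩
  · push Not at hm
    have hh : IsHigh f j w c := by
      by_contra hh
      exact hint (isInternal_of_not_isHigh hD hw hc hh)
    obtain ⟨hmax, hle⟩ := (isHigh_iff_of_not_meetsHigh hC hD h hw hm hc).1 hh
    obtain ⟨a, ha⟩ := h.exists_of_Hf_meet_eq hγ
    by_cases haP : InP a
    · have hja : InP (j (f a)) := by simpa using haP
      have hjaC : InP (f a) := by simpa using haP
      have : ∃ b, Le (j (f b)) w ∧ ¬ Le (f b) (f a) := by
        by_contra hall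
        push Not at hall
        refine hm a ⟨haP, fun b hb => ?_⟩
        obtain ⟨b', hb', hbb'⟩ := hmax b hb
        have h1 : Lt (j (f b)) (j (f b')) := hD.lt_of_not_le hb' hb (by simpa using hbb')
        exact hD.lt_of_lt_of_le h1 (hD.le_meet hb' (by simpa using hall b' hb'))
      obtain ⟨b, hb, hba⟩ := this
      refine ⟨Hf (meet b a), ?_⟩
      rw [← ha, embedding_Hf, embedding_meet, hC.meet_comm _ _ hjaC hc,
        hC.meet_eq_of_not_le (hle b hb) hjaC hba]
    · refine ⟨Hf a, ?_⟩
      rw [← ha, hC.meet_of_not _ _ fun h' => haP (by simpa using h'.1), embedding_Hf]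

/-- The formula `w ∧ c ≤ γ` in terms of the elements of `C` below `w` and of internal meets. -/
theorem meet_le_iff_of_not_isInternal (hD : IsTree D flag) (hw : InP w) {c γ : C} (hc : InP c)
    (hγ : InP γ) (hint : ¬ IsInternal j w c) :
    Le (meet w (j c)) (j γ) ↔ ¬ IsInternal j w γ := by
  have hjc : InP (j c) := by simpa using hc
  have hjγ : InP (j γ) := by simpa using hγ
  constructor
  · rintro hle ⟨δ, hδ⟩
    have hδw : Le (j δ) w := by rw [← hδ]; exact hD.meet_le_left hw hjγ
    refine hint ⟨meet δ c, ?_⟩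
    rw [embedding_meet]
    refine hD.le_antisymm (hD.le_meet ?_ (hD.meet_le_right hw hjc))
      (hD.le_meet (hD.le_trans (hD.meet_le_left hδw.1 hjc) hδw) (hD.meet_le_right hδw.1 hjc))
    rw [← hδ]
    exact hD.le_meet (hD.meet_le_left hw hjc) hle
  · intro hint'
    rw [IsInternal.meet_eq_of_not hD hw hc hγ hint hint']
    exact hD.meet_le_right hw hjγ

/-- The formula `w ≤ γ`. -/
theorem le_iff_of_forall_ne (hD : IsTree D flag) (hw : InP w) {γ : C} (hne : ∀ δ, w ≠ j δ)
    (hγ : InP γ) : Le w (j γ) ↔ ¬ IsInternal j w γ ∧ ∃ c, Le w (j c) := by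
  constructor
  · intro hle
    refine ⟨fun ⟨δ, hδ⟩ => hne δ ?_, γ, hle⟩
    rw [← hδ, hle.2.2]
  · rintro ⟨hint, c, hc⟩
    have hcP : InP c := by simpa using hc.2.1
    have hint' : ¬ IsInternal j w c := fun ⟨δ, hδ⟩ => hne δ (by rw [← hδ, hc.2.2])
    have := IsInternal.meet_eq_of_not hD hw hcP hγ hint' hint
    rw [hc.2.2] at this
    rw [this]
    exact hD.meet_le_right hw (by simpa using hγ)

end CoheirPoints

/-! ### Comparing two co-heir points. -/

section Comparison

variable {M C D₁ D₂ : Type u} [lang.Structure M] [lang.Structure C] [lang.Structure D₁]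
  [lang.Structure D₂] {flag : Prop} {f : M ↪[lang] C} {j₁ : C ↪[lang] D₁} {j₂ : C ↪[lang] D₂}
  {w₁ : D₁} {w₂ : D₂}

/-- The elements of `C` below a coheir point are determined by its type over `M` and its side. -/
theorem le_iff_le_of_profile (hC : IsTree C flag) (hD₁ : IsTree D₁ flag) (hD₂ : IsTree D₂ flag)
    (h₁ : IsCoheirPoint f j₁ w₁) (h₂ : IsCoheirPoint f j₂ w₂) (hw₁ : InP w₁) (hw₂ : InP w₂)
    (hB : ∀ b, Le (j₁ (f b)) w₁ ↔ Le (j₂ (f b)) w₂)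
    (hG : ∀ m, MeetsHigh f j₁ w₁ m ↔ MeetsHigh f j₂ w₂ m)
    (hS : HasSide f j₁ w₁ ↔ HasSide f j₂ w₂) (γ : C) : Le (j₁ γ) w₁ ↔ Le (j₂ γ) w₂ := by
  by_cases hs : HasSide f j₁ w₁
  · obtain ⟨m, hm⟩ := hs.exists_meetsHigh hD₁ h₁
    rw [le_iff_of_hasSide hC hD₁ h₁ hw₁ hs hm,
      le_iff_of_hasSide hC hD₂ h₂ hw₂ (hS.1 hs) ((hG m).1 hm)]
    simp only [hB]
  · rw [le_iff_of_not_hasSide hC hD₁ hs, le_iff_of_not_hasSide hC hD₂ (by rwa [← hS])]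
    simp only [hB]

/-- Being high depends only on the type over `M`. Without a side, internal means not high; with a
side, a high meet is internal exactly when `c ∧ m` is below `w`, and the previous lemma applies. -/
theorem isInternal_iff_of_profile (hC : IsTree C flag) (hD₁ : IsTree D₁ flag)
    (hD₂ : IsTree D₂ flag)
    (h₁ : IsCoheirPoint f j₁ w₁) (h₂ : IsCoheirPoint f j₂ w₂) (hw₁ : InP w₁) (hw₂ : InP w₂)
    (hB : ∀ b, Le (j₁ (f b)) w₁ ↔ Le (j₂ (f b)) w₂)
    (hG : ∀ m, MeetsHigh f j₁ w₁ m ↔ MeetsHigh f j₂ w₂ m)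
    (hS : HasSide f j₁ w₁ ↔ HasSide f j₂ w₂) {c : C} (hc : InP c) :
    IsInternal j₁ w₁ c ↔ IsInternal j₂ w₂ c := by
  have hhigh : IsHigh f j₁ w₁ c ↔ IsHigh f j₂ w₂ c := by
    by_cases hm : ∃ m, MeetsHigh f j₁ w₁ m
    · obtain ⟨m, hm⟩ := hm
      rw [isHigh_iff_of_meetsHigh hD₁ hw₁ hm hc,
        isHigh_iff_of_meetsHigh hD₂ hw₂ ((hG m).1 hm) hc]
      simp only [hB]
    · push Not at hm
      rw [isHigh_iff_of_not_meetsHigh hC hD₁ h₁ hw₁ hm hc,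
        isHigh_iff_of_not_meetsHigh hC hD₂ h₂ hw₂ (fun m => by rw [← hG]; exact hm m) hc]
      simp only [hB]
  by_cases hs : HasSide f j₁ w₁
  · by_cases hh : IsHigh f j₁ w₁ c
    · obtain ⟨m, hm⟩ := hs.exists_meetsHigh hD₁ h₁
      rw [isInternal_iff_of_meetsHigh hD₁ h₁ hw₁ hm hc,
        isInternal_iff_of_meetsHigh hD₂ h₂ hw₂ ((hG m).1 hm) hc]
      exact le_iff_le_of_profile hC hD₁ hD₂ h₁ h₂ hw₁ hw₂ hB hG hS _
    · exact iff_of_true (isInternal_of_not_isHigh hD₁ hw₁ hc hh)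
        (isInternal_of_not_isHigh hD₂ hw₂ hc (by rwa [← hhigh]))
  · rw [isInternal_iff_of_not_hasSide hD₁ hw₁ hs hc,
      isInternal_iff_of_not_hasSide hD₂ hw₂ (by rwa [← hS]) hc, hhigh]

/-- Internal meets are determined by the elements of `C` below a point. -/
theorem meet_eq_of_isInternal (hD₁ : IsTree D₁ flag) (hD₂ : IsTree D₂ flag) (hw₁ : InP w₁)
    (hw₂ : InP w₂) (hL : ∀ γ, Le (j₁ γ) w₁ ↔ Le (j₂ γ) w₂) {c γ : C} (hc : InP c)
    (hI : IsInternal j₂ w₂ c) (h : meet w₁ (j₁ c) = j₁ γ) : meet w₂ (j₂ c) = j₂ γ := by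
  obtain ⟨δ, hδ⟩ := hI
  have hc₁ : InP (j₁ c) := by simpa using hc
  have hc₂ : InP (j₂ c) := by simpa using hc
  have hγ1 : Le (j₁ γ) w₁ := by rw [← h]; exact hD₁.meet_le_left hw₁ hc₁
  have hγc : Le γ c := by rw [← embedding_Le j₁, ← h]; exact hD₁.meet_le_right hw₁ hc₁
  have hδ2 : Le (j₂ δ) w₂ := by rw [← hδ]; exact hD₂.meet_le_left hw₂ hc₂
  have hδc : Le δ c := by rw [← embedding_Le j₂, ← hδ]; exact hD₂.meet_le_right hw₂ hc₂
  have h1 : Le (j₂ γ) (j₂ δ) := by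
    rw [← hδ]; exact hD₂.le_meet ((hL γ).1 hγ1) (by simpa using hγc)
  have h2 : Le (j₁ δ) (j₁ γ) := by
    rw [← h]; exact hD₁.le_meet ((hL δ).2 hδ2) (by simpa using hδc)
  rw [hδ]
  rw [embedding_Le, ← embedding_Le j₂] at h2
  exact hD₂.le_antisymm h2 h1

end Comparison

/-! ### Finite data determining a co-heir. -/

section Counting

variable {M C D₁ D₂ : Type u} [lang.Structure M] [lang.Structure C] [lang.Structure D₁]
  [lang.Structure D₂] {flag : Prop} {n : ℕ} {f : M ↪[lang] C} {j₁ : C ↪[lang] D₁}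
  {j₂ : C ↪[lang] D₂} {x₁ : Fin n → D₁} {x₂ : Fin n → D₂}

/-- The meet `w ∧ c` lies in `P` but not in `C`. -/
def IsExternal {D : Type u} [lang.Structure D] (j : C ↪[lang] D) (w : D) (c : C) : Prop :=
  InP c ∧ ¬ IsInternal j w c

/-- The meets of the entries of a tuple realize types that are finitely satisfiable in `M`. -/
def IsCoheirTuple {D : Type u} [lang.Structure D] (f : M ↪[lang] C) (j : C ↪[lang] D)
    (x : Fin n → D) : Prop :=
  ∀ i k, IsCoheirPoint f j (meet (x i) (x k))

/-- The finitely many bits that determine a coheir up to colours. -/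
def coheirBits {D : Type u} [lang.Structure D] (f : M ↪[lang] C) (j : C ↪[lang] D)
    (x : Fin n → D) (i k : Fin n) : Prop × Prop × Prop × Prop × (Fin n → Prop) :=
  (HasSide f j (meet (x i) (x k)), ∃ c, Le (meet (x i) (x k)) (j c),
    ∃ c, IsExternal j (x i) c ∧ Le (meet (x i) (j c)) (x k),
    ∃ c c', IsExternal j (x i) c ∧ IsExternal j (x k) c' ∧
      Hf (meet (x i) (j c)) = Hf (meet (x k) (j c')),
    fun l => ∃ c, IsExternal j (x i) c ∧ Hf (meet (x i) (j c)) = Hf (meet (x k) (x l)))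

/-- The elements of `M` that are the colour of an external meet of `w`. -/
def coheirColours {D : Type u} [lang.Structure D] (f : M ↪[lang] C) (j : C ↪[lang] D) (w : D) :
    Set M :=
  {m | ∃ c, IsExternal j w c ∧ Hf (meet w (j c)) = j (f m)}

/-- All external meets of `w` are one and the same point, which has one colour. -/
theorem coheirColours_subsingleton {D : Type u} [lang.Structure D] (hD : IsTree D flag)
    (f : M ↪[lang] C) (j : C ↪[lang] D) {w : D} (hw : InP w) :
    (coheirColours f j w).Subsingleton := by
  rintro m ⟨c, hc, hm⟩ m' ⟨c', hc', hm'⟩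
  rw [IsInternal.meet_eq_of_not hD hw hc.1 hc'.1 hc.2 hc'.2, hm'] at hm
  exact (f.injective (j.injective hm)).symm

/-- Two tuples with the same type over `M` and the same bits and colours. -/
structure SameData (flag : Prop) (f : M ↪[lang] C) (j₁ : C ↪[lang] D₁) (j₂ : C ↪[lang] D₂)
    (x₁ : Fin n → D₁) (x₂ : Fin n → D₂) : Prop where
  tree : IsTree C flag
  tree₁ : IsTree D₁ flag
  tree₂ : IsTree D₂ flag
  coheir₁ : IsCoheirTuple f j₁ x₁
  coheir₂ : IsCoheirTuple f j₂ x₂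
  realize_iff : ∀ φ : lang.Formula (Fin n ⊕ M),
    φ.Realize (Sum.elim x₁ (j₁ ∘ f)) ↔ φ.Realize (Sum.elim x₂ (j₂ ∘ f))
  bits : coheirBits f j₁ x₁ = coheirBits f j₂ x₂
  colours : flag → ∀ i, InP (x₁ i) → coheirColours f j₁ (x₁ i) = coheirColours f j₂ (x₂ i)

namespace SameData

/-- The variable standing for the `i`-th entry of a tuple. -/
abbrev tupVar (i : Fin n) : lang.Term (Fin n ⊕ M) := Term.var (Sum.inl i)

/-- A parameter. -/
abbrev parVar (m : M) : lang.Term (Fin n ⊕ M) := Term.var (Sum.inr m)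

variable (h : SameData flag f j₁ j₂ x₁ x₂)
include h

theorem InP_iff (i : Fin n) : InP (x₁ i) ↔ InP (x₂ i) := by
  simpa using h.realize_iff (memP (tupVar i))

theorem hasSide_iff (i k : Fin n) :
    HasSide f j₁ (meet (x₁ i) (x₁ k)) ↔ HasSide f j₂ (meet (x₂ i) (x₂ k)) :=
  iff_of_eq (congrArg (·.1) (congrFun (congrFun h.bits i) k))

theorem bounded_iff (i k : Fin n) :
    (∃ c, Le (meet (x₁ i) (x₁ k)) (j₁ c)) ↔ ∃ c, Le (meet (x₂ i) (x₂ k)) (j₂ c) :=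
  iff_of_eq (congrArg (·.2.1) (congrFun (congrFun h.bits i) k))

theorem low_base_iff (i k : Fin n) (b : M) :
    Le (j₁ (f b)) (meet (x₁ i) (x₁ k)) ↔ Le (j₂ (f b)) (meet (x₂ i) (x₂ k)) := by
  simpa using h.realize_iff (leFormula (parVar b) (tMeet (tupVar i) (tupVar k)))

theorem meetsHigh_iff (i k : Fin n) (m : M) :
    MeetsHigh f j₁ (meet (x₁ i) (x₁ k)) m ↔ MeetsHigh f j₂ (meet (x₂ i) (x₂ k)) m := by
  refine and_congr Iff.rfl (forall_congr' fun b => imp_congr (h.low_base_iff i k b) ?_)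
  simpa using h.realize_iff
    (ltFormula (parVar b) (tMeet (tMeet (tupVar i) (tupVar k)) (parVar m)))

theorem low_iff {i k : Fin n} (hi : InP (x₁ i)) (hk : InP (x₁ k)) (γ : C) :
    Le (j₁ γ) (meet (x₁ i) (x₁ k)) ↔ Le (j₂ γ) (meet (x₂ i) (x₂ k)) :=
  le_iff_le_of_profile h.tree h.tree₁ h.tree₂ (h.coheir₁ i k) (h.coheir₂ i k)
    (h.tree₁.meet_mem _ _ hi hk)
    (h.tree₂.meet_mem _ _ ((h.InP_iff i).1 hi) ((h.InP_iff k).1 hk)) (h.low_base_iff i k)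
    (h.meetsHigh_iff i k) (h.hasSide_iff i k) γ

theorem isInternal_iff {i k : Fin n} (hi : InP (x₁ i)) (hk : InP (x₁ k)) {c : C} (hc : InP c) :
    IsInternal j₁ (meet (x₁ i) (x₁ k)) c ↔ IsInternal j₂ (meet (x₂ i) (x₂ k)) c :=
  isInternal_iff_of_profile h.tree h.tree₁ h.tree₂ (h.coheir₁ i k) (h.coheir₂ i k)
    (h.tree₁.meet_mem _ _ hi hk)
    (h.tree₂.meet_mem _ _ ((h.InP_iff i).1 hi) ((h.InP_iff k).1 hk)) (h.low_base_iff i k)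
    (h.meetsHigh_iff i k) (h.hasSide_iff i k) hc

theorem isInternal_iff' {i : Fin n} (hi : InP (x₁ i)) {c : C} (hc : InP c) :
    IsInternal j₁ (x₁ i) c ↔ IsInternal j₂ (x₂ i) c := by
  simpa only [h.tree₁.meet_self, h.tree₂.meet_self] using h.isInternal_iff hi hi hc

theorem isExternal_iff {i : Fin n} (hi : InP (x₁ i)) (c : C) :
    IsExternal j₁ (x₁ i) c ↔ IsExternal j₂ (x₂ i) c :=
  and_congr_right fun hc => not_congr (h.isInternal_iff' hi hc)

/-- By finite satisfiability such a `γ` comes from `M`, where the type over `M` decides. The colour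
version below has the same reason. -/
theorem meet_eq_iff (i k : Fin n) (γ : C) :
    meet (x₁ i) (x₁ k) = j₁ γ ↔ meet (x₂ i) (x₂ k) = j₂ γ := by
  have key : ∀ a : M, meet (x₁ i) (x₁ k) = j₁ (f a) ↔ meet (x₂ i) (x₂ k) = j₂ (f a) := fun a => by
    simpa using h.realize_iff (Term.equal (tMeet (tupVar i) (tupVar k)) (parVar a))
  constructor
  · intro h'
    obtain ⟨a, rfl⟩ := (h.coheir₁ i k).exists_of_eq h'
    exact (key a).1 h'
  · intro h'
    obtain ⟨a, rfl⟩ := (h.coheir₂ i k).exists_of_eq h'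
    exact (key a).2 h'

theorem eq_iff (i : Fin n) (γ : C) : x₁ i = j₁ γ ↔ x₂ i = j₂ γ := by
  simpa only [h.tree₁.meet_self, h.tree₂.meet_self] using h.meet_eq_iff i i γ

theorem Hf_meet_eq_iff (i k : Fin n) (γ : C) :
    Hf (meet (x₁ i) (x₁ k)) = j₁ γ ↔ Hf (meet (x₂ i) (x₂ k)) = j₂ γ := by
  have key : ∀ a : M, Hf (meet (x₁ i) (x₁ k)) = j₁ (f a) ↔ Hf (meet (x₂ i) (x₂ k)) = j₂ (f a) :=
    fun a => by
      simpa using h.realize_iff (Term.equal (tH (tMeet (tupVar i) (tupVar k))) (parVar a))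
  constructor
  · intro h'
    obtain ⟨a, rfl⟩ := (h.coheir₁ i k).exists_of_Hf_eq h'
    exact (key a).1 h'
  · intro h'
    obtain ⟨a, rfl⟩ := (h.coheir₂ i k).exists_of_Hf_eq h'
    exact (key a).2 h'

theorem meet_le_iff {i k : Fin n} (hi : InP (x₁ i)) (hk : InP (x₁ k)) {γ : C} (hγ : InP γ) :
    Le (meet (x₁ i) (x₁ k)) (j₁ γ) ↔ Le (meet (x₂ i) (x₂ k)) (j₂ γ) := by
  by_cases hne : ∃ δ, meet (x₁ i) (x₁ k) = j₁ δ
  · obtain ⟨δ, hδ⟩ := hne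
    rw [hδ, (h.meet_eq_iff i k δ).1 hδ, embedding_Le, embedding_Le]
  · push Not at hne
    rw [le_iff_of_forall_ne h.tree₁ (h.tree₁.meet_mem _ _ hi hk) hne hγ,
      le_iff_of_forall_ne h.tree₂ (h.tree₂.meet_mem _ _ ((h.InP_iff i).1 hi) ((h.InP_iff k).1 hk))
        (fun δ hδ => hne δ ((h.meet_eq_iff i k δ).2 hδ)) hγ, h.isInternal_iff hi hk hγ,
      h.bounded_iff]

/-- The bit only asserts that some external `c` has the property. This suffices because the external
meet of an entry does not depend on `c`; the colour bits are read in the same way. -/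
theorem external_le_iff {i k : Fin n} (hi : InP (x₁ i)) {c : C} (hc : IsExternal j₁ (x₁ i) c) :
    Le (meet (x₁ i) (j₁ c)) (x₁ k) ↔ Le (meet (x₂ i) (j₂ c)) (x₂ k) := by
  have hc₂ := (h.isExternal_iff hi c).1 hc
  have key : (∃ c, IsExternal j₁ (x₁ i) c ∧ Le (meet (x₁ i) (j₁ c)) (x₁ k)) ↔
      ∃ c, IsExternal j₂ (x₂ i) c ∧ Le (meet (x₂ i) (j₂ c)) (x₂ k) :=
    iff_of_eq (congrArg (·.2.2.1) (congrFun (congrFun h.bits i) k))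
  constructor
  · intro h'
    obtain ⟨c', hc', h''⟩ := key.1 ⟨c, hc, h'⟩
    rwa [IsInternal.meet_eq_of_not h.tree₂ ((h.InP_iff i).1 hi) hc₂.1 hc'.1 hc₂.2 hc'.2]
  · intro h'
    obtain ⟨c', hc', h''⟩ := key.2 ⟨c, hc₂, h'⟩
    rwa [IsInternal.meet_eq_of_not h.tree₁ hi hc.1 hc'.1 hc.2 hc'.2]

/-- A colour of an external meet that lies in `C` comes from `M`, so it is recorded in
`coheirColours`. This is the only place where infinitely many possibilities enter. -/
theorem Hf_external_eq_iff (hf : flag) {i : Fin n} (hi : InP (x₁ i)) {c : C}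
    (hc : IsExternal j₁ (x₁ i) c) (γ : C) :
    Hf (meet (x₁ i) (j₁ c)) = j₁ γ ↔ Hf (meet (x₂ i) (j₂ c)) = j₂ γ := by
  have hi₂ := (h.InP_iff i).1 hi
  have hc₂ := (h.isExternal_iff hi c).1 hc
  have h₁ := h.coheir₁ i i
  have h₂ := h.coheir₂ i i
  rw [h.tree₁.meet_self] at h₁
  rw [h.tree₂.meet_self] at h₂
  constructor
  · intro h'
    obtain ⟨a, rfl⟩ := h₁.exists_of_Hf_meet_eq_of_not_isInternal h.tree h.tree₁ hi hc.1 hc.2 h'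
    have : a ∈ coheirColours f j₁ (x₁ i) := ⟨c, hc, h'⟩
    rw [h.colours hf i hi] at this
    obtain ⟨c', hc', h''⟩ := this
    rwa [IsInternal.meet_eq_of_not h.tree₂ hi₂ hc₂.1 hc'.1 hc₂.2 hc'.2]
  · intro h'
    obtain ⟨a, rfl⟩ := h₂.exists_of_Hf_meet_eq_of_not_isInternal h.tree h.tree₂ hi₂ hc₂.1 hc₂.2 h'
    have : a ∈ coheirColours f j₂ (x₂ i) := ⟨c, hc₂, h'⟩
    rw [← h.colours hf i hi] at this
    obtain ⟨c', hc', h''⟩ := this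
    rwa [IsInternal.meet_eq_of_not h.tree₁ hi hc.1 hc'.1 hc.2 hc'.2]

theorem Hf_external_eq_meet_iff {i : Fin n} (hi : InP (x₁ i)) {c : C}
    (hc : IsExternal j₁ (x₁ i) c) (k l : Fin n) :
    Hf (meet (x₁ i) (j₁ c)) = Hf (meet (x₁ k) (x₁ l)) ↔
      Hf (meet (x₂ i) (j₂ c)) = Hf (meet (x₂ k) (x₂ l)) := by
  have hc₂ := (h.isExternal_iff hi c).1 hc
  have key : (∃ c, IsExternal j₁ (x₁ i) c ∧ Hf (meet (x₁ i) (j₁ c)) = Hf (meet (x₁ k) (x₁ l))) ↔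
      ∃ c, IsExternal j₂ (x₂ i) c ∧ Hf (meet (x₂ i) (j₂ c)) = Hf (meet (x₂ k) (x₂ l)) :=
    iff_of_eq (congrFun (congrArg (·.2.2.2.2) (congrFun (congrFun h.bits i) k)) l)
  constructor
  · intro h'
    obtain ⟨c', hc', h''⟩ := key.1 ⟨c, hc, h'⟩
    rwa [IsInternal.meet_eq_of_not h.tree₂ ((h.InP_iff i).1 hi) hc₂.1 hc'.1 hc₂.2 hc'.2]
  · intro h'
    obtain ⟨c', hc', h''⟩ := key.2 ⟨c, hc₂, h'⟩
    rwa [IsInternal.meet_eq_of_not h.tree₁ hi hc.1 hc'.1 hc.2 hc'.2]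

theorem Hf_external_eq_external_iff {i k : Fin n} (hi : InP (x₁ i)) (hk : InP (x₁ k)) {c c' : C}
    (hc : IsExternal j₁ (x₁ i) c) (hc' : IsExternal j₁ (x₁ k) c') :
    Hf (meet (x₁ i) (j₁ c)) = Hf (meet (x₁ k) (j₁ c')) ↔
      Hf (meet (x₂ i) (j₂ c)) = Hf (meet (x₂ k) (j₂ c')) := by
  have hi₂ := (h.InP_iff i).1 hi
  have hk₂ := (h.InP_iff k).1 hk
  have hc₂ := (h.isExternal_iff hi c).1 hc
  have hc'₂ := (h.isExternal_iff hk c').1 hc'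
  have key : (∃ c c', IsExternal j₁ (x₁ i) c ∧ IsExternal j₁ (x₁ k) c' ∧
        Hf (meet (x₁ i) (j₁ c)) = Hf (meet (x₁ k) (j₁ c'))) ↔
      ∃ c c', IsExternal j₂ (x₂ i) c ∧ IsExternal j₂ (x₂ k) c' ∧
        Hf (meet (x₂ i) (j₂ c)) = Hf (meet (x₂ k) (j₂ c')) :=
    iff_of_eq (congrArg (·.2.2.2.1) (congrFun (congrFun h.bits i) k))
  constructor
  · intro h'
    obtain ⟨d, d', hd, hd', h''⟩ := key.1 ⟨c, c', hc, hc', h'⟩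
    rwa [IsInternal.meet_eq_of_not h.tree₂ hi₂ hc₂.1 hd.1 hc₂.2 hd.2,
      IsInternal.meet_eq_of_not h.tree₂ hk₂ hc'₂.1 hd'.1 hc'₂.2 hd'.2]
  · intro h'
    obtain ⟨d, d', hd, hd', h''⟩ := key.2 ⟨c, c', hc₂, hc'₂, h'⟩
    rwa [IsInternal.meet_eq_of_not h.tree₁ hi hc.1 hd.1 hc.2 hd.2,
      IsInternal.meet_eq_of_not h.tree₁ hk hc'.1 hd'.1 hc'.2 hd'.2]

/-- Every meet of entries is in `C`, a meet of entries of the tuple, or an external meet. -/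
theorem meet_cases {a b : Fin n ⊕ C} (ha : InP (Sum.elim x₁ j₁ a)) (hb : InP (Sum.elim x₁ j₁ b)) :
    (∃ γ, InP γ ∧ meet (Sum.elim x₁ j₁ a) (Sum.elim x₁ j₁ b) = j₁ γ ∧
      meet (Sum.elim x₂ j₂ a) (Sum.elim x₂ j₂ b) = j₂ γ) ∨
    (∃ i k, InP (x₁ i) ∧ InP (x₁ k) ∧
      meet (Sum.elim x₁ j₁ a) (Sum.elim x₁ j₁ b) = meet (x₁ i) (x₁ k) ∧
      meet (Sum.elim x₂ j₂ a) (Sum.elim x₂ j₂ b) = meet (x₂ i) (x₂ k)) ∨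
    ∃ i c, InP (x₁ i) ∧ IsExternal j₁ (x₁ i) c ∧
      meet (Sum.elim x₁ j₁ a) (Sum.elim x₁ j₁ b) = meet (x₁ i) (j₁ c) ∧
      meet (Sum.elim x₂ j₂ a) (Sum.elim x₂ j₂ b) = meet (x₂ i) (j₂ c) := by
  have key : ∀ (i : Fin n) (c : C), InP (x₁ i) → InP c →
      (∃ γ, InP γ ∧ meet (x₁ i) (j₁ c) = j₁ γ ∧ meet (x₂ i) (j₂ c) = j₂ γ) ∨
      ∃ i' c', InP (x₁ i') ∧ IsExternal j₁ (x₁ i') c' ∧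
        meet (x₁ i) (j₁ c) = meet (x₁ i') (j₁ c') ∧
        meet (x₂ i) (j₂ c) = meet (x₂ i') (j₂ c') := by
    intro i c hi hc
    by_cases hint : IsInternal j₁ (x₁ i) c
    · left
      obtain ⟨γ, hγ⟩ := hint
      have hP := h.tree₁.meet_mem _ _ hi ((embedding_InP j₁ c).2 hc)
      rw [hγ, embedding_InP] at hP
      refine ⟨γ, hP, hγ, ?_⟩
      have hL := h.low_iff hi hi
      simp only [h.tree₁.meet_self, h.tree₂.meet_self] at hL
      exact meet_eq_of_isInternal h.tree₁ h.tree₂ hi ((h.InP_iff i).1 hi) hL hc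
        ((h.isInternal_iff' hi hc).1 ⟨γ, hγ⟩) hγ
    · exact Or.inr ⟨i, c, hi, ⟨hc, hint⟩, rfl, rfl⟩
  rcases a with i | c <;> rcases b with k | d <;> simp only [Sum.elim_inl, Sum.elim_inr] at ha hb ⊢
  · exact Or.inr (Or.inl ⟨i, k, ha, hb, rfl, rfl⟩)
  · exact (key i d ha (by simpa using hb)).imp_right Or.inr
  · rw [h.tree₁.meet_comm _ _ ha hb, h.tree₂.meet_comm _ _ (by simpa using ha)
      ((h.InP_iff k).1 hb)]
    exact (key k c hb (by simpa using ha)).imp_right Or.inr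
  · rw [embedding_InP] at ha hb
    exact Or.inl ⟨meet c d, h.tree.meet_mem _ _ ha hb, by rw [embedding_meet],
      by rw [embedding_meet]⟩

theorem Hf_cases {a b : Fin n ⊕ C} (hab : OkPair (Sum.elim x₁ j₁) a b) :
    (∃ γ, meet (Sum.elim x₁ j₁ a) (Sum.elim x₁ j₁ b) = j₁ γ ∧
      meet (Sum.elim x₂ j₂ a) (Sum.elim x₂ j₂ b) = j₂ γ) ∨
    (∃ i k, meet (Sum.elim x₁ j₁ a) (Sum.elim x₁ j₁ b) = meet (x₁ i) (x₁ k) ∧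
      meet (Sum.elim x₂ j₂ a) (Sum.elim x₂ j₂ b) = meet (x₂ i) (x₂ k)) ∨
    ∃ i c, InP (x₁ i) ∧ IsExternal j₁ (x₁ i) c ∧
      meet (Sum.elim x₁ j₁ a) (Sum.elim x₁ j₁ b) = meet (x₁ i) (j₁ c) ∧
      meet (Sum.elim x₂ j₂ a) (Sum.elim x₂ j₂ b) = meet (x₂ i) (j₂ c) := by
  rcases hab with rfl | ⟨ha, hb⟩
  · rcases a with i | c
    · exact Or.inr (Or.inl ⟨i, i, rfl, rfl⟩)
    · exact Or.inl ⟨c, h.tree₁.meet_self _, h.tree₂.meet_self _⟩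
  · rcases h.meet_cases ha hb with ⟨γ, -, h'⟩ | ⟨i, k, -, -, h'⟩ | h'
    exacts [Or.inl ⟨γ, h'⟩, Or.inr (Or.inl ⟨i, k, h'⟩), Or.inr (Or.inr h')]

/-- Tuples with the same data realize the same atomic formulas over `C`. -/
theorem atomEq : AtomEq flag (Sum.elim x₁ j₁) (Sum.elim x₂ j₂) where
  P_iff := by
    rintro (i | c)
    · exact h.InP_iff i
    · simp
  Q_iff := by
    rintro (i | c)
    · simpa using h.realize_iff (memQ (tupVar i))
    · simp
  eq_iff := by
    rintro (i | c) (k | d)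
    · simpa using h.realize_iff (Term.equal (tupVar i) (tupVar k))
    · exact h.eq_iff i d
    · exact eq_comm.trans ((h.eq_iff k c).trans eq_comm)
    · simp [j₁.injective.eq_iff, j₂.injective.eq_iff]
  le_iff := by
    intro a b e ha hb he
    rcases h.meet_cases ha hb with ⟨γ, hγ, e1, e2⟩ | ⟨i, k, hi, hk, e1, e2⟩ | ⟨i, c, hi, hc, e1, e2⟩ <;>
      rw [e1, e2] <;> rcases e with l | d <;> simp only [Sum.elim_inl, Sum.elim_inr] at he ⊢
    · simpa only [h.tree₁.meet_self, h.tree₂.meet_self] using h.low_iff he he γ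
    · rw [embedding_Le, embedding_Le]
    · simpa using h.realize_iff (leFormula (tMeet (tupVar i) (tupVar k)) (tupVar l))
    · exact h.meet_le_iff hi hk (by simpa using he)
    · exact h.external_le_iff hi hc
    · have hd : InP d := by simpa using he
      have hc₂ := (h.isExternal_iff hi c).1 hc
      rw [meet_le_iff_of_not_isInternal h.tree₁ hi hc.1 hd hc.2,
        meet_le_iff_of_not_isInternal h.tree₂ ((h.InP_iff i).1 hi) hc₂.1 hd hc₂.2,
        h.isInternal_iff' hi hd]
  H_iff := by
    intro hf a b a' b' hab hab'
    rcases h.Hf_cases hab with ⟨γ, e1, e2⟩ | ⟨i, k, e1, e2⟩ | ⟨i, c, hi, hc, e1, e2⟩ <;>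
      rcases h.Hf_cases hab' with ⟨γ', e3, e4⟩ | ⟨i', k', e3, e4⟩ | ⟨i', c', hi', hc', e3, e4⟩ <;>
      rw [e1, e2, e3, e4]
    · simp only [← embedding_Hf, j₁.injective.eq_iff, j₂.injective.eq_iff]
    · rw [← embedding_Hf, ← embedding_Hf, eq_comm, h.Hf_meet_eq_iff, eq_comm]
    · rw [← embedding_Hf, ← embedding_Hf, eq_comm, h.Hf_external_eq_iff hf hi' hc', eq_comm]
    · rw [← embedding_Hf, ← embedding_Hf, h.Hf_meet_eq_iff]
    · simpa using h.realize_iff (Term.equal (tH (tMeet (tupVar i) (tupVar k)))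
        (tH (tMeet (tupVar i') (tupVar k'))))
    · rw [eq_comm, h.Hf_external_eq_meet_iff hi' hc', eq_comm]
    · rw [← embedding_Hf, ← embedding_Hf, h.Hf_external_eq_iff hf hi hc]
    · exact h.Hf_external_eq_meet_iff hi hc i' k'
    · exact h.Hf_external_eq_external_iff hi hi' hc hc'

end SameData

end Counting

/-! ### Elementary invariance of trees and richness. -/

section FlaggedTheory

variable {M N : Type*} [lang.Structure M] [lang.Structure N] {flag : Prop}

/-- The theory of meet trees, with a colouring if `flag` holds and with `H = id` otherwise. -/
noncomputable def flagTheory (flag : Prop) : lang.Theory :=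
  open Classical in
  insert (if flag then ∀' (fP &0 ⟹ fQ (tH &0)) else ∀' Term.bdEqual (tH &0) &0) treeTheory

theorem model_flagTheory_iff : M ⊨ flagTheory flag ↔ IsTree M flag := by
  have h1 : M ⊨ flagTheory flag ↔ (flag → ∀ x : M, InP x → InQ (Hf x)) ∧
      (¬ flag → ∀ x : M, Hf x = x) ∧ OrderAxioms M := by
    rw [flagTheory, ← Set.singleton_union, Theory.model_union_iff, Theory.model_singleton_iff,
      model_treeTheory_iff, ← and_assoc]
    refine and_congr_left fun _ => ?_
    by_cases hf : flag
    · simp [hf, Sentence.Realize, Formula.Realize, Fin.snoc]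
    · simp [hf, Sentence.Realize, Formula.Realize, Fin.snoc]
  rw [h1]
  exact ⟨fun h => h.2.2.isTree h.1 h.2.1, fun h => ⟨h.H_mem, h.H_id, h.orderAxioms⟩⟩

theorem IsTree.of_elementarilyEquivalent (hM : IsTree M flag) (h : M ≅[lang] N) :
    IsTree N flag :=
  model_flagTheory_iff.1 (h.theory_model_iff.1 (model_flagTheory_iff.2 hM))

theorem IsRich.of_elementarilyEquivalent (hM : IsRich M flag) (h : M ≅[lang] N) :
    IsRich N flag :=
  (model_richTheory_iff _).1 (h.theory_model_iff.1 ((model_richTheory_iff _).2 hM))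

end FlaggedTheory

/-! ### Bounds on the number of co-heirs. -/

section CoheirData

variable {M C : Type u} [lang.Structure M] [lang.Structure C] [Nonempty C] {flag : Prop} {n : ℕ}

/-- Substituting the term `xᵢ ∧ xₖ` turns a formula about the meet into one about the tuple. It then
holds at some tuple from `M`, whose meet is again in `M`. -/
theorem isCoheirTuple_point (f : M ↪ₑ[lang] C) (U : Ultrafilter (Fin n → M)) :
    IsCoheirTuple f.toEmbedding (UPow.diag lang U).toEmbedding (UPow.point f U) := by
  intro i k φ hφ
  let t : C ⊕ Unit → lang.Term (Fin n ⊕ C) :=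
    Sum.elim (fun c => Term.var (Sum.inr c))
      fun _ => tMeet (Term.var (Sum.inl i)) (Term.var (Sum.inl k))
  have ht : ∀ (D : Type u) [lang.Structure D] (x : Fin n → D) (j : C → D),
      Formula.Realize (BoundedFormula.subst φ t) (Sum.elim x j) ↔
        φ.Realize (Sum.elim j fun _ => meet (x i) (x k)) := by
    intro D _ x j
    rw [Formula.Realize, BoundedFormula.realize_subst, Formula.Realize]
    refine iff_of_eq (congrArg₂ _ (funext fun y => ?_) rfl)
    rcases y with c | _ <;> simp [t]
  have h1 := (ht _ (UPow.point f U) (UPow.diag lang U)).2 hφ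
  rw [UPow.realize_point] at h1
  obtain ⟨a, ha⟩ := ultraType_finSatIn f U {_} (by simpa using h1)
  have h2 := (ht _ (fun l => f (a l)) id).1 (ha _ (by simp))
  exact ⟨meet (a i) (a k), by
    have := embedding_meet f.toEmbedding (a i) (a k)
    rw [this]
    exact h2⟩

/-- The bits of the limit type of an ultrafilter. -/
def typeBits (f : M ↪ₑ[lang] C) (U : Ultrafilter (Fin n → M)) :=
  coheirBits f.toEmbedding (UPow.diag lang U).toEmbedding (UPow.point f U)

/-- The colours of the limit type of an ultrafilter. -/
def typeColours (f : M ↪ₑ[lang] C) (U : Ultrafilter (Fin n → M)) (i : Fin n) : Set M :=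
  {m | InP (UPow.point f U i) ∧
    m ∈ coheirColours f.toEmbedding (UPow.diag lang U).toEmbedding (UPow.point f U i)}

/-- A coheir is determined by its restriction to the small model, finitely many bits and
finitely many colours. -/
theorem ultraType_eq_of_data {f : M ↪ₑ[lang] C} (hC : IsTree C flag) (rC : IsRich C flag)
    {U V : Ultrafilter (Fin n → M)} (hp : ultraType (L := lang) id U = ultraType id V)
    (hb : typeBits f U = typeBits f V) (hc : flag → typeColours f U = typeColours f V) :
    ultraType (L := lang) f U = ultraType f V := by
  have hU := (UPow.diag lang U (C := C)).elementarilyEquivalent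
  have hV := (UPow.diag lang V (C := C)).elementarilyEquivalent
  have hreal : ∀ φ : lang.Formula (Fin n ⊕ M),
      φ.Realize (Sum.elim (UPow.point f U) ((UPow.diag lang U).toEmbedding ∘ f.toEmbedding)) ↔
        φ.Realize (Sum.elim (UPow.point f V) ((UPow.diag lang V).toEmbedding ∘ f.toEmbedding)) := by
    intro φ
    have h1 := mapParams_mem_ultraType (f := f) U φ
    have h2 := mapParams_mem_ultraType (f := f) V φ
    rw [← UPow.realize_point, realize_mapParams] at h1 h2
    exact h1.trans ((Set.ext_iff.1 hp φ).trans h2.symm)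
  have hd : SameData flag f.toEmbedding (UPow.diag lang U).toEmbedding
      (UPow.diag lang V).toEmbedding (UPow.point f U) (UPow.point f V) :=
    { tree := hC
      tree₁ := hC.of_elementarilyEquivalent hU
      tree₂ := hC.of_elementarilyEquivalent hV
      coheir₁ := isCoheirTuple_point f U
      coheir₂ := isCoheirTuple_point f V
      realize_iff := hreal
      bits := hb
      colours := fun hf i hi => by
        have hi' : InP (UPow.point f V i) := by
          simpa using (hreal (memP (Term.var (Sum.inl i)))).1 (by simpa using hi)
        have := congrFun (hc hf) i
        simpa only [typeColours, hi, hi', true_and, Set.ofPred_mem_eq] using this }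
  ext φ
  rw [← UPow.realize_point, ← UPow.realize_point]
  exact hd.atomEq.realize_iff hd.tree₁ hd.tree₂ (rC.of_elementarilyEquivalent hU)
    (rC.of_elementarilyEquivalent hV) φ

theorem mk_subsingleton_sets_le (M : Type u) [Infinite M] :
    #{s : Set M // s.Subsingleton} ≤ #M := by
  rw [← mk_option (α := M) |>.trans (add_one_eq (aleph0_le_mk M))]
  refine mk_le_of_surjective (f := fun o : Option M => o.elim
    (⟨∅, Set.subsingleton_empty⟩ : {s : Set M // s.Subsingleton})
    fun m => ⟨{m}, Set.subsingleton_singleton⟩) ?_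
  rintro ⟨s, hs⟩
  rcases hs.eq_empty_or_singleton with rfl | ⟨m, rfl⟩
  exacts [⟨none, rfl⟩, ⟨some m, rfl⟩]

/-- A type over an infinite coloured tree has at most as many coheirs as the tree has points. -/
theorem mk_coheirs_le {f : M ↪ₑ[lang] C} [Infinite M] (hC : IsTree C True) (rC : IsRich C True)
    {p : Set (lang.Formula (Fin n ⊕ M))} (hp : p ∈ completeTypes lang M n) :
    #(coheirs f p) ≤ #M := by
  have hex : ∀ q : coheirs f p, ∃ U : Ultrafilter (Fin n → M), q.1 = ultraType f U :=
    fun q => exists_eq_ultraType_of_mem_coheirs q.2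
  choose U hU using hex
  have hsub : ∀ (q : coheirs f p) (i : Fin n), (typeColours f (U q) i).Subsingleton := by
    intro q i m hm m' hm'
    exact coheirColours_subsingleton
      (hC.of_elementarilyEquivalent (UPow.diag lang (U q) (C := C)).elementarilyEquivalent) _ _ hm.1
      hm.2 hm'.2
  -- The first factor is finite, and the second consists of `n` choices among at most `|M|` sets.
  let F : coheirs f p → (Fin n → Fin n → Prop × Prop × Prop × Prop × (Fin n → Prop)) ×
      (Fin n → {s : Set M // s.Subsingleton}) :=
    fun q => (typeBits f (U q), fun i => ⟨typeColours f (U q) i, hsub q i⟩)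
  have hF : Function.Injective F := by
    intro q r h
    have hq : p = ultraType id (U q) := eq_of_mapParams_subset (f := f) hp (by
      rw [← hU]; exact q.2.2.1)
    have hr : p = ultraType id (U r) := eq_of_mapParams_subset (f := f) hp (by
      rw [← hU]; exact r.2.2.1)
    refine Subtype.ext ?_
    rw [hU q, hU r]
    refine ultraType_eq_of_data hC rC (hq.symm.trans hr) (congrArg Prod.fst h) fun _ => ?_
    funext i
    exact congrArg Subtype.val (congrFun (congrArg Prod.snd h) i)
  have h0 := aleph0_le_mk M
  have h2 : #(Fin n → {s : Set M // s.Subsingleton}) ≤ #M := by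
    simp only [mk_arrow, mk_fin, lift_natCast, lift_uzero]
    exact (power_le_power_right (mk_subsingleton_sets_le M)).trans (power_nat_le h0)
  refine (mk_le_of_injective (f := fun q => (ULift.up.{u} (F q).1, (F q).2)) ?_).trans ?_
  · intro q r h
    simp only [Prod.mk.injEq, ULift.up_inj] at h
    exact hF (Prod.ext h.1 h.2)
  · rw [← mul_def]
    refine mul_le_of_le h0 ?_ h2
    exact (lt_aleph0_of_finite _).le.trans h0

/-- Without colours, a type has only finitely many coheirs. -/
theorem finite_ultraTypes {f : M ↪ₑ[lang] C} (hC : IsTree C False) (rC : IsRich C False)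
    (p : Set (lang.Formula (Fin n ⊕ M))) :
    {q : Set (lang.Formula (Fin n ⊕ C)) |
      ∃ U : Ultrafilter (Fin n → M), ultraType id U = p ∧ ultraType f U = q}.Finite := by
  have hex : ∀ q : {q : Set (lang.Formula (Fin n ⊕ C)) |
      ∃ U : Ultrafilter (Fin n → M), ultraType id U = p ∧ ultraType f U = q},
      ∃ U : Ultrafilter (Fin n → M), ultraType (L := lang) id U = p ∧ ultraType f U = q.1 := fun q => q.2
  choose U hU1 hU2 using hex
  refine Set.finite_coe_iff.1 (Finite.of_injective (fun q => typeBits f (U q)) fun q r h => ?_)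
  refine Subtype.ext ?_
  rw [← hU2 q, ← hU2 r]
  exact ultraType_eq_of_data hC rC ((hU1 q).trans (hU1 r).symm) h fun h => h.elim

end CoheirData

/-! ### An independent family on a countable set. -/

section IndependentFamily

open Classical in
/-- The members of the independent family of Fichtenholz, Kantorovich and Hausdorff. -/
def independentSet (A : Set ℕ) : Set (Finset ℕ × Finset (Finset ℕ)) :=
  {x | x.1.filter (· ∈ A) ∈ x.2}

/-- Any choice of sides of the members of the independent family extends to an ultrafilter. -/
theorem exists_ultrafilter_independentSet (χ : Set (Set ℕ)) :
    ∃ U : Ultrafilter (Finset ℕ × Finset (Finset ℕ)), ∀ A, independentSet A ∈ U ↔ A ∈ χ := by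
  classical
  obtain ⟨U, hU⟩ := exists_ultrafilter_of_finset
    (fun A : Set ℕ => {x | x ∈ independentSet A ↔ A ∈ χ}) (by
    intro s
    have hsep : ∀ A B : Set ℕ, ∃ i : ℕ, (i ∈ A ↔ i ∈ B) → A = B := by
      intro A B
      by_cases h : A = B
      · exact ⟨0, fun _ => h⟩
      · have : ¬ ∀ i, i ∈ A ↔ i ∈ B := fun h' => h (Set.ext h')
        push Not at this
        obtain ⟨i, hi⟩ := this
        exact ⟨i, fun h' => by tauto⟩
    choose g hg using hsep
    -- `F` contains a number separating any two distinct members of `s`, so they have different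
    -- traces on `F`. The required point is `F` together with the traces of the members of `χ`.
    let F : Finset ℕ := (s ×ˢ s).image fun p => g p.1 p.2
    refine ⟨(F, (s.filter (· ∈ χ)).image fun A => F.filter (· ∈ A)), fun A hA => ?_⟩
    simp only [independentSet, Set.mem_ofPred_eq, Finset.mem_image, Finset.mem_filter]
    constructor
    · rintro ⟨B, ⟨hB, hχ⟩, h⟩
      have hF : g B A ∈ F := Finset.mem_image.2 ⟨(B, A), Finset.mem_product.2 ⟨hB, hA⟩, rfl⟩
      have h1 := Finset.ext_iff.1 h (g B A)
      simp only [Finset.mem_filter, hF, true_and] at h1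
      rwa [← hg B A h1]
    · exact fun h => ⟨A, ⟨hA, h⟩, by congr⟩)
  refine ⟨U, fun A => ⟨fun h => ?_, fun h => ?_⟩⟩
  · obtain ⟨x, hx1, hx2⟩ := ((show ∀ᶠ x in (U : Filter _), x ∈ independentSet A from h).and
      (hU A)).exists
    exact hx2.1 hx1
  · exact Filter.mem_of_superset (hU A) fun x hx => hx.2 h

end IndependentFamily

/-! ### Dependence by counting co-heirs. -/

section Dependent

instance (n : ℕ) : Countable (Func n) :=
  ⟨fun _ => 0, by intro a b _; cases a <;> cases b <;> rfl⟩

instance (n : ℕ) : Countable (Rel n) :=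
  ⟨fun r => match r with | Rel.P => 0 | Rel.Q => 1 | Rel.lt => 2, by
    intro a b h; cases a <;> cases b <;> first | rfl | cases h⟩

instance (n : ℕ) : Countable (lang.Functions n) := inferInstanceAs (Countable (Func n))

instance (n : ℕ) : Countable (lang.Relations n) := inferInstanceAs (Countable (Rel n))

instance : Countable lang.Symbols :=
  inferInstanceAs (Countable ((Σ l, lang.Functions l) ⊕ Σ l, lang.Relations l))

theorem card_lang_le : lang.card ≤ ℵ₀ := mk_le_aleph0_iff.2 inferInstance

theorem IsRich.infinite {M : Type*} [lang.Structure M] {flag : Prop} (h : IsRich M flag) :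
    Infinite M := by
  by_contra h'
  have := not_infinite_iff_finite.1 h'
  have := Fintype.ofFinite M
  obtain ⟨x, hx, -⟩ := h.exists_Q Finset.univ
  exact hx (Finset.mem_univ x)

theorem exists_countable_elementarySubstructure {M : Type u} [lang.Structure M] [Infinite M]
    (s : Set M) (hs : s.Countable) : ∃ S : lang.ElementarySubstructure M, s ⊆ S ∧ #S = ℵ₀ := by
  obtain ⟨S, hS, hc⟩ := exists_elementarySubstructure_card_eq lang s (ℵ₀ : Cardinal.{u}) le_rfl
    (by simpa using hs.le_aleph0) (by simpa using card_lang_le) (by simp)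
  exact ⟨S, hS, by simpa using hc⟩

/-- Place the tuples `a i` in a countable elementary substructure `S`. Each `χ ⊆ 𝒫(ℕ)` yields an
ultrafilter on them whose limit type over `M` remembers `χ`, through the parameters attached to the
independent sets. These are co-heirs of types over `S`, too many for the bound `mk_coheirs_le`,
which needs no saturation of `M`. -/
theorem isDependent_of_isRich {M : Type u} [lang.Structure M] [Nonempty M] (hM : IsTree M True)
    (rM : IsRich M True) {k l : ℕ} (φ : lang.Formula (Fin k ⊕ Fin l)) :
    ¬ ∃ (a : ℕ → Fin k → M) (b : Set ℕ → Fin l → M),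
      ∀ (i : ℕ) (s : Set ℕ), φ.Realize (Sum.elim (a i) (b s)) ↔ i ∈ s := by
  rintro ⟨a, b, hab⟩
  have := rM.infinite
  obtain ⟨S, hS, hcard⟩ := exists_countable_elementarySubstructure
    (Set.range fun x : ℕ × Fin k => a x.1 x.2) (Set.countable_range _)
  have hScount : Countable S := mk_le_aleph0_iff.1 hcard.le
  have hSinf : Infinite S := infinite_iff.2 hcard.ge
  let a' : ℕ → Fin k → S := fun i j => ⟨a i j, hS ⟨(i, j), rfl⟩⟩
  let f : S ↪ₑ[lang] M := S.subtype
  have hMtype : ∀ p : Set (lang.Formula (Fin k ⊕ S)), ∃ g : Set (lang.Formula (Fin k ⊕ M)) → S,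
      p ∈ completeTypes lang S k → Set.InjOn g (coheirs f p) := by
    intro p
    by_cases hp : p ∈ completeTypes lang S k
    · obtain ⟨ι⟩ : Nonempty (coheirs f p ↪ S) := mk_coheirs_le (f := f) hM rM hp
      classical
      refine ⟨fun q => if h : q ∈ coheirs f p then ι ⟨q, h⟩ else Classical.arbitrary S,
        fun _ q hq r hr h => ?_⟩
      simp only [hq, hr, dif_pos] at h
      exact congrArg Subtype.val (ι.injective h)
    · exact ⟨fun _ => Classical.arbitrary S, fun h => (hp h).elim⟩
  choose g hg using hMtype
  obtain ⟨e, he⟩ := exists_injective_nat (Finset ℕ × Finset (Finset ℕ))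
  choose U hU using exists_ultrafilter_independentSet
  let W : Set (Set ℕ) → Ultrafilter (Fin k → S) := fun χ => (U χ).map fun x => a' (e x)
  have hW : ∀ χ A, φ.relabel (Sum.map id (b (e '' independentSet A))) ∈ ultraType f (W χ) ↔
      A ∈ χ := by
    intro χ A
    rw [← hU χ A]
    have h1 : ∀ x, (φ.relabel (Sum.map id (b (e '' independentSet A))) :
        lang.Formula (Fin k ⊕ M)).Realize (Sum.elim (fun i => f (a' (e x) i)) id) ↔
        x ∈ independentSet A := by
      intro x
      rw [Formula.realize_relabel, Sum.elim_comp_map, ← he.mem_set_image, ← hab]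
      rfl
    simp only [ultraType, W, Set.mem_ofPred_eq, Ultrafilter.coe_map, Filter.eventually_map, h1]
    rfl
  -- `χ` is coded by the type over `S` and the label of its limit among the countably many co-heirs
  -- of that type. This would inject a set of size `2 ^ 2 ^ ℵ₀` into one of size at most `2 ^ ℵ₀`.
  let F : Set (Set ℕ) → Set (lang.Formula (Fin k ⊕ S)) × S := fun χ =>
    (ultraType id (W χ), g (ultraType id (W χ)) (ultraType f (W χ)))
  have hF : Function.Injective F := by
    intro χ χ' h
    have h1 : ultraType (L := lang) id (W χ) = ultraType id (W χ') := congrArg Prod.fst h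
    have h2 := congrArg Prod.snd h
    simp only [F, h1] at h2
    have hmem : ∀ χ, ultraType f (W χ) ∈ coheirs f (ultraType id (W χ)) := fun χ =>
      ultraType_mem_coheirs (Set.image_subset_iff.2 fun φ hφ =>
        (mapParams_mem_ultraType (W χ) φ).2 hφ)
    have h3 := hg _ (ultraType_mem_completeTypes id (W χ')) (h1 ▸ hmem χ) (hmem χ') h2
    ext A
    rw [← hW, ← hW, h3]
  have hle := lift_mk_le_lift_mk_of_injective hF
  simp only [mk_set, mk_prod, lift_id, hcard, lift_power, lift_two, mk_nat, lift_aleph0] at hle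
  have hform : #(lang.Formula (Fin k ⊕ S)) ≤ ℵ₀ := mk_le_aleph0_iff.2 inferInstance
  have h2 : (2 : Cardinal.{u}) ^ #(lang.Formula (Fin k ⊕ S)) * ℵ₀ ≤ 2 ^ (ℵ₀ : Cardinal.{u}) := by
    have h3 : (2 : Cardinal.{u}) ^ #(lang.Formula (Fin k ⊕ S)) ≤ 2 ^ (ℵ₀ : Cardinal.{u}) :=
      power_le_power_left two_ne_zero hform
    refine (mul_le_mul' h3 (cantor _).le).trans (mul_eq_self ?_).le
    exact (cantor _).le
  exact absurd (hle.trans (by simpa using h2)) (by simpa using cantor ((2 : Cardinal.{u}) ^ ℵ₀))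

end Dependent

/-! ### Types above a branch and their co-heirs. -/

section Branches

variable {M : Type u} [lang.Structure M] {flag : Prop}

namespace IsBranch

variable {B : Set M}

theorem InP (hB : IsBranch B) {b : M} (hb : b ∈ B) : InP b := hB.prop.1 hb

theorem mem_of_forall (hB : IsBranch B) {x : M} (hx : Directionality.InP x)
    (h : ∀ b ∈ B, b ≠ x → Lt b x ∨ Lt x b) : x ∈ B := by
  refine hB.le_of_ge (y := insert x B) ⟨Set.insert_subset hx hB.prop.1, ?_⟩
    (Set.subset_insert x B) (Set.mem_insert x B)
  exact hB.prop.2.insert fun b hb hne => (h b hb hne.symm).symm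

theorem total (hB : IsBranch B) {x y : M} (hx : x ∈ B) (hy : y ∈ B) (h : x ≠ y) :
    Lt x y ∨ Lt y x := hB.prop.2 hx hy h

/-- Richness puts a point above any `b`; above a largest point of the branch it would prolong the
branch, against maximality. -/
theorem exists_gt (hB : IsBranch B) (hM : IsTree M flag) (rM : IsRich M flag) {b : M}
    (hb : b ∈ B) : ∃ b' ∈ B, Lt b b' := by
  by_contra! hmax
  obtain ⟨m, -, hm⟩ := rM.exists_Q ∅
  obtain ⟨a, ha, -⟩ := rM.exists_branch m b hm (hB.InP hb) ∅ (by simp)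
  refine hmax a (hB.mem_of_forall (hM.le_of_lt ha).2.1 fun b' hb' _ => Or.inl ?_) ha
  by_cases h : b' = b
  · rwa [h]
  · exact hM.lt_of_lt_of_le ((hB.total hb' hb h).resolve_right (hmax b' hb')) (hM.le_of_lt ha)

theorem nonempty (hB : IsBranch B) (rM : IsRich M flag) : B.Nonempty := by
  by_contra h
  rw [Set.not_nonempty_iff_eq_empty] at h
  obtain ⟨x, hx⟩ := rM.exists_P
  have := hB.mem_of_forall hx (by simp [h])
  simp [h] at this

/-- Every finite set has a point on the branch that is not below any of its elements. -/
theorem exists_forall_not_le (hB : IsBranch B) (hM : IsTree M flag) (rM : IsRich M flag)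
    (A : Finset M) : ∃ b ∈ B, ∀ e ∈ A, ¬ Le b e := by
  classical
  induction A using Finset.induction_on with
  | empty =>
    obtain ⟨b, hb⟩ := hB.nonempty rM
    exact ⟨b, hb, by simp⟩
  | insert e A _ ih =>
    obtain ⟨b, hb, h⟩ := ih
    -- If `e` bounded the whole branch, maximality would put `e` on it, but a branch has no largest
    -- point.
    have he : ∃ b' ∈ B, ¬ Le b' e := by
      by_cases heB : e ∈ B
      · obtain ⟨b', hb', hlt⟩ := hB.exists_gt hM rM heB
        exact ⟨b', hb', hM.not_le_of_lt hlt⟩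
      · by_contra! hall
        refine heB (hB.mem_of_forall (hall b hb).2.1 fun b' hb' hne => Or.inl ?_)
        exact (hM.lt_iff _ _).2 ⟨hall b' hb', hne⟩
    obtain ⟨b', hb', h'⟩ := he
    have hmax : ∃ c ∈ B, Le b c ∧ Le b' c := by
      by_cases hbb : b = b'
      · subst hbb
        exact ⟨b, hb, hM.le_refl (hB.InP hb), hM.le_refl (hB.InP hb)⟩
      · rcases hB.total hb hb' hbb with hlt | hlt
        · exact ⟨b', hb', hM.le_of_lt hlt, hM.le_refl (hB.InP hb')⟩
        · exact ⟨b, hb, hM.le_refl (hB.InP hb), hM.le_of_lt hlt⟩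
    obtain ⟨c, hc, hbc, hbc'⟩ := hmax
    refine ⟨c, hc, fun x hx hcx => ?_⟩
    rcases Finset.mem_insert.1 hx with rfl | hx
    · exact h' (hM.le_trans hbc' hcx)
    · exact h x hx (hM.le_trans hbc hcx)

/-- A point above a branch of any given colour is approximated in the model. -/
theorem exists_ultrafilter (hB : IsBranch B) (hM : IsTree M True) (rM : IsRich M True) {m : M}
    (hm : InQ m) : ∃ U : Ultrafilter (Fin 1 → M), 
      (∀ b ∈ B, ∀ᶠ a in (U : Filter (Fin 1 → M)), Lt b (a 0)) ∧
        ∀ᶠ a in (U : Filter (Fin 1 → M)), Hf (a 0) = m := by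
  classical
  obtain ⟨U, hU⟩ := exists_ultrafilter_of_finset
    (fun b : B => {a : Fin 1 → M | Lt b.1 (a 0) ∧ Hf (a 0) = m}) (by
    intro s
    obtain ⟨b, hb, h⟩ := hB.exists_forall_not_le hM rM (s.image Subtype.val)
    obtain ⟨a, ha, -, ha'⟩ := rM.exists_branch m b hm (hB.InP hb) ∅ (by simp)
    refine ⟨fun _ => a, fun e he => ⟨?_, ha' trivial⟩⟩
    have h1 := h e.1 (Finset.mem_image_of_mem _ he)
    have hne : e.1 ≠ b := by
      rintro h2
      exact h1 (by rw [h2]; exact hM.le_refl (hB.InP hb))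
    have := (hB.total e.2 hb hne).resolve_right fun h2 => h1 (hM.le_of_lt h2)
    exact hM.lt_of_lt_of_le this (hM.le_of_lt ha))
  obtain ⟨b, hb⟩ := hB.nonempty rM
  exact ⟨U, fun b hb => Filter.mem_of_superset (hU ⟨b, hb⟩) fun a ha => ha.1,
    Filter.mem_of_superset (hU ⟨b, hb⟩) fun a ha => ha.2⟩

end IsBranch

/-- Every tree has a branch. -/
theorem exists_isBranch (M : Type u) [lang.Structure M] : ∃ B : Set M, IsBranch B := by
  obtain ⟨B, -, hB⟩ := zorn_subset_nonempty
    {B' : Set M | B' ⊆ setP M ∧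
      IsChain (fun a b : M => Structure.RelMap (L := lang) Rel.lt ![a, b]) B'} (by
    intro c hc hchain hne
    refine ⟨⋃₀ c, ⟨Set.sUnion_subset fun s hs => (hc hs).1, ?_⟩, fun s hs =>
      Set.subset_sUnion_of_mem hs⟩
    rintro x ⟨s, hs, hx⟩ y ⟨t, ht, hy⟩ hxy
    rcases hchain.total hs ht with h | h
    · exact (hc ht).2 (h hx) hy hxy
    · exact (hc hs).2 hx (h hy) hxy) ∅ ⟨Set.empty_subset _, by simp [IsChain]⟩
  exact ⟨B, hB⟩

variable {N : Type u} [lang.Structure N]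

@[simp]
theorem realize_gtFormula {M : Type u} (b : M) (a : Fin 1 → N) (g : M → N) :
    (gtFormula b).Realize (Sum.elim a g) ↔ Lt (g b) (a 0) :=
  Formula.realize_rel₂

@[simp]
theorem realize_hEqFormula {M : Type u} (m : M) (a : Fin 1 → N) (g : M → N) :
    (hEqFormula m).Realize (Sum.elim a g) ↔ Hf (a 0) = g m := by
  simp [hEqFormula]

/-- Two points of the same colour in the same cone above `b` are equivalent over parameters
outside the cone. -/
theorem atomEq_of_cone (hM : IsTree M True) {b y z : M} (hy : Lt b y) (hz : Lt b z)
    (hH : Hf y = Hf z) {β : Type*} (ρ : β → M) (hρ : ∀ i, ¬ Le b (ρ i)) :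
    AtomEq True (Sum.elim (fun _ : Fin 1 => y) ρ) (Sum.elim (fun _ : Fin 1 => z) ρ) := by
  have hyP := (hM.le_of_lt hy).2.1
  have hzP := (hM.le_of_lt hz).2.1
  have hbP := (hM.le_of_lt hy).1
  have hmeet : ∀ {y}, Lt b y → ∀ i, InP (ρ i) → meet y (ρ i) = meet b (ρ i) := fun hy i hi =>
    hM.meet_eq_of_not_le (hM.le_of_lt hy) hi (hρ i)
  have hne : ∀ {y}, Lt b y → ∀ i, y ≠ ρ i := fun hy i h => hρ i (h ▸ hM.le_of_lt hy)
  have hnle : ∀ {y}, Lt b y → ∀ i, ¬ Le y (ρ i) := fun hy i h =>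
    hρ i (hM.le_trans (hM.le_of_lt hy) h)
  have hlow : ∀ {y w}, Lt b y → ¬ Le b w → (Le w y ↔ Le w b) := fun hy hw =>
    ⟨fun h => (hM.le_total _ _ _ h (hM.le_of_lt hy)).resolve_right hw,
      fun h => hM.le_trans h (hM.le_of_lt hy)⟩
  constructor
  · rintro (_ | i)
    · exact iff_of_true hyP hzP
    · exact Iff.rfl
  · rintro (_ | i)
    · exact iff_of_false (hM.disj _ hyP) (hM.disj _ hzP)
    · exact Iff.rfl
  · rintro (_ | i) (_ | k)
    · simp
    · exact iff_of_false (hne hy k) (hne hz k)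
    · exact iff_of_false (hne hy i).symm (hne hz i).symm
    · exact Iff.rfl
  · rintro (_ | i) (_ | k) (_ | l) hi hk hl <;> simp only [Sum.elim_inl, Sum.elim_inr] at hi hk hl ⊢
    · rw [hM.meet_self, hM.meet_self]
      exact iff_of_true (hM.le_refl hyP) (hM.le_refl hzP)
    · rw [hM.meet_self, hM.meet_self]
      exact iff_of_false (hnle hy l) (hnle hz l)
    · exact iff_of_true (hM.meet_le_left hyP hk) (hM.meet_le_left hzP hk)
    · rw [hmeet hy k hk, hmeet hz k hk]
    · exact iff_of_true (hM.meet_le_right hi hyP) (hM.meet_le_right hi hzP)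
    · rw [hM.meet_comm _ _ hi hyP, hM.meet_comm _ _ hi hzP, hmeet hy i hi, hmeet hz i hi]
    · have h1 : ¬ Le b (meet (ρ i) (ρ k)) := fun h => hρ i (hM.le_trans h (hM.meet_le_left hi hk))
      rw [hlow hy h1, hlow hz h1]
  · have key : ∀ i k : Fin 1 ⊕ β, OkPair (Sum.elim (fun _ : Fin 1 => y) ρ) i k →
        Hf (meet (Sum.elim (fun _ : Fin 1 => y) ρ i) (Sum.elim (fun _ : Fin 1 => y) ρ k)) =
          Hf (meet (Sum.elim (fun _ : Fin 1 => z) ρ i) (Sum.elim (fun _ : Fin 1 => z) ρ k)) := by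
      rintro (_ | i) (_ | k) h <;> simp only [Sum.elim_inl, Sum.elim_inr]
      · rw [hM.meet_self, hM.meet_self, hH]
      · have := (h.resolve_left (by simp)).2
        rw [hmeet hy k this, hmeet hz k this]
      · have hi : InP (ρ i) := (h.resolve_left (by simp)).1
        rw [hM.meet_comm _ _ hi hyP, hM.meet_comm _ _ hi hzP, hmeet hy i hi, hmeet hz i hi]
    intro _ i k i' k' h h'
    rw [key i k h, key i' k' h']

variable {C : Type u} [lang.Structure C]

/-- The formula `H(x ∧ y₀) = y₁`. -/
def meetColourFormula : lang.Formula (Fin 1 ⊕ ℕ) :=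
  Term.equal (tH (tMeet (Term.var (Sum.inl 0)) (Term.var (Sum.inr 0)))) (Term.var (Sum.inr 1))

theorem realize_inst_meetColourFormula (b : ℕ → C) (a : Fin 1 → C) :
    (inst meetColourFormula b).Realize (Sum.elim a id) ↔ Hf (meet (a 0) (b 0)) = b 1 := by
  simp [inst, meetColourFormula, Formula.realize_relabel]

/-- Over a branch there is a coheir for each possible colour of the limit. -/
theorem exists_coheirs_of_branch {f : M ↪ₑ[lang] C} (hM : IsTree M True) (rM : IsRich M True)
    (hf : IsMonsterOver f) {B : Set M} (hB : IsBranch B) {m : M} (hm : InQ m)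
    {p : Set (lang.Formula (Fin 1 ⊕ M))} (hp : p ∈ completeTypes lang M 1)
    (hpB : ∀ b ∈ B, gtFormula b ∈ p) (hpm : hEqFormula m ∈ p) :
    ∃ c : C, ∀ m' : M, InQ m' → ∃ q ∈ coheirs f p,
      inst meetColourFormula (fun i => if i = 0 then c else f m') ∈ q := by
  classical
  have hC : IsTree C True := hM.of_elementarilyEquivalent f.elementarilyEquivalent
  obtain ⟨U₀, hU₀, -⟩ := hB.exists_ultrafilter hM rM hm
  -- This is the use of saturation: a point of the monster above the entire branch, against which
  -- the splitting level of a co-heir can be measured.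
  obtain ⟨c, hc⟩ := hf (f '' B) (Order.lt_succ_iff.2 (mk_image_le.trans (mk_set_le B))) 1
    (Set.range gtFormula) (by
      refine (ultraType_finSatIn f U₀).comp.mono ?_
      rintro _ ⟨_, ⟨⟨_, b, hb, rfl⟩, rfl⟩, rfl⟩
      refine Filter.mem_of_superset (hU₀ b hb) fun a ha => ?_
      rw [Set.mem_ofPred_eq, realize_mapParams, realize_gtFormula]
      exact (embedding_Lt f.toEmbedding b (a 0)).2 ha)
  have hBc : ∀ b ∈ B, Lt (f b) (c 0) := by
    intro b hb
    have h := hc _ ⟨⟨f b, b, hb, rfl⟩, rfl⟩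
    rwa [realize_gtFormula] at h
  refine ⟨c 0, fun m' hm' => ?_⟩
  set ψ : lang.Formula (Fin 1 ⊕ C) :=
    inst meetColourFormula (fun i => if i = 0 then c 0 else f m') with hψ
  suffices h : FinSatIn f (insert ψ (mapParams f '' p)) by
    obtain ⟨U, hU⟩ := h.exists_ultraType
    exact ⟨_, ultraType_mem_coheirs ((Set.subset_insert _ _).trans hU),
      hU (Set.mem_insert _ _)⟩
  intro s hs
  obtain ⟨V, rfl⟩ := exists_eq_ultraType_of_mem_completeTypes hp
  obtain ⟨t, ht, hst⟩ : ∃ t : Finset (lang.Formula (Fin 1 ⊕ M)),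
      (t : Set (lang.Formula (Fin 1 ⊕ M))) ⊆ ultraType id V ∧
      ∀ φ ∈ s, φ = ψ ∨ ∃ χ ∈ t, mapParams f χ = φ := by
    obtain ⟨t, ht, h⟩ := Finset.subset_set_image_iff.1
      (show ((s.filter (· ≠ ψ) : Finset _) : Set (lang.Formula (Fin 1 ⊕ C))) ⊆
        mapParams f '' ultraType id V by
        intro φ hφ
        have hφ := Finset.mem_filter.1 (Finset.mem_coe.1 hφ)
        exact (hs hφ.1).resolve_left hφ.2)
    refine ⟨t, ht, fun φ hφ => or_iff_not_imp_left.2 fun hne => ?_⟩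
    have : φ ∈ t.image (mapParams f) := h ▸ Finset.mem_filter.2 ⟨hφ, hne⟩
    simpa using this
  choose F hF using fun φ : lang.Formula (Fin 1 ⊕ M) => WitnessName.exists_finset_support (M := M) φ
  -- `A` holds the parameters of the finite part of `p`, and also `m`, which later replaces the
  -- parameters that do not matter. The point `b` of the branch is chosen below none of them.
  let A : Finset M := insert m (t.biUnion fun φ => (F φ).biUnion fun i =>
    Sum.elim (fun _ => ∅) (fun e => {e}) i)
  obtain ⟨b, hb, hbA⟩ := hB.exists_forall_not_le hM rM A
  obtain ⟨a₁, ha₁⟩ := ultraType_finSatIn (id : M → M) V (insert (gtFormula b) (insert (hEqFormula m) t))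
    (by
      rw [Finset.coe_insert, Finset.coe_insert]
      exact Set.insert_subset (hpB b hb) (Set.insert_subset hpm ht))
  have h1 : Lt b (a₁ 0) := (realize_gtFormula _ _ _).1 (ha₁ _ (by simp))
  have h2 : Hf (a₁ 0) = m := (realize_hEqFormula _ _ _).1 (ha₁ _ (by simp))
  -- Choose `b < b₁ < b₂` with `b₂` on the branch and `b₁` of colour `m'`, and let `a₂`, of colour
  -- `m`, split from `b₂` at `b₁`. Since `c` is above `b₂`, also `a₂ ∧ c = b₁`, which has colour
  -- `m'`.
  obtain ⟨b₂, hb₂, hbb₂⟩ := hB.exists_gt hM rM hb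
  obtain ⟨b₁, hb₁₂, hbb₁, hHb₁⟩ := rM.exists_between m' b₂ hm' (hB.InP hb₂) {b} (by simpa using hbb₂)
  have hb₁P := (hM.le_of_lt hb₁₂).1
  obtain ⟨a₂, ha₂, hmeet, hHa₂⟩ := rM.exists_branch m b₁ hm hb₁P {b₂} (by simpa using hb₁₂)
  have hmeet := hmeet b₂ (by simp)
  have hba₂ : Lt b a₂ := hM.lt_of_lt_of_le (hbb₁ b (by simp)) (hM.le_of_lt ha₂)
  have ha₂P := (hM.le_of_lt ha₂).2.1
  refine ⟨fun _ => a₂, fun φ hφ => ?_⟩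
  rcases hst φ hφ with rfl | ⟨χ, hχ, rfl⟩
  · rw [hψ, realize_inst_meetColourFormula]
    have hcb₂ := hBc b₂ hb₂
    have e1 : meet (f a₂) (f b₂) = f b₁ := by
      rw [← hmeet]; exact (embedding_meet f.toEmbedding a₂ b₂).symm
    have hfa₂ : InP (f a₂) := (embedding_InP f.toEmbedding a₂).2 ha₂P
    have hfb₂ : InP (f b₂) := (hC.le_of_lt hcb₂).1
    have hcP : InP (c 0) := (hC.le_of_lt hcb₂).2.1
    have e2 : meet (f a₂) (c 0) = f b₁ := by
      rw [hC.meet_comm _ _ hfa₂ hcP, hC.meet_eq_of_not_le (hC.le_of_lt hcb₂) hfa₂,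
        hC.meet_comm _ _ hfb₂ hfa₂, e1]
      intro hle
      have h3 : meet (f a₂) (f b₂) = f b₂ := hC.meet_eq_right hle
      rw [e1] at h3
      exact hM.ne_of_lt hb₁₂ (f.injective h3)
    have e3 : f (Hf b₁) = Hf (f b₁) := embedding_Hf f.toEmbedding b₁
    simp only [if_true, one_ne_zero, if_false, e2, ← e3, hHb₁ trivial]
  · rw [realize_mapParams]
    -- `a₁` satisfies the finite part of `p`, and `a₁`, `a₂` both lie above `b` with colour `m`. As
    -- `b` is below no parameter, `atomEq_of_cone` and quantifier elimination transfer the formulas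
    -- to `a₂`.
    have h3 : χ.Realize (Sum.elim (fun _ : Fin 1 => a₂) (id : M → M)) := by
      let ρ : M → M := fun e => if e ∈ A then e else m
      have hρ : ∀ a : Fin 1 → M, χ.Realize (Sum.elim a id) ↔ χ.Realize (Sum.elim a ρ) := by
        intro a
        refine hF χ _ _ ?_
        rintro (i | e) he
        · rfl
        · have : e ∈ A := Finset.mem_insert_of_mem (Finset.mem_biUnion.2 ⟨χ, hχ,
            Finset.mem_biUnion.2 ⟨Sum.inr e, he, by simp⟩⟩)
          simp [ρ, this]
      have h4 : χ.Realize (Sum.elim a₁ id) := ha₁ χ (by simp [hχ])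
      rw [hρ] at h4 ⊢
      have h5 : a₁ = fun _ => a₁ 0 := by
        funext i; rw [Subsingleton.elim i 0]
      rw [h5] at h4
      refine ((atomEq_of_cone hM h1 hba₂ (h2.trans (hHa₂ trivial).symm) ρ
        fun e => ?_).realize_iff hM hM rM rM χ).1 h4
      refine hbA _ ?_
      by_cases he : e ∈ A
      · simp only [ρ, if_pos he, he]
      · simp only [ρ, if_neg he]
        exact Finset.mem_insert_self _ _
    rw [← f.map_formula] at h3
    exact (iff_of_eq (congrArg _ (by funext x; rcases x with x | x <;> rfl))).1 h3

end Branches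

/-! ### Medium directionality. -/

section Directionality

variable {M C : Type u} [lang.Structure M] [lang.Structure C]

/-- There is a type above any branch with any given colour. -/
theorem exists_completeType_of_branch (hM : IsTree M True) (rM : IsRich M True) {B : Set M}
    (hB : IsBranch B) {m : M} (hm : InQ m) : ∃ p ∈ completeTypes lang M 1,
      (∀ b ∈ B, gtFormula b ∈ p) ∧ hEqFormula m ∈ p := by
  obtain ⟨U, h1, h2⟩ := hB.exists_ultrafilter hM rM hm
  refine ⟨_, ultraType_mem_completeTypes id U, fun b hb => ?_, ?_⟩
  · exact Filter.mem_of_superset (h1 b hb) fun a ha => (realize_gtFormula b a id).2 ha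
  · exact Filter.mem_of_superset h2 fun a ha => (realize_hEqFormula m a id).2 ha

theorem mk_deltaCoheirs_le_mk_coheirs {L : FirstOrder.Language.{0, 0}} {M C : Type u}
    [L.Structure M] [L.Structure C] (f : M ↪ₑ[L] C) {n : ℕ} (p : Set (L.Formula (Fin n ⊕ M)))
    (Δ : Set (L.Formula (Fin n ⊕ ℕ))) : #(deltaCoheirs f Δ p) ≤ #(coheirs f p) :=
  (mk_le_mk_of_subset (deltaCoheirs_subset_image f p Δ)).trans mk_image_le

/-- The types above a branch have at least `|Q|` coheirs for a single formula. -/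
theorem mk_setQ_le_mk_deltaCoheirs {f : M ↪ₑ[lang] C} (hM : IsTree M True) (rM : IsRich M True)
    (hf : IsMonsterOver f) {B : Set M} (hB : IsBranch B) {m : M} (hm : InQ m)
    {p : Set (lang.Formula (Fin 1 ⊕ M))} (hp : p ∈ completeTypes lang M 1)
    (hpB : ∀ b ∈ B, gtFormula b ∈ p) (hpm : hEqFormula m ∈ p) :
    #(setQ M) ≤ #(deltaCoheirs f {meetColourFormula} p) := by
  obtain ⟨c, hc⟩ := exists_coheirs_of_branch hM rM hf hB hm hp hpB hpm
  choose! q hq hcq using hc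
  refine mk_le_of_injective (f := fun m' : setQ M =>
    (⟨_, inter_mem_deltaCoheirs {meetColourFormula} (hq m' m'.2)⟩ :
      deltaCoheirs f {meetColourFormula} p)) ?_
  intro m₁ m₂ h
  have h1 := Set.ext_iff.1 (congrArg Subtype.val h)
    (inst meetColourFormula fun i => if i = 0 then c else f m₁)
  have h2 := (h1.1 ⟨hcq m₁ m₁.2, _, rfl, _, Or.inl rfl⟩).1
  obtain ⟨U, hU⟩ := exists_eq_ultraType_of_mem_coheirs (hq m₂ m₂.2)
  have h3 := hcq m₂ m₂.2
  rw [hU] at h2 h3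
  -- If two co-heirs had the same restriction, one tuple would satisfy both colour formulas, so `a ∧
  -- c` would have both colours.
  obtain ⟨a, ha1, ha2⟩ := (Filter.Eventually.and h2 h3).exists
  rw [realize_inst_meetColourFormula] at ha1 ha2
  simp only [if_true, one_ne_zero, if_false] at ha1 ha2
  exact Subtype.ext (f.injective (ha1.symm.trans ha2))

/-- A structure all of whose points are in `Q`. -/
@[reducible]
def allQ (A : Type u) : lang.Structure A where
  funMap {n} s x := match n, s, x with
    | _, Func.meet, x => x 0
    | _, Func.H, x => x 0
  RelMap {n} r _ := match n, r with
    | _, Rel.P => False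
    | _, Rel.Q => True
    | _, Rel.lt => False

theorem isTree_allQ (A : Type u) : letI := allQ A; IsTree A True := by
  let := allQ A
  have hP : ∀ x : A, ¬ InP x := fun x h => h
  have hle : ∀ x y : A, ¬ Le x y := fun x y h => h.1
  exact
  { disj := fun x h => (hP x h).elim
    H_mem := fun _ x h => (hP x h).elim
    H_of_not := fun x _ => rfl
    H_id := fun h => (h trivial).elim
    lt_iff := fun x y => iff_of_false (fun h => h) fun h => hle x y h.1
    meet_mem := fun x y h => (hP x h).elim
    meet_comm := fun x y h => (hP x h).elim
    meet_self := fun x => rfl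
    meet_assoc := fun x y z h => (hP x h).elim
    le_total := fun x y z h => (hle _ _ h).elim
    meet_of_not := fun x y _ => rfl }

variable {T : lang.Theory}

/-- There are models of any infinite cardinality with equally many points in `Q`. -/
theorem IsModelCompletion.exists_model (hT : IsModelCompletion.{u} T univTheory)
    {κ : Cardinal.{u}} (hκ : ℵ₀ ≤ κ) : ∃ (M : Type u) (_ : lang.Structure M),
      Nonempty M ∧ M ⊨ T ∧ #M = κ ∧ κ ≤ #(setQ M) := by
  -- A set of size `κ` lying entirely in `Q` is a model of the universal theory. Embedding it and
  -- then passing down to size `κ` around its image keeps `Q` large.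
  let := allQ κ.out
  have hκ' : #κ.out = κ := mk_out κ
  have : Infinite κ.out := by rw [infinite_iff, hκ']; exact hκ
  obtain ⟨N, _, hN, ⟨e⟩⟩ := hT.exists_embedding κ.out (isTree_allQ _).model_univTheory
  have hN' : κ ≤ #N := by rw [← hκ']; exact mk_le_of_injective e.injective
  obtain ⟨S, hS, hc⟩ := exists_elementarySubstructure_card_eq lang (Set.range e) κ hκ
    (by simpa [hκ'] using mk_range_le (f := e)) (by simpa using (lift_le_aleph0.2 card_lang_le).trans hκ)
    (by simpa using hN')
  have hNe : Nonempty S := ⟨⟨e (Classical.arbitrary _), hS ⟨_, rfl⟩⟩⟩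
  refine ⟨S, inferInstance, hNe, (S.theory_model_iff T).2 hN, by simpa using hc, ?_⟩
  rw [← hκ']
  refine mk_le_of_injective (f := fun x : κ.out => (⟨⟨e x, hS ⟨x, rfl⟩⟩, ?_⟩ : setQ S)) ?_
  · have h1 : InQ (e x) := (embedding_InQ e x).2 trivial
    exact (embedding_InQ S.subtype.toEmbedding _).1 h1
  · intro x y h
    exact e.injective (congrArg (fun z : setQ S => (z.1 : N)) h)

/-- The bound `κ` holds for all types by `mk_coheirs_le`. It is attained by a type above a branch in
a model with `κ` colours, so the supremum is a maximum. -/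
theorem IsModelCompletion.isMedium (hT : IsModelCompletion.{u} T univTheory) : IsMedium.{u} T := by
  intro κ hκ
  have hκ : ℵ₀ ≤ κ := (le_max_left _ _).trans hκ
  constructor
  · rintro _ ⟨M, C, _, _, f, n, p, Δ, hMne, hMT, rfl, -, hp, -, rfl⟩
    have hM := hT.isTree M
    have rM := hT.isRich M
    have := rM.infinite
    have : Nonempty C := hMne.map f
    exact (mk_deltaCoheirs_le_mk_coheirs f p Δ).trans
      (mk_coheirs_le (hM.of_elementarilyEquivalent f.elementarilyEquivalent)
        (rM.of_elementarilyEquivalent f.elementarilyEquivalent) hp)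
  · intro κ' hκ'
    obtain ⟨M, _, hMne, hMT, hcard, hQ⟩ := hT.exists_model hκ
    have hM := hT.isTree M
    have rM := hT.isRich M
    have := rM.infinite
    obtain ⟨C, _, f, hf⟩ := exists_isMonsterOver (L := lang) M
    obtain ⟨B, hB⟩ := exists_isBranch M
    obtain ⟨m, -, hm⟩ := rM.exists_Q ∅
    obtain ⟨p, hp, hpB, hpm⟩ := exists_completeType_of_branch hM rM hB hm
    exact (hQ.trans (mk_setQ_le_mk_deltaCoheirs hM rM hf hB hm hp hpB hpm)).trans
      (hκ' ⟨M, C, _, _, f, 1, p, _, hMne, hMT, hcard, hf, hp, Set.finite_singleton _, rfl⟩)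

end Directionality

/-! ### The reduct without `H` as a tree with `H = id`. -/

section Erase

variable {α : Type*}

/-- The structure with `H = id` on a structure in the language without `H`. -/
@[reducible]
def withId (M : Type*) [lang'.Structure M] : lang.Structure M where
  funMap {n} s x := match n, s, x with
    | _, Func.meet, x => Structure.funMap (L := lang') Func'.meet x
    | _, Func.H, x => x 0
  RelMap r x := Structure.RelMap (L := lang') r x

/-- The application of a function symbol, where `H` is read as the identity. -/
def eraseFunc {n : ℕ} (s : Func n) (ts : Fin n → lang'.Term α) : lang'.Term α :=
  match n, s, ts with
    | _, Func.meet, ts => Term.func (L := lang') Func'.meet ts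
    | _, Func.H, ts => ts 0

/-- Removing `H` from a term. -/
def eraseTerm : lang.Term α → lang'.Term α
  | .var a => .var a
  | .func s ts => eraseFunc s fun i => eraseTerm (ts i)

/-- Removing `H` from a formula. -/
def erase {n : ℕ} (φ : lang.BoundedFormula α n) : lang'.BoundedFormula α n :=
  φ.mapTermRel (fun _ t => eraseTerm t) (fun _ r => r) fun _ => id

theorem realize_eraseTerm {M : Type*} [lang'.Structure M] (t : lang.Term α) (v : α → M) :
    (eraseTerm t).realize v = @Term.realize lang M (withId M) α v t := by
  induction t with
  | var a => rfl
  | func s ts ih =>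
    cases s with
    | meet =>
      exact congrArg (Structure.funMap (L := lang') Func'.meet) (funext ih)
    | H =>
      exact ih 0

theorem realize_erase {M : Type*} [lang'.Structure M] {n : ℕ} (φ : lang.BoundedFormula α n)
    (v : α → M) (xs : Fin n → M) :
    (erase φ).Realize v xs ↔ @BoundedFormula.Realize lang M (withId M) α n φ v xs := by
  let := withId M
  exact BoundedFormula.realize_mapTermRel_id (fun n t xs => realize_eraseTerm t _)
    fun n R x => rfl

theorem isExpansionOn_withId (M : Type*) [lang'.Structure M] :
    letI := withId M; incl.IsExpansionOn M := by
  let := withId M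
  refine ⟨fun {n} s x => ?_, fun r x => rfl⟩
  cases s
  rfl

theorem isTree_withId {N : Type*} [lang.Structure N] (h : IsTree N True) :
    @IsTree N (@withId N (incl.reduct N)) False := by
  exact @IsTree.mk N (@withId N (incl.reduct N)) False h.disj (fun h => h.elim)
    (fun _ _ => rfl) (fun _ _ => rfl) h.lt_iff h.meet_mem h.meet_comm h.meet_self h.meet_assoc
    h.le_total h.meet_of_not

theorem isRich_withId {N : Type*} [lang.Structure N] (h : IsRich N True) :
    @IsRich N (@withId N (incl.reduct N)) False := by
  refine @IsRich.mk N (@withId N (incl.reduct N)) False h.exists_other h.exists_Q h.exists_P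
    (fun m x hm hx E hE => ?_) fun m d hm hd F hF => ?_
  · obtain ⟨y, h1, h2, -⟩ := h.exists_between m x hm hx E hE
    exact ⟨y, h1, h2, False.elim⟩
  · obtain ⟨y, h1, h2, -⟩ := h.exists_branch m d hm hd F hF
    exact ⟨y, h1, h2, False.elim⟩

variable {T : lang.Theory}

/-- Models of the reduct of a model completion become rich trees with `H = id`. -/
theorem IsModelCompletion.withId_model (hT : IsModelCompletion.{u} T univTheory)
    (M : Type u) [lang'.Structure M] [Nonempty M] [hM : M ⊨ restrict incl T] :
    @IsTree M (withId M) False ∧ @IsRich M (withId M) False := by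
  have key : ∀ σ ∈ flagTheory False ∪ richTheory False, erase σ ∈ restrict incl T := by
    intro σ hσ
    rw [restrict, Set.mem_ofPred_eq, Theory.models_sentence_iff]
    intro N
    -- Semantic consequence is tested on models in a fixed universe, while the hypothesis on `T`
    -- concerns models in `Type u`; an isomorphic lifted copy bridges the two.
    let : lang.Structure (ULift.{u} N) := Equiv.ulift.symm.inducedStructure
    have hN : N ≅[lang] ULift.{u} N := (Equiv.ulift.{u}.symm.inducedStructureEquiv
      (L := lang) (M := N)).toElementaryEmbedding.elementarilyEquivalent
    have : ULift.{u} N ⊨ T := hN.theory_model_iff.1 N.is_model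
    have hNt := isTree_withId ((hT.isTree (ULift.{u} N)).of_elementarilyEquivalent hN.symm)
    have hNr := isRich_withId ((hT.isRich (ULift.{u} N)).of_elementarilyEquivalent hN.symm)
    let := incl.reduct N
    rw [LHom.realize_onSentence]
    refine (realize_erase σ _ _).2 ?_
    let := withId N
    exact ((model_flagTheory_iff.2 hNt).union
      ((model_richTheory_iff _).2 hNr)).realize_of_mem σ hσ
  let := withId M
  have h : M ⊨ flagTheory False ∪ richTheory False := by
    refine (Theory.model_iff _).2 fun σ hσ => ?_
    exact (realize_erase σ _ _).1 (hM.realize_of_mem _ (key σ hσ))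
  exact ⟨model_flagTheory_iff.1 (h.mono Set.subset_union_left),
    (model_richTheory_iff _).1 (h.mono Set.subset_union_right)⟩

/-- Reading `H` as the identity adds no definable sets, so the elementary embedding and the types
transfer to the full language. There `finite_ultraTypes` applies, since no colours have to be
recorded, and every co-heir in the small language is the restriction of one of those finitely many
limit types. -/
theorem IsModelCompletion.isSmall_restrict (hT : IsModelCompletion.{u} T univTheory) :
    IsSmall.{u} (restrict incl T) := by
  intro M C _ _ _ hM f _ n p hp Δ _
  refine (Set.Finite.image _ ?_).subset (deltaCoheirs_subset_image f p Δ)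
  obtain ⟨hMt, hMr⟩ := hT.withId_model M
  let := withId M
  let := withId C
  have : incl.IsExpansionOn C := isExpansionOn_withId C
  let g : M ↪ₑ[lang] C :=
    { toFun := f
      map_formula' := fun n φ x => by
        have h1 := realize_erase φ x default
        have h2 := realize_erase φ (f ∘ x) default
        exact h2.symm.trans ((f.map_formula (erase φ) x).trans h1) }
  have hg := g.elementarilyEquivalent
  have : Nonempty C := ‹Nonempty M›.map f
  refine ((finite_ultraTypes (f := g) (hMt.of_elementarilyEquivalent hg)
    (hMr.of_elementarilyEquivalent hg) {φ | erase φ ∈ p}).image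
    fun q => {φ | incl.onFormula φ ∈ q}).subset ?_
  intro q hq
  obtain ⟨U, rfl⟩ := exists_eq_ultraType_of_mem_coheirs hq
  refine ⟨ultraType g U, ⟨U, ?_, rfl⟩, ?_⟩
  · rw [eq_of_mapParams_subset hp hq.2.1]
    ext φ
    exact Filter.eventually_congr (Filter.Eventually.of_forall fun a =>
      (realize_erase φ _ default).symm)
  · ext φ
    exact Filter.eventually_congr (Filter.Eventually.of_forall fun a =>
      incl.realize_onFormula φ)

end Erase

end Directionality

theorem mainTheorem11 :
    (∃ T : Directionality.lang.Theory,
      Directionality.IsModelCompletion.{u} T Directionality.univTheory) ∧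
    ∀ T : Directionality.lang.Theory,
      Directionality.IsModelCompletion.{u} T Directionality.univTheory →
      Directionality.IsDependent.{u} T ∧
      Directionality.IsMedium.{u} T ∧
      (∀ (M C : Type u) [Directionality.lang.Structure M] [Directionality.lang.Structure C]
        [Nonempty M] [M ⊨ T] (f : M ↪ₑ[Directionality.lang] C),
        Directionality.IsMonsterOver f →
          (∃ p ∈ Directionality.completeTypes Directionality.lang M 1,
            #(Directionality.setQ M) ≤ #(Directionality.coheirs f p)) ∧
          (∀ B : Set M, Directionality.IsBranch B → ∀ m ∈ Directionality.setQ M,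
            (∃ p ∈ Directionality.completeTypes Directionality.lang M 1,
              (∀ b ∈ B, Directionality.gtFormula b ∈ p) ∧ Directionality.hEqFormula m ∈ p) ∧
            ∀ p ∈ Directionality.completeTypes Directionality.lang M 1,
              (∀ b ∈ B, Directionality.gtFormula b ∈ p) → Directionality.hEqFormula m ∈ p →
                #(Directionality.setQ M) ≤ #(Directionality.coheirs f p)) ∧
          ∀ (n : ℕ), ∀ p ∈ Directionality.completeTypes Directionality.lang M n,
            #(Directionality.coheirs f p) ≤ #M ^ (ℵ₀ : Cardinal.{u})) ∧
      Directionality.IsSmall.{u} (Directionality.restrict Directionality.incl T) := by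
  refine ⟨⟨_, Directionality.isModelCompletion_richTheory⟩, fun T hT => ⟨?_, hT.isMedium, ?_,
    hT.isSmall_restrict⟩⟩
  · intro M _ _ _ k l φ
    exact Directionality.isDependent_of_isRich (hT.isTree M) (hT.isRich M) φ
  · intro M C _ _ _ _ f hf
    have hM := hT.isTree M
    have rM := hT.isRich M
    have : Infinite M := rM.infinite
    have : Nonempty C := ‹Nonempty M›.map f
    have key : ∀ B : Set M, Directionality.IsBranch B → ∀ m ∈ Directionality.setQ M,
        ∀ p ∈ Directionality.completeTypes Directionality.lang M 1,
          (∀ b ∈ B, Directionality.gtFormula b ∈ p) → Directionality.hEqFormula m ∈ p →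
            #(Directionality.setQ M) ≤ #(Directionality.coheirs f p) :=
      fun B hB m hm p hp hpB hpm =>
        (Directionality.mk_setQ_le_mk_deltaCoheirs hM rM hf hB hm hp hpB hpm).trans
          (Directionality.mk_deltaCoheirs_le_mk_coheirs f p _)
    refine ⟨?_, fun B hB m hm =>
      ⟨Directionality.exists_completeType_of_branch hM rM hB hm, key B hB m hm⟩, fun n p hp => ?_⟩
    · obtain ⟨B, hB⟩ := Directionality.exists_isBranch M
      obtain ⟨m, -, hm⟩ := rM.exists_Q ∅
      obtain ⟨p, hp, hpB, hpm⟩ := Directionality.exists_completeType_of_branch hM rM hB hm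
      exact ⟨p, hp, key B hB m hm p hp hpB hpm⟩
    · refine (Directionality.mk_coheirs_le (hM.of_elementarilyEquivalent f.elementarilyEquivalent)
        (rM.of_elementarilyEquivalent f.elementarilyEquivalent) hp).trans ?_
      exact self_le_power _ one_le_aleph0
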